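/- **Conventions.** For a real Lie algebra $\mathfrak g$ put $(d\alpha)(x,y)=-\alpha([x,y])$. A complex structure on $\mathfrak g$ is an endomorphism $J$ with $J^2=-1$ and $[x,y]+J[Jx,y]+J[x,Jy]-[Jx,Jy]=0$; $\mathfrak g^{1,0}$ is the $i$-eigenspace of $J$ on $\mathfrak g_{\mathbb C}$, $\mathfrak g^{*(1,0)}$ is the space of forms with $\omega\circ J=i\omega$, and $\mathfrak g^{*(0,1)}$ is its conjugate. $J$ is nilpotent if $\mathfrak g^{*(1,0)}$ has a basis with $d\omega^p\in\Lambda^2\langle\omega^j,\bar\omega^j: j<p\rangle$ for all $p$. $\mathfrak f^1(\mathfrak g,J)$ is the complex Lie algebra $\mathfrak g^{1,0}\oplus\mathfrak g^{*(0,1)}$ with the Courant bracket $[x+\alpha,y+\beta]=[x,y]+\iota_xd\beta-\iota_yd\alpha$. The real Lie algebras $\mathfrak h_n$ are given by $(de^1,\dots,de^6)$, with $ij=e^i\wedge e^j$: $\mathfrak h_1=(0,0,0,0,0,0)$, $\mathfrak h_2=(0,0,0,0,12,34)$, $\mathfrak h_3=(0,0,0,0,0,12+34)$, $\mathfrak h_4=(0,0,0,0,12,14+23)$,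 $\mathfrak h_5=(0,0,0,0,13+42,14+23)$, $\mathfrak h_6=(0,0,0,0,12,13)$, $\mathfrak h_7=(0,0,0,12,13,23)$, $\mathfrak h_8=(0,0,0,0,0,12)$, $\mathfrak h_9=(0,0,0,0,12,14+25)$, $\mathfrak h_{10}=(0,0,0,12,13,14)$, $\mathfrak h_{11}=(0,0,0,12,13,14+23)$, $\mathfrak h_{12}=(0,0,0,12,13,24)$, $\mathfrak h_{13}=(0,0,0,12,13+14,24)$, $\mathfrak h_{14}=(0,0,0,12,14,13+42)$, $\mathfrak h_{15}=(0,0,0,12,13+42,14+23)$, $\mathfrak h_{16}=(0,0,0,12,14,24)$, $\mathfrak h_{17}=(0,0,0,0,12,15)$. **Theorem.** (i) Let $\mathfrak g$ be a real six-dimensional nilpotent Lie algebra with a nilpotent complex structure $J$. Then $\mathfrak g^{*(1,0)}$ has a *reduced* basis $\omega^1,\omega^2,\omega^3$, that is, one with $$d\omega^1=0,\quad d\omega^2=\epsilon\,\omega^1\bar\omega^1,\quad d\omega^3=\rho\,\omega^1\omega^2+A\,\omega^1\bar\omega^1+B\,\omega^1\bar\omega^2+C\,\omega^2\bar\omega^1+D\,\omega^2\bar\omega^2,$$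 where $\epsilon,\rho\in\{0,1\}$, $A,B,C,D\in\mathbb C$, and if $\epsilon=1$ then $A=D=0$ and $d\omega^3\neq0$. (ii) For a reduced basis let $\Delta_1=AD-BC$, $\Delta_2=\frac12\left(|B|^2+|C|^2-A\bar D-\bar AD-|\rho|^2\right)$, $d=\dim_{\mathbb C}\langle d\omega^3,d\bar\omega^3\rangle$ and $X=\begin{pmatrix}A&B\\C&D\end{pmatrix}$. For every $\mathfrak g$, $J$ as in (i) and every reduced basis, the invariants satisfy the constraints of exactly one row of the following table. For that row, $\mathfrak f^1(\mathfrak g,J)$ is isomorphic to the complexification of the algebra in the first column, $\mathfrak g$ is isomorphic to an algebra in the last column, and every $\mathfrak h_k$ with $1\le k\le16$ isomorphic to $\mathfrak g$ is in the last column. Here $0,+,-$ mean zero, positive, negative, and $*$ means unconstrained. | $\mathfrak f^1$ | $\epsilon$ | $\lvert\rho\rvert$ | rank $X$ | $\lvert\Delta_1\rvert$ | $\lvert\Delta_2\rvert$ | $\lvert\Delta_1\rvert^2-\Delta_2^2$ | $d$ | $\lvert B\rvert$ | $\lvert C\rvert$ | $\mathfrak g$ | |---|---|---|---|---|---|---|---|---|---|---|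 | $\mathfrak h_1$ | 0 | 0 | 0 | 0 | 0 | 0 | 0 | 0 | 0 | $\mathfrak h_1$ | | $\mathfrak h_8$ | 0 | 0 | 1 | 0 | 0 | 0 | 1 | $*$ | $*$ | $\mathfrak h_8$ | | $\mathfrak h_8$ | 0 | 0 | 1 | 0 | + | − | 2 | $*$ | $*$ | $\mathfrak h_5$ | | $\mathfrak h_6$ | 0 | 0 | 2 | + | $*$ | + | 2 | $*$ | $*$ | $\mathfrak h_2$ | | $\mathfrak h_6$ | 0 | 0 | 2 | + | + | 0 | 1 | $*$ | $*$ | $\mathfrak h_3$ | | $\mathfrak h_6$ | 0 | 0 | 2 | + | + | 0 | 2 | $*$ | $*$ | $\mathfrak h_4$ | | $\mathfrak h_6$ | 0 | 0 | 2 | + | + | − | 2 | $*$ | $*$ | $\mathfrak h_5$ | | $\mathfrak h_8$ | 0 | + | 0 | 0 | + | − | 2 | 0 | 0 | $\mathfrak h_5$ | | $\mathfrak h_6$ | 0 | + | 1 | 0 | 0 | 0 | 2 | $*$ | $*$ | $\mathfrak h_6$ | | $\mathfrak h_6$ | 0 | + | 1 | 0 | + | − | 2 | $*$ | $*$ | $\mathfrak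 h_5$ | | $\mathfrak h_7$ | 0 | + | 2 | + | $*$ | + | 2 | $*$ | $*$ | $\mathfrak h_2$ | | $\mathfrak h_7$ | 0 | + | 2 | + | + | 0 | 2 | $*$ | $*$ | $\mathfrak h_4$ | | $\mathfrak h_7$ | 0 | + | 2 | + | + | − | 2 | $*$ | $*$ | $\mathfrak h_5$ | | $\mathfrak h_3$ | + | 0 | 1 | 0 | + | − | 2 | + | 0 | $\mathfrak h_{15}$ | | $\mathfrak h_{17}$ | + | 0 | 1 | 0 | + | − | 2 | 0 | + | $\mathfrak h_{15}$ | | $\mathfrak h_9$ | + | 0 | 2 | + | + | 0 | 1 | + | + | $\mathfrak h_9$ | | $\mathfrak h_9$ | + | 0 | 2 | + | + | − | 2 | + | + | $\mathfrak h_{15}$ | | $\mathfrak h_6$ | + | + | 0 | 0 | + | − | 2 | 0 | 0 | $\mathfrak h_{15}$ | | $\mathfrak h_4$ | + | + | 1 | 0 | 0 | 0 | 2 | $\lvert\rho\rvert$ | 0 | $\mathfrak h_7,\mathfrak h_{16}$ | | $\mathfrak h_4$ | + | + | 1 | 0 | + | − | 2 | + | 0 | $\mathfrak h_{15}$ | |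 $\mathfrak h_{10}$ | + | + | 1 | 0 | 0 | 0 | 2 | 0 | $\lvert\rho\rvert$ | $\mathfrak h_{10}$ | | $\mathfrak h_{10}$ | + | + | 1 | 0 | + | − | 2 | 0 | + | $\mathfrak h_{15}$ | | $\mathfrak h_{11}$ | + | + | 2 | + | $*$ | + | 2 | + | + | $\mathfrak h_{12},\mathfrak h_{13}$ | | $\mathfrak h_{11}$ | + | + | 2 | + | + | 0 | 2 | + | + | $\mathfrak h_{11},\mathfrak h_{14}$ | | $\mathfrak h_{11}$ | + | + | 2 | + | + | − | 2 | + | + | $\mathfrak h_{15}$ | (iii) Conversely, for each row and each $\mathfrak h_k$ in its last column there is a nilpotent complex structure on $\mathfrak h_k$ with a reduced basis whose invariants satisfy the row. Moreover each single $*$ is unconstrained: for every real $t\ge0$ such a structure and basis exist for which the quantity marked $*$ equals $t$. -/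

import Mathlib

open scoped TensorProduct ComplexConjugate

noncomputable section

namespace NilCx

/-! ### The real Lie algebras `h_1, …, h_17` -/

/-- Structure equations of `h_n`: the `k`-th list holds the pairs `(i, j)` with
`d e^k = ∑ e^i ∧ e^j`. Indices start at `0`, so that `(0, 1)` is the term usually written `12`,
and `(3, 1)` is the term `42`. -/
def structureEqs : ℕ → Fin 6 → List (Fin 6 × Fin 6)
  | 1 => ![[], [], [], [], [], []]
  | 2 => ![[], [], [], [], [(0, 1)], [(2, 3)]]
  | 3 => ![[], [], [], [], [], [(0, 1), (2, 3)]]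
  | 4 => ![[], [], [], [], [(0, 1)], [(0, 3), (1, 2)]]
  | 5 => ![[], [], [], [], [(0, 2), (3, 1)], [(0, 3), (1, 2)]]
  | 6 => ![[], [], [], [], [(0, 1)], [(0, 2)]]
  | 7 => ![[], [], [], [(0, 1)], [(0, 2)], [(1, 2)]]
  | 8 => ![[], [], [], [], [], [(0, 1)]]
  | 9 => ![[], [], [], [], [(0, 1)], [(0, 3), (1, 4)]]
  | 10 => ![[], [], [], [(0, 1)], [(0, 2)], [(0, 3)]]
  | 11 => ![[], [], [], [(0, 1)], [(0, 2)], [(0, 3), (1, 2)]]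
  | 12 => ![[], [], [], [(0, 1)], [(0, 2)], [(1, 3)]]
  | 13 => ![[], [], [], [(0, 1)], [(0, 2), (0, 3)], [(1, 3)]]
  | 14 => ![[], [], [], [(0, 1)], [(0, 3)], [(0, 2), (3, 1)]]
  | 15 => ![[], [], [], [(0, 1)], [(0, 2), (3, 1)], [(0, 3), (1, 2)]]
  | 16 => ![[], [], [], [(0, 1)], [(0, 3)], [(1, 3)]]
  | 17 => ![[], [], [], [], [(0, 1)], [(0, 4)]]
  | _ => ![[], [], [], [], [], []]

/-- The real Lie algebra `h_n`, for `1 ≤ n ≤ 17` (abelian for other values of `n`). -/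
def NilAlg (_n : ℕ) : Type := Fin 6 → ℝ

instance (n : ℕ) : AddCommGroup (NilAlg n) := inferInstanceAs (AddCommGroup (Fin 6 → ℝ))
instance (n : ℕ) : Module ℝ (NilAlg n) := inferInstanceAs (Module ℝ (Fin 6 → ℝ))

/-- `e^k [x, y] = - (d e^k)(x, y)`. -/
def nilBracket (n : ℕ) (x y : Fin 6 → ℝ) : Fin 6 → ℝ := fun k =>
  -((structureEqs n k).map fun p => x p.1 * y p.2 - y p.1 * x p.2).sum

instance (n : ℕ) : Bracket (NilAlg n) (NilAlg n) := ⟨nilBracket n⟩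

theorem nilBracket_add_left (n : ℕ) (x y z : Fin 6 → ℝ) :
    nilBracket n (x + y) z = nilBracket n x z + nilBracket n y z := by
  funext k
  simp only [nilBracket, Pi.add_apply]
  induction structureEqs n k with
  | nil => simp
  | cons p l ih => simp only [List.map_cons, List.sum_cons]; linarith

theorem nilBracket_skew (n : ℕ) (x y : Fin 6 → ℝ) :
    nilBracket n x y = -nilBracket n y x := by
  funext k
  simp only [nilBracket, Pi.neg_apply]
  induction structureEqs n k with
  | nil => simp
  | cons p l ih => simp only [List.map_cons, List.sum_cons]; linarith

theorem nilBracket_smul_right (n : ℕ) (t : ℝ) (x y : Fin 6 → ℝ) :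
    nilBracket n x (t • y) = t • nilBracket n x y := by
  funext k
  simp only [nilBracket, Pi.smul_apply, smul_eq_mul]
  induction structureEqs n k with
  | nil => simp
  | cons p l ih => simp only [List.map_cons, List.sum_cons]; linarith

theorem nilBracket_add_right (n : ℕ) (x y z : Fin 6 → ℝ) :
    nilBracket n x (y + z) = nilBracket n x y + nilBracket n x z := by
  rw [nilBracket_skew, nilBracket_add_left, nilBracket_skew n y, nilBracket_skew n z]
  abel

theorem nilBracket_self (n : ℕ) (x : Fin 6 → ℝ) : nilBracket n x x = 0 := by
  have h := nilBracket_skew n x x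
  funext k
  have hk := congrFun h k
  simp only [Pi.neg_apply] at hk
  simp only [Pi.zero_apply]
  linarith

set_option maxHeartbeats 4000000 in
theorem nilBracket_jacobi (n : ℕ) (x y z : Fin 6 → ℝ) :
    nilBracket n x (nilBracket n y z) =
      nilBracket n (nilBracket n x y) z + nilBracket n y (nilBracket n x z) := by
  funext k
  by_cases hn : n < 18
  · interval_cases n <;> fin_cases k <;> simp [nilBracket, structureEqs] <;> ring
  · have h : structureEqs n = ![[], [], [], [], [], []] := by
      unfold structureEqs
      split <;> first | rfl | omega
    fin_cases k <;> simp [nilBracket, h]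

instance (n : ℕ) : LieRing (NilAlg n) where
  add_lie x y z := nilBracket_add_left n x y z
  lie_add x y z := nilBracket_add_right n x y z
  lie_self x := nilBracket_self n x
  leibniz_lie x y z := nilBracket_jacobi n x y z

instance (n : ℕ) : LieAlgebra ℝ (NilAlg n) where
  lie_smul t x y := nilBracket_smul_right n t x y

/-! ### The Courant bracket -/

section Courant

variable {L : Type*} [LieRing L] [LieAlgebra ℂ L]

/-- The vector space `L ⊕ L^*` over a complex Lie algebra `L`, carrying the Courant bracket. -/
def Courant (L : Type*) [LieRing L] [LieAlgebra ℂ L] : Type _ :=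
  L × Module.Dual ℂ L

instance : AddCommGroup (Courant L) :=
  inferInstanceAs (AddCommGroup (L × Module.Dual ℂ L))
instance : Module ℂ (Courant L) :=
  inferInstanceAs (Module ℂ (L × Module.Dual ℂ L))

/-- The contraction `ι_x d β`, that is `z ↦ (d β)(x, z) = - β [x, z]`. -/
def iotaD (x : L) (β : Module.Dual ℂ L) : Module.Dual ℂ L :=
  -(β ∘ₗ (LieAlgebra.ad ℂ L x : L →ₗ[ℂ] L))

theorem iotaD_apply (x z : L) (β : Module.Dual ℂ L) : iotaD x β z = -β ⁅x, z⁆ := rfl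

/-- The Courant bracket `[x + α, y + β] = [x, y] + ι_x d β - ι_y d α`. -/
instance : Bracket (Courant L) (Courant L) :=
  ⟨fun u v => (⁅u.1, v.1⁆, iotaD u.1 v.2 - iotaD v.1 u.2)⟩

theorem courant_ext {u v : Courant L} (h1 : u.1 = v.1) (h2 : ∀ z, u.2 z = v.2 z) : u = v :=
  Prod.ext h1 (LinearMap.ext h2)

theorem courant_fst (u v : Courant L) : (⁅u, v⁆ : Courant L).1 = ⁅u.1, v.1⁆ := rfl
theorem courant_snd (u v : Courant L) (z : L) :
    (⁅u, v⁆ : Courant L).2 z = -v.2 ⁅u.1, z⁆ + u.2 ⁅v.1, z⁆ := by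
  change -v.2 ⁅u.1, z⁆ - -u.2 ⁅v.1, z⁆ = _
  ring
theorem courant_add_fst (u v : Courant L) : (u + v).1 = u.1 + v.1 := rfl
theorem courant_add_snd (u v : Courant L) (z : L) : (u + v).2 z = u.2 z + v.2 z := rfl
theorem courant_smul_fst (c : ℂ) (u : Courant L) : (c • u).1 = c • u.1 := rfl
theorem courant_smul_snd (c : ℂ) (u : Courant L) (z : L) : (c • u).2 z = c * u.2 z := rfl
theorem courant_zero_fst : (0 : Courant L).1 = 0 := rfl
theorem courant_zero_snd (z : L) : (0 : Courant L).2 z = 0 := rfl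

instance : LieRing (Courant L) where
  add_lie u v w := by
    refine courant_ext ?_ fun z => ?_
    · simp only [courant_fst, courant_add_fst, add_lie]
    · simp only [courant_snd, courant_add_fst, courant_add_snd, add_lie, map_add]; ring
  lie_add u v w := by
    refine courant_ext ?_ fun z => ?_
    · simp only [courant_fst, courant_add_fst, lie_add]
    · simp only [courant_snd, courant_add_fst, courant_add_snd, add_lie, map_add]; ring
  lie_self u := by
    refine courant_ext ?_ fun z => ?_
    · simp only [courant_fst, lie_self, courant_zero_fst]
    · simp only [courant_snd, courant_zero_snd]; ring
  leibniz_lie u v w := by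
    refine courant_ext ?_ fun z => ?_
    · simp only [courant_fst, courant_add_fst]; exact leibniz_lie _ _ _
    · simp only [courant_snd, courant_fst, courant_add_snd, lie_lie, map_sub]; ring

instance : LieAlgebra ℂ (Courant L) where
  lie_smul c u v := by
    refine courant_ext ?_ fun z => ?_
    · simp only [courant_fst, courant_smul_fst, lie_smul]
    · simp only [courant_snd, courant_smul_fst, courant_smul_snd, smul_lie, map_smul, smul_eq_mul]
      ring

theorem lie_eigen (K : L →ₗ[ℂ] L)
    (hK : ∀ x y, ⁅x, y⁆ + K ⁅K x, y⁆ + K ⁅x, K y⁆ - ⁅K x, K y⁆ = 0) {x y : L}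
    (hx : K x = Complex.I • x) (hy : K y = Complex.I • y) :
    K ⁅x, y⁆ = Complex.I • ⁅x, y⁆ := by
  have h := hK x y
  rw [hx, hy] at h
  simp only [smul_lie, lie_smul, map_smul, smul_smul, Complex.I_mul_I] at h
  have h2 : (2 : ℂ) • (⁅x, y⁆ + Complex.I • K ⁅x, y⁆) = 0 := by
    rw [← h]; module
  have h3 := (smul_eq_zero.mp h2).resolve_left two_ne_zero
  have h4 : Complex.I • ⁅x, y⁆ + (Complex.I * Complex.I) • K ⁅x, y⁆ = 0 := by
    rw [mul_smul, ← smul_add, h3, smul_zero]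
  rw [Complex.I_mul_I, neg_one_smul] at h4
  exact (add_neg_eq_zero.mp h4).symm

end Courant

/-! ### Complex-valued forms on a real Lie algebra

The complexified dual `(g^*)_ℂ` is the space of real linear maps `g → ℂ`, and complex 2-forms are
(alternating) real bilinear maps `g × g → ℂ`. -/

section Forms

variable {g : Type*} [LieRing g] [LieAlgebra ℝ g]

/-- Chevalley–Eilenberg differential of a 1-form: `(d α)(x, y) = - α [x, y]`. -/
def dForm (α : g →ₗ[ℝ] ℂ) : g →ₗ[ℝ] g →ₗ[ℝ] ℂ :=
  LinearMap.mk₂ ℝ (fun x y => -α ⁅x, y⁆) (by intros; simp [add_comm]) (by intros; simp)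
    (by intros; simp [add_comm]) (by intros; simp)

/-- `(α ∧ β)(x, y) = α x * β y - α y * β x`. -/
def wedge (α β : g →ₗ[ℝ] ℂ) : g →ₗ[ℝ] g →ₗ[ℝ] ℂ :=
  LinearMap.mk₂ ℝ (fun x y => α x * β y - α y * β x) (by intros; simp; ring)
    (by intros; simp; ring) (by intros; simp; ring) (by intros; simp; ring)

/-- Complex conjugate of a 1-form. -/
def conjForm (α : g →ₗ[ℝ] ℂ) : g →ₗ[ℝ] ℂ :=
  Complex.conjAe.toLinearMap ∘ₗ α

/-- An integrable complex structure on `g`. -/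
structure IsComplexStructure (J : g →ₗ[ℝ] g) : Prop where
  sq : ∀ x, J (J x) = -x
  integrable : ∀ x y, ⁅x, y⁆ + J ⁅J x, y⁆ + J ⁅x, J y⁆ - ⁅J x, J y⁆ = 0

/-- The space `g^{*(1,0)}` of forms of type `(1,0)`. -/
def forms10 (J : g →ₗ[ℝ] g) : Submodule ℂ (g →ₗ[ℝ] ℂ) where
  carrier := {α | ∀ x, α (J x) = Complex.I * α x}
  add_mem' := by
    intro a b ha hb x
    simp [ha x, hb x, mul_add]
  zero_mem' := by intro x; simp
  smul_mem' := by
    intro c a ha x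
    simp [ha x]; ring

/-- A nilpotent complex structure: an integrable one with a basis `ω` of `g^{*(1,0)}` such that
`d ω^p` lies in `Λ²⟨ω^j, conj ω^j : j < p⟩` for every `p`. -/
structure IsNilpotentComplexStructure (J : g →ₗ[ℝ] g) : Prop extends IsComplexStructure J where
  exists_basis : ∃ (m : ℕ) (ω : Module.Basis (Fin m) ℂ (forms10 J)), ∀ p : Fin m,
    dForm (ω p : g →ₗ[ℝ] ℂ) ∈ Submodule.span ℂ {β : g →ₗ[ℝ] g →ₗ[ℝ] ℂ | ∃ a b : g →ₗ[ℝ] ℂ,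
      (∃ i < p, a = ω i ∨ a = conjForm (ω i)) ∧ (∃ j < p, b = ω j ∨ b = conjForm (ω j)) ∧
      β = wedge a b}

/-! ### The complex Lie algebra `f^1(g, J)` -/

/-- The complexification of `g`. -/
abbrev Cx (g : Type*) [LieRing g] [LieAlgebra ℝ g] : Type _ := ℂ ⊗[ℝ] g

/-- Complex linear extension of `J`; its `i`-eigenspace is `g^{(1,0)}`. -/
abbrev JC (J : g →ₗ[ℝ] g) : Cx g →ₗ[ℂ] Cx g := J.baseChange ℂ

theorem integrable_complexified {J : g →ₗ[ℝ] g} (hJ : IsComplexStructure J) (x y : Cx g) :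
    ⁅x, y⁆ + JC J ⁅JC J x, y⁆ + JC J ⁅x, JC J y⁆ - ⁅JC J x, JC J y⁆ = 0 := by
  have add_right (a b c : Cx g) : ⁅a, b + c⁆ = ⁅a, b⁆ + ⁅a, c⁆ := LieRing.lie_add a b c
  have zero_right (a : Cx g) : ⁅a, (0 : Cx g)⁆ = 0 := by
    have h := add_right a 0 0
    rw [add_zero] at h
    exact left_eq_add.mp h
  induction x using TensorProduct.induction_on with
  | zero => simp
  | add a b ha hb =>
    simp only [map_add, add_lie]
    rw [← add_zero (0 : Cx g)]
    nth_rewrite 1 [← ha]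
    rw [← hb]
    abel
  | tmul s a =>
    induction y using TensorProduct.induction_on with
    | zero => simp [zero_right]
    | add c d hc hd =>
      simp only [map_add, add_right]
      rw [← add_zero (0 : Cx g)]
      nth_rewrite 1 [← hc]
      rw [← hd]
      abel
    | tmul t b =>
      simp only [JC, LinearMap.baseChange_tmul, LieAlgebra.ExtendScalars.bracket_tmul]
      rw [← TensorProduct.tmul_add, ← TensorProduct.tmul_add, ← TensorProduct.tmul_sub,
        hJ.integrable, TensorProduct.tmul_zero]

theorem lie_type10 {J : g →ₗ[ℝ] g} (hJ : IsComplexStructure J) {x y : Cx g}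
    (hx : JC J x = Complex.I • x) (hy : JC J y = Complex.I • y) :
    JC J ⁅x, y⁆ = Complex.I • ⁅x, y⁆ :=
  lie_eigen (JC J) (integrable_complexified hJ) hx hy

/-- The complex Lie algebra `f^1(g, J) = g^{(1,0)} ⊕ g^{*(0,1)}` with the Courant bracket. Here
`g^{(1,0)}` is the `i`-eigenspace of `J` on `g_ℂ`, and `g^{*(0,1)}` is the space of complex linear
forms on `g_ℂ` that vanish on `g^{(1,0)}`. -/
def f1 (J : g →ₗ[ℝ] g) (hJ : IsComplexStructure J) : LieSubalgebra ℂ (Courant (Cx g)) where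
  carrier := {u | JC J u.1 = Complex.I • u.1 ∧ ∀ z, JC J z = Complex.I • z → u.2 z = 0}
  add_mem' := by
    rintro u v ⟨hu, hu'⟩ ⟨hv, hv'⟩
    refine ⟨?_, fun z hz => ?_⟩
    · rw [courant_add_fst, map_add, hu, hv, smul_add]
    · rw [courant_add_snd, hu' z hz, hv' z hz, add_zero]
  zero_mem' := by
    refine ⟨?_, fun z _ => courant_zero_snd z⟩
    rw [courant_zero_fst, map_zero, smul_zero]
  smul_mem' := by
    rintro c u ⟨hu, hu'⟩
    refine ⟨?_, fun z hz => ?_⟩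
    · rw [courant_smul_fst, map_smul, hu, smul_comm]
    · rw [courant_smul_snd, hu' z hz, mul_zero]
  lie_mem' := by
    rintro u v ⟨hu, hu'⟩ ⟨hv, hv'⟩
    refine ⟨lie_type10 hJ hu hv, fun z hz => ?_⟩
    rw [courant_snd, hv' _ (lie_type10 hJ hu hz), hu' _ (lie_type10 hJ hv hz)]
    simp

end Forms

/-! ### Reduced structure equations and their invariants -/

/-- The constants `ε, ρ, A, B, C, D` of the structure equations. -/
structure Constants where
  (ε ρ A B C D : ℂ)

namespace Constants

def Δ₁ (c : Constants) : ℂ := c.A * c.D - c.B * c.C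

def Δ₂ (c : Constants) : ℝ :=
  (‖c.B‖ ^ 2 + ‖c.C‖ ^ 2 - (c.A * conj c.D + conj c.A * c.D).re - ‖c.ρ‖ ^ 2) / 2

def X (c : Constants) : Matrix (Fin 2) (Fin 2) ℂ := !![c.A, c.B; c.C, c.D]

end Constants

/-- `ω` is a basis of `g^{*(1,0)}` with reduced structure equations with constants `c`:
`ε, ρ ∈ {0, 1}`, `A = D = 0` if `ε = 1`, and `d ω^3 ≠ 0` if `ε = 1`. -/
structure IsReduced {g : Type*} [LieRing g] [LieAlgebra ℝ g] {J : g →ₗ[ℝ] g}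
    (ω : Module.Basis (Fin 3) ℂ (forms10 J)) (c : Constants) : Prop where
  eps : c.ε = 0 ∨ c.ε = 1
  rho : c.ρ = 0 ∨ c.ρ = 1
  coeff : c.ε = 1 → c.A = 0 ∧ c.D = 0
  nonzero : c.ε = 1 → dForm (ω 2 : g →ₗ[ℝ] ℂ) ≠ 0
  d_one : dForm (ω 0 : g →ₗ[ℝ] ℂ) = 0
  d_two : dForm (ω 1 : g →ₗ[ℝ] ℂ) = c.ε • wedge (ω 0) (conjForm (ω 0))
  d_three : dForm (ω 2 : g →ₗ[ℝ] ℂ) =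
    c.ρ • wedge (ω 0) (ω 1) + c.A • wedge (ω 0) (conjForm (ω 0)) +
      c.B • wedge (ω 0) (conjForm (ω 1)) + c.C • wedge (ω 1) (conjForm (ω 0)) +
      c.D • wedge (ω 1) (conjForm (ω 1))

/-- The dimension `d` of the complex span of `d ω^3` and `d (conj ω^3)`. -/
def dimSpan {g : Type*} [LieRing g] [LieAlgebra ℝ g] {J : g →ₗ[ℝ] g}
    (ω : Module.Basis (Fin 3) ℂ (forms10 J)) : ℕ :=
  Module.finrank ℂ (Submodule.span ℂ
    {dForm (ω 2 : g →ₗ[ℝ] ℂ), dForm (conjForm (ω 2 : g →ₗ[ℝ] ℂ))})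

/-! ### The table -/

/-- Entries `0`, `+`, `-`, `*` (unconstrained) and `|ρ|` of the table. -/
inductive Entry where
  | zero | pos | neg | free | absRho

/-- The real number `v` obeys the constraint `e`, where `r = |ρ|`. -/
def Entry.Holds (e : Entry) (r v : ℝ) : Prop :=
  match e with
  | .zero => v = 0
  | .pos => 0 < v
  | .neg => v < 0
  | .free => True
  | .absRho => v = r

/-- A row of the table: the index `n` of the algebra `h_n` underlying `f^1`, the entries for
`ε`, `|ρ|`, `rank X`, `|Δ₁|`, `|Δ₂|`, `|Δ₁|² - Δ₂²`, `d`, `|B|`, `|C|`, and the list of the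
indices `k` of the algebras `h_k` occurring as `g`. -/
structure Row where
  (f : ℕ)
  (ε ρ : Entry)
  (rank : ℕ)
  (Δ₁ Δ₂ diff : Entry)
  (d : ℕ)
  (B C : Entry)
  (g : List ℕ)

/-- The invariants belonging to the reduced basis `ω` obey the constraints of the row `r`. -/
structure Row.Holds (r : Row) {g : Type*} [LieRing g] [LieAlgebra ℝ g] {J : g →ₗ[ℝ] g}
    (ω : Module.Basis (Fin 3) ℂ (forms10 J)) (c : Constants) : Prop where
  eps : r.ε.Holds ‖c.ρ‖ ‖c.ε‖
  rho : r.ρ.Holds ‖c.ρ‖ ‖c.ρ‖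
  rank : c.X.rank = r.rank
  delta_one : r.Δ₁.Holds ‖c.ρ‖ ‖c.Δ₁‖
  delta_two : r.Δ₂.Holds ‖c.ρ‖ |c.Δ₂|
  diff : r.diff.Holds ‖c.ρ‖ (‖c.Δ₁‖ ^ 2 - c.Δ₂ ^ 2)
  dim : dimSpan ω = r.d
  absB : r.B.Holds ‖c.ρ‖ ‖c.B‖
  absC : r.C.Holds ‖c.ρ‖ ‖c.C‖

open Entry in
/-- The columns are
`f^1 | ε | |ρ| | rank X | |Δ₁| | |Δ₂| | |Δ₁|² - Δ₂² | d | |B| | |C| | g`. -/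
def table : List Row :=
  [⟨1,  zero, zero, 0, zero, zero, zero, 0, zero, zero, [1]⟩,
   ⟨8,  zero, zero, 1, zero, zero, zero, 1, free, free, [8]⟩,
   ⟨8,  zero, zero, 1, zero, pos,  neg,  2, free, free, [5]⟩,
   ⟨6,  zero, zero, 2, pos,  free, pos,  2, free, free, [2]⟩,
   ⟨6,  zero, zero, 2, pos,  pos,  zero, 1, free, free, [3]⟩,
   ⟨6,  zero, zero, 2, pos,  pos,  zero, 2, free, free, [4]⟩,
   ⟨6,  zero, zero, 2, pos,  pos,  neg,  2, free, free, [5]⟩,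
   ⟨8,  zero, pos,  0, zero, pos,  neg,  2, zero, zero, [5]⟩,
   ⟨6,  zero, pos,  1, zero, zero, zero, 2, free, free, [6]⟩,
   ⟨6,  zero, pos,  1, zero, pos,  neg,  2, free, free, [5]⟩,
   ⟨7,  zero, pos,  2, pos,  free, pos,  2, free, free, [2]⟩,
   ⟨7,  zero, pos,  2, pos,  pos,  zero, 2, free, free, [4]⟩,
   ⟨7,  zero, pos,  2, pos,  pos,  neg,  2, free, free, [5]⟩,
   ⟨3,  pos,  zero, 1, zero, pos,  neg,  2, pos,  zero, [15]⟩,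
   ⟨17, pos,  zero, 1, zero, pos,  neg,  2, zero, pos,  [15]⟩,
   ⟨9,  pos,  zero, 2, pos,  pos,  zero, 1, pos,  pos,  [9]⟩,
   ⟨9,  pos,  zero, 2, pos,  pos,  neg,  2, pos,  pos,  [15]⟩,
   ⟨6,  pos,  pos,  0, zero, pos,  neg,  2, zero, zero, [15]⟩,
   ⟨4,  pos,  pos,  1, zero, zero, zero, 2, absRho, zero, [7, 16]⟩,
   ⟨4,  pos,  pos,  1, zero, pos,  neg,  2, pos,  zero, [15]⟩,
   ⟨10, pos,  pos,  1, zero, zero, zero, 2, zero, absRho, [10]⟩,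
   ⟨10, pos,  pos,  1, zero, pos,  neg,  2, zero, pos,  [15]⟩,
   ⟨11, pos,  pos,  2, pos,  free, pos,  2, pos,  pos,  [12, 13]⟩,
   ⟨11, pos,  pos,  2, pos,  pos,  zero, 2, pos,  pos,  [11, 14]⟩,
   ⟨11, pos,  pos,  2, pos,  pos,  neg,  2, pos,  pos,  [15]⟩]

/-- Some nilpotent complex structure on `h_k` has a reduced basis of `(1,0)`-forms whose invariants
obey the row `r`, with constants that moreover satisfy `P`. -/
def Realized (r : Row) (k : ℕ) (P : Constants → Prop) : Prop :=
  ∃ (J : NilAlg k →ₗ[ℝ] NilAlg k) (ω : Module.Basis (Fin 3) ℂ (forms10 J)) (c : Constants),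
    IsNilpotentComplexStructure (g := NilAlg k) J ∧ IsReduced ω c ∧ r.Holds ω c ∧ P c

end NilCx

end

/-! Everything depends only on the six constants of a reduced basis. The coordinates it gives
identify `g` with `ℂ³` under `Constants.bracket` (`coord_bijective`, `IsReduced.coord_lie`) and `f1`
with `ℂ⁶` under `Constants.courantBracket` (`IsReduced.f1Coord_lie`). An isomorphism with some `h_n`
thus amounts to six independent 1-forms satisfying its structure equations: `HasModel` over the
reals, `HasComplexModel` over the complex numbers.

Write `Ω = dω³`. If `ε = 0`, then `Ω` lives on the real four-space of the first two coordinates,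
where `Ω ∧ Ω` and `Ω ∧ conj Ω` are `Δ₁` and `Δ₂` times a common volume form (`form_plucker`,
`form_conj_polar`). The wedge square is therefore a quadratic form on the real forms `Re (sΩ)`,
whose type is the sign of `|Δ₁|² - Δ₂²`, and its null vectors are decomposable. Two real null lines
give `h_2`, a complex conjugate pair gives `h_5`, and a double one gives `h_4`; if `Δ₁ = Δ₂ = 0` and
`ρ = 1` the algebra is `h_6`. If `Ω` and `conj Ω` are proportional and nonzero, then a multiple of
`X` is Hermitian, and its rank decides between `h_3` and `h_8`.

If `ε = 1`, then `A = D = 0`, and with `ω¹ = a + ib`, `ω² = p + iq` the equations form a pencil `dω³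
= M(a, b) ∧ p + N(a, b) ∧ q` of real `2 × 2` matrices. Its discriminant is `16 (|Δ₁|² - Δ₂²)`
(`disc_mat`). As `q` may be changed by multiples of `p`, the models come from the generalized
eigenvalues of `M` relative to `N`, with separate cases when `N` is singular.

The rows exclude each other because a few of their entries already do (`table_signature`). The
algebras `h_1, …, h_16` are told apart by the isomorphism invariant `lieClass`, up to three pairs
whose members always share a row.

For the converse, constants with the required signature are written down. The classification then
recognizes their row and model, and multiplication by `i` on `ℂ³` is carried over to `h_k`. A
reduced basis exists because integrability removes the `(0,2)` part of `dω³`, the Jacobi identity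
removes `D` when `ε ≠ 0`, and a triangular change of basis does the rest (`exists_isReduced`). -/

noncomputable section

namespace NilCx

/-! ### Brackets of the algebras `h_n` in coordinates -/

section Brackets

variable (x y : Fin 6 → ℝ)

theorem nilBracket_one : nilBracket 1 x y = 0 := by
  funext k; fin_cases k <;> simp [nilBracket, structureEqs]

theorem nilBracket_two : nilBracket 2 x y =
    ![0, 0, 0, 0, -(x 0 * y 1 - y 0 * x 1), -(x 2 * y 3 - y 2 * x 3)] := by
  funext k; fin_cases k <;> simp [nilBracket, structureEqs]

theorem nilBracket_three : nilBracket 3 x y =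
    ![0, 0, 0, 0, 0, -(x 0 * y 1 - y 0 * x 1 + (x 2 * y 3 - y 2 * x 3))] := by
  funext k; fin_cases k <;> simp [nilBracket, structureEqs]

theorem nilBracket_four : nilBracket 4 x y =
    ![0, 0, 0, 0, -(x 0 * y 1 - y 0 * x 1),
      -(x 0 * y 3 - y 0 * x 3 + (x 1 * y 2 - y 1 * x 2))] := by
  funext k; fin_cases k <;> simp [nilBracket, structureEqs]

theorem nilBracket_five : nilBracket 5 x y =
    ![0, 0, 0, 0, -(x 0 * y 2 - y 0 * x 2 + (x 3 * y 1 - y 3 * x 1)),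
      -(x 0 * y 3 - y 0 * x 3 + (x 1 * y 2 - y 1 * x 2))] := by
  funext k; fin_cases k <;> simp [nilBracket, structureEqs]

theorem nilBracket_six : nilBracket 6 x y =
    ![0, 0, 0, 0, -(x 0 * y 1 - y 0 * x 1), -(x 0 * y 2 - y 0 * x 2)] := by
  funext k; fin_cases k <;> simp [nilBracket, structureEqs]

theorem nilBracket_seven : nilBracket 7 x y =
    ![0, 0, 0, -(x 0 * y 1 - y 0 * x 1), -(x 0 * y 2 - y 0 * x 2),
      -(x 1 * y 2 - y 1 * x 2)] := by
  funext k; fin_cases k <;> simp [nilBracket, structureEqs]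

theorem nilBracket_eight : nilBracket 8 x y =
    ![0, 0, 0, 0, 0, -(x 0 * y 1 - y 0 * x 1)] := by
  funext k; fin_cases k <;> simp [nilBracket, structureEqs]

theorem nilBracket_nine : nilBracket 9 x y =
    ![0, 0, 0, 0, -(x 0 * y 1 - y 0 * x 1),
      -(x 0 * y 3 - y 0 * x 3 + (x 1 * y 4 - y 1 * x 4))] := by
  funext k; fin_cases k <;> simp [nilBracket, structureEqs]

theorem nilBracket_ten : nilBracket 10 x y =
    ![0, 0, 0, -(x 0 * y 1 - y 0 * x 1), -(x 0 * y 2 - y 0 * x 2),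
      -(x 0 * y 3 - y 0 * x 3)] := by
  funext k; fin_cases k <;> simp [nilBracket, structureEqs]

theorem nilBracket_eleven : nilBracket 11 x y =
    ![0, 0, 0, -(x 0 * y 1 - y 0 * x 1), -(x 0 * y 2 - y 0 * x 2),
      -(x 0 * y 3 - y 0 * x 3 + (x 1 * y 2 - y 1 * x 2))] := by
  funext k; fin_cases k <;> simp [nilBracket, structureEqs]

theorem nilBracket_twelve : nilBracket 12 x y =
    ![0, 0, 0, -(x 0 * y 1 - y 0 * x 1), -(x 0 * y 2 - y 0 * x 2),
      -(x 1 * y 3 - y 1 * x 3)] := by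
  funext k; fin_cases k <;> simp [nilBracket, structureEqs]

theorem nilBracket_thirteen : nilBracket 13 x y =
    ![0, 0, 0, -(x 0 * y 1 - y 0 * x 1),
      -(x 0 * y 2 - y 0 * x 2 + (x 0 * y 3 - y 0 * x 3)), -(x 1 * y 3 - y 1 * x 3)] := by
  funext k; fin_cases k <;> simp [nilBracket, structureEqs]

theorem nilBracket_fourteen : nilBracket 14 x y =
    ![0, 0, 0, -(x 0 * y 1 - y 0 * x 1), -(x 0 * y 3 - y 0 * x 3),
      -(x 0 * y 2 - y 0 * x 2 + (x 3 * y 1 - y 3 * x 1))] := by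
  funext k; fin_cases k <;> simp [nilBracket, structureEqs]

theorem nilBracket_fifteen : nilBracket 15 x y =
    ![0, 0, 0, -(x 0 * y 1 - y 0 * x 1), -(x 0 * y 2 - y 0 * x 2 + (x 3 * y 1 - y 3 * x 1)),
      -(x 0 * y 3 - y 0 * x 3 + (x 1 * y 2 - y 1 * x 2))] := by
  funext k; fin_cases k <;> simp [nilBracket, structureEqs]

theorem nilBracket_sixteen : nilBracket 16 x y =
    ![0, 0, 0, -(x 0 * y 1 - y 0 * x 1), -(x 0 * y 3 - y 0 * x 3),
      -(x 1 * y 3 - y 1 * x 3)] := by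
  funext k; fin_cases k <;> simp [nilBracket, structureEqs]

end Brackets

/-! ### Isomorphism invariants of real Lie algebras -/

section Invariants

variable (L : Type*) [LieRing L] [LieAlgebra ℝ L]

def IsAb : Prop := ∀ x y : L, ⁅x, y⁆ = 0

def IsTwoStep : Prop := ∀ x y z : L, ⁅x, ⁅y, z⁆⁆ = 0

/-- The derived algebra is contained in a line. -/
def DerivedInLine : Prop := ∃ z : L, ∀ x y : L, ∃ t : ℝ, ⁅x, y⁆ = t • z

/-- The derived algebra is contained in a plane. -/
def DerivedInPlane : Prop := ∃ z w : L, ∀ x y : L, ∃ s t : ℝ, ⁅x, y⁆ = s • z + t • w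

/-- There are two commuting pairs of non-commuting elements. -/
def HasCommutingPairs : Prop :=
  ∃ x y z w : L, ⁅x, y⁆ ≠ 0 ∧ ⁅z, w⁆ ≠ 0 ∧ ⁅x, z⁆ = 0 ∧ ⁅x, w⁆ = 0 ∧ ⁅y, z⁆ = 0 ∧ ⁅y, w⁆ = 0

/-- Separates `h_4` from `h_6`: the centre of `h_6` is larger than its derived algebra. -/
def CentralIsBracket : Prop := ∀ c : L, (∀ y : L, ⁅c, y⁆ = 0) → ∃ x y : L, c = ⁅x, y⁆

/-- Recognizes `h_16` among the algebras whose third term is not in a line: it has a central vector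
outside the derived algebra. -/
def CentralIsTripleBracket : Prop :=
  ∀ c : L, (∀ y : L, ⁅c, y⁆ = 0) → ∃ x y z : L, c = ⁅x, ⁅y, z⁆⁆

/-- The third term of the lower central series is contained in a line. -/
def ThirdInLine : Prop := ∃ z : L, ∀ x y w : L, ∃ t : ℝ, ⁅x, ⁅y, w⁆⁆ = t • z

variable {L} in
/-- `x` centralizes the derived algebra. -/
def CentralizesDerived (x : L) : Prop := ∀ y z : L, ⁅x, ⁅y, z⁆⁆ = 0

variable {L} in
/-- `ad x` has rank at most one. -/
def IsSmall (x : L) : Prop := ∃ z : L, ∀ y, ∃ t : ℝ, ⁅x, y⁆ = t • z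

/-- Holds for `h_5` and `h_15`. There the relevant `ad x` is multiplication by complex numbers in
disguise, so its real rank is even, and rank at most one means zero. -/
def SmallIsCentral : Prop :=
  ∀ x : L, CentralizesDerived x → IsSmall x → ∀ y : L, ⁅x, y⁆ = 0

/-- Fails for `h_2` and `h_13`, where small elements lie in two different directions whose sum is
not small. In `h_4`, `h_6` and `h_14` they form a subspace. -/
def SmallIsAdditive : Prop :=
  ∀ x y : L, CentralizesDerived x → CentralizesDerived y → IsSmall x → IsSmall y →
    IsSmall (x + y)

/-- This property and the next separate `h_10`, `h_11` and `h_12` by the brackets inside the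
centralizer of the derived algebra: zero, in the third term, or not in it. -/
def CentralizerAbelian : Prop :=
  ∀ x y : L, CentralizesDerived x → CentralizesDerived y → ⁅x, y⁆ = 0

def CentralizerBracketInThird : Prop :=
  ∀ x y : L, CentralizesDerived x → CentralizesDerived y → ∃ u v w : L, ⁅x, y⁆ = ⁅u, ⁅v, w⁆⁆

open Classical in
/-- The index of `h_n`, up to identifying `16, 13, 14` with `7, 12, 11`. -/
def lieClass : ℕ :=
  if IsAb L then 1 else
  if IsTwoStep L then
    if DerivedInLine L then (if HasCommutingPairs L then 3 else 8) else
    if ¬ DerivedInPlane L then 7 else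
    if SmallIsCentral L then 5 else
    if ¬ SmallIsAdditive L then 2 else
    if CentralIsBracket L then 4 else 6
  else
    if ThirdInLine L then
      if DerivedInPlane L then 9 else
      if CentralizerAbelian L then 10 else
      if CentralizerBracketInThird L then 11 else 12
    else
      if ¬ CentralIsTripleBracket L then 7 else
      if SmallIsCentral L then 15 else
      if SmallIsAdditive L then 11 else 12

end Invariants

/-! ### Invariance of `lieClass` under isomorphism. -/

section Transport

variable {L L' : Type*} [LieRing L] [LieAlgebra ℝ L] [LieRing L'] [LieAlgebra ℝ L']
variable (e : L ≃ₗ⁅ℝ⁆ L')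

include e

theorem IsAb.transport (h : IsAb L) : IsAb L' := fun x y => by
  have := congrArg e (h (e.symm x) (e.symm y))
  simpa [LieEquiv.map_lie] using this

theorem IsTwoStep.transport (h : IsTwoStep L) : IsTwoStep L' := fun x y z => by
  have := congrArg e (h (e.symm x) (e.symm y) (e.symm z))
  simpa [LieEquiv.map_lie] using this

theorem DerivedInLine.transport (h : DerivedInLine L) : DerivedInLine L' := by
  obtain ⟨z, h⟩ := h
  refine ⟨e z, fun x y => ?_⟩
  obtain ⟨t, ht⟩ := h (e.symm x) (e.symm y)
  exact ⟨t, by simpa [LieEquiv.map_lie] using congrArg e ht⟩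

theorem DerivedInPlane.transport (h : DerivedInPlane L) : DerivedInPlane L' := by
  obtain ⟨z, w, h⟩ := h
  refine ⟨e z, e w, fun x y => ?_⟩
  obtain ⟨s, t, ht⟩ := h (e.symm x) (e.symm y)
  exact ⟨s, t, by simpa [LieEquiv.map_lie] using congrArg e ht⟩

theorem lie_symm_eq_zero {x : L'} {w : L} (h : ⁅x, e w⁆ = 0) : ⁅e.symm x, w⁆ = 0 := by
  simpa [LieEquiv.map_lie] using congrArg e.symm h

theorem HasCommutingPairs.transport (h : HasCommutingPairs L) : HasCommutingPairs L' := by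
  obtain ⟨x, y, z, w, h⟩ := h
  refine ⟨e x, e y, e z, e w, ?_⟩
  simpa only [← LieEquiv.map_lie, ne_eq, EmbeddingLike.map_eq_zero_iff] using h

theorem central_symm {c : L'} (h : ∀ y : L', ⁅c, y⁆ = 0) (y : L) : ⁅e.symm c, y⁆ = 0 :=
  lie_symm_eq_zero e (h (e y))

theorem CentralIsBracket.transport (h : CentralIsBracket L) : CentralIsBracket L' := by
  intro c hc
  obtain ⟨x, y, hxy⟩ := h (e.symm c) (central_symm e hc)
  exact ⟨e x, e y, by simpa [LieEquiv.map_lie] using congrArg e hxy⟩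

theorem CentralIsTripleBracket.transport (h : CentralIsTripleBracket L) :
    CentralIsTripleBracket L' := by
  intro c hc
  obtain ⟨x, y, z, hxy⟩ := h (e.symm c) (central_symm e hc)
  exact ⟨e x, e y, e z, by simpa [LieEquiv.map_lie] using congrArg e hxy⟩

theorem ThirdInLine.transport (h : ThirdInLine L) : ThirdInLine L' := by
  obtain ⟨z, h⟩ := h
  refine ⟨e z, fun x y w => ?_⟩
  obtain ⟨t, ht⟩ := h (e.symm x) (e.symm y) (e.symm w)
  exact ⟨t, by simpa [LieEquiv.map_lie] using congrArg e ht⟩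

theorem CentralizesDerived.transport {x : L} (h : CentralizesDerived x) :
    CentralizesDerived (e x) := fun y z => by
  simpa [LieEquiv.map_lie] using congrArg e (h (e.symm y) (e.symm z))

theorem IsSmall.transport {x : L} (h : IsSmall x) : IsSmall (e x) := by
  obtain ⟨z, h⟩ := h
  refine ⟨e z, fun y => ?_⟩
  obtain ⟨t, ht⟩ := h (e.symm y)
  exact ⟨t, by simpa [LieEquiv.map_lie] using congrArg e ht⟩

theorem SmallIsCentral.transport (h : SmallIsCentral L) : SmallIsCentral L' := by
  intro x hx hs y
  simpa [LieEquiv.map_lie] using congrArg e (h (e.symm x) (hx.transport e.symm) (hs.transport e.symm) (e.symm y))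

theorem SmallIsAdditive.transport (h : SmallIsAdditive L) : SmallIsAdditive L' := by
  intro x y hx hy hsx hsy
  simpa [LieEquiv.map_lie] using (h _ _ (hx.transport e.symm) (hy.transport e.symm) (hsx.transport e.symm)
    (hsy.transport e.symm)).transport e

theorem CentralizerAbelian.transport (h : CentralizerAbelian L) : CentralizerAbelian L' := by
  intro x y hx hy
  simpa [LieEquiv.map_lie] using congrArg e (h _ _ (hx.transport e.symm) (hy.transport e.symm))

theorem CentralizerBracketInThird.transport (h : CentralizerBracketInThird L) :
    CentralizerBracketInThird L' := by
  intro x y hx hy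
  obtain ⟨u, v, w, h⟩ := h _ _ (hx.transport e.symm) (hy.transport e.symm)
  exact ⟨e u, e v, e w, by simpa [LieEquiv.map_lie] using congrArg e h⟩

theorem lieClass_congr : lieClass L = lieClass L' := by
  classical
  have h1 : IsAb L ↔ IsAb L' := ⟨.transport e, .transport e.symm⟩
  have h2 : IsTwoStep L ↔ IsTwoStep L' := ⟨.transport e, .transport e.symm⟩
  have h3 : DerivedInLine L ↔ DerivedInLine L' := ⟨.transport e, .transport e.symm⟩
  have h4 : DerivedInPlane L ↔ DerivedInPlane L' := ⟨.transport e, .transport e.symm⟩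
  have h5 : HasCommutingPairs L ↔ HasCommutingPairs L' :=
    ⟨.transport e, .transport e.symm⟩
  have h6 : CentralIsBracket L ↔ CentralIsBracket L' := ⟨.transport e, .transport e.symm⟩
  have h7 : CentralIsTripleBracket L ↔ CentralIsTripleBracket L' :=
    ⟨.transport e, .transport e.symm⟩
  have h8 : ThirdInLine L ↔ ThirdInLine L' := ⟨.transport e, .transport e.symm⟩
  have h9 : SmallIsCentral L ↔ SmallIsCentral L' := ⟨.transport e, .transport e.symm⟩
  have h10 : SmallIsAdditive L ↔ SmallIsAdditive L' := ⟨.transport e, .transport e.symm⟩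
  have h11 : CentralizerAbelian L ↔ CentralizerAbelian L' := ⟨.transport e, .transport e.symm⟩
  have h12 : CentralizerBracketInThird L ↔ CentralizerBracketInThird L' :=
    ⟨.transport e, .transport e.symm⟩
  simp only [lieClass, h1, h2, h3, h4, h5, h6, h7, h8, h9, h10, h11, h12]

end Transport

/-! ### The invariants in the coordinates of `h_n`. -/

section Coordinates

variable {n : ℕ}

theorem isTwoStep_iff : IsTwoStep (NilAlg n) ↔
    ∀ x y z : Fin 6 → ℝ, ∀ k, nilBracket n x (nilBracket n y z) k = 0 :=
  ⟨fun h x y z k => congrFun (h x y z) k, fun h x y z => funext (h x y z)⟩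

theorem derivedInLine_iff : DerivedInLine (NilAlg n) ↔
    ∃ z : Fin 6 → ℝ, ∀ x y : Fin 6 → ℝ, ∃ t : ℝ, ∀ k, nilBracket n x y k = t * z k :=
  ⟨fun ⟨z, h⟩ => ⟨z, fun x y => (h x y).imp fun _ ht k => congrFun ht k⟩,
    fun ⟨z, h⟩ => ⟨z, fun x y => (h x y).imp fun _ ht => funext ht⟩⟩

theorem derivedInPlane_iff : DerivedInPlane (NilAlg n) ↔
    ∃ z w : Fin 6 → ℝ, ∀ x y : Fin 6 → ℝ, ∃ s t : ℝ, ∀ k,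
      nilBracket n x y k = s * z k + t * w k :=
  ⟨fun ⟨z, w, h⟩ => ⟨z, w, fun x y => (h x y).imp fun _ h => h.imp fun _ ht k => congrFun ht k⟩,
    fun ⟨z, w, h⟩ => ⟨z, w, fun x y => (h x y).imp fun _ h => h.imp fun _ ht => funext ht⟩⟩

theorem thirdInLine_iff : ThirdInLine (NilAlg n) ↔
    ∃ z : Fin 6 → ℝ, ∀ x y w : Fin 6 → ℝ, ∃ t : ℝ, ∀ k,
      nilBracket n x (nilBracket n y w) k = t * z k :=
  ⟨fun ⟨z, h⟩ => ⟨z, fun x y w => (h x y w).imp fun _ ht k => congrFun ht k⟩,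
    fun ⟨z, h⟩ => ⟨z, fun x y w => (h x y w).imp fun _ ht => funext ht⟩⟩

theorem centralizesDerived_iff (x : Fin 6 → ℝ) : CentralizesDerived (L := NilAlg n) x ↔
    ∀ y z : Fin 6 → ℝ, ∀ k, nilBracket n x (nilBracket n y z) k = 0 :=
  ⟨fun h y z k => congrFun (h y z) k, fun h y z => funext (h y z)⟩

theorem isSmall_iff (x : Fin 6 → ℝ) : IsSmall (L := NilAlg n) x ↔
    ∃ z : Fin 6 → ℝ, ∀ y : Fin 6 → ℝ, ∃ t : ℝ, ∀ k, nilBracket n x y k = t * z k :=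
  ⟨fun ⟨z, h⟩ => ⟨z, fun y => (h y).imp fun _ ht k => congrFun ht k⟩,
    fun ⟨z, h⟩ => ⟨z, fun y => (h y).imp fun _ ht => funext ht⟩⟩

/-- Vectors on one line have vanishing `2 × 2` minors. This replaces an unknown line by a polynomial
identity that can be tested on unit vectors. -/
theorem IsSmall.minor {x : Fin 6 → ℝ} (h : IsSmall (L := NilAlg n) x) (y y' : Fin 6 → ℝ)
    (i j : Fin 6) :
    nilBracket n x y i * nilBracket n x y' j = nilBracket n x y j * nilBracket n x y' i := by
  obtain ⟨z, h⟩ := (isSmall_iff x).1 h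
  obtain ⟨s, hs⟩ := h y
  obtain ⟨t, ht⟩ := h y'
  rw [hs, ht, hs, ht]; ring

theorem DerivedInLine.minor (h : DerivedInLine (NilAlg n)) (x y x' y' : Fin 6 → ℝ)
    (i j : Fin 6) :
    nilBracket n x y i * nilBracket n x' y' j = nilBracket n x y j * nilBracket n x' y' i := by
  obtain ⟨z, h⟩ := derivedInLine_iff.1 h
  obtain ⟨s, hs⟩ := h x y
  obtain ⟨t, ht⟩ := h x' y'
  rw [hs, ht, hs, ht]; ring

theorem ThirdInLine.minor (h : ThirdInLine (NilAlg n)) (x y z x' y' z' : Fin 6 → ℝ)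
    (i j : Fin 6) :
    nilBracket n x (nilBracket n y z) i * nilBracket n x' (nilBracket n y' z') j =
      nilBracket n x (nilBracket n y z) j * nilBracket n x' (nilBracket n y' z') i := by
  obtain ⟨w, h⟩ := thirdInLine_iff.1 h
  obtain ⟨s, hs⟩ := h x y z
  obtain ⟨t, ht⟩ := h x' y' z'
  rw [hs, ht, hs, ht]; ring

/-- Three brackets spanning the last three coordinates do not lie in a plane. -/
theorem not_derivedInPlane (x y x' y' x'' y'' : Fin 6 → ℝ)
    (h : nilBracket n x y = ![0, 0, 0, 1, 0, 0])
    (h' : nilBracket n x' y' = ![0, 0, 0, 0, 1, 0])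
    (h'' : nilBracket n x'' y'' = ![0, 0, 0, 0, 0, 1]) : ¬ DerivedInPlane (NilAlg n) := by
  intro hp
  obtain ⟨z, w, hp⟩ := derivedInPlane_iff.1 hp
  obtain ⟨s1, t1, h1⟩ := hp x y
  obtain ⟨s2, t2, h2⟩ := hp x' y'
  obtain ⟨s3, t3, h3⟩ := hp x'' y''
  rw [h] at h1; rw [h'] at h2; rw [h''] at h3
  have a1 := h1 3; have a2 := h1 4; have a3 := h1 5
  have b1 := h2 3; have b2 := h2 4; have b3 := h2 5
  have c1 := h3 3; have c2 := h3 4; have c3 := h3 5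
  simp at a1 a2 a3 b1 b2 b3 c1 c2 c3
  -- The `3 × 3` determinant of three combinations of `z` and `w` vanishes identically, but here it
  -- is the determinant of the identity matrix.
  have key : (s1 * z 3 + t1 * w 3) * ((s2 * z 4 + t2 * w 4) * (s3 * z 5 + t3 * w 5) -
      (s2 * z 5 + t2 * w 5) * (s3 * z 4 + t3 * w 4)) -
      (s1 * z 4 + t1 * w 4) * ((s2 * z 3 + t2 * w 3) * (s3 * z 5 + t3 * w 5) -
      (s2 * z 5 + t2 * w 5) * (s3 * z 3 + t3 * w 3)) +
      (s1 * z 5 + t1 * w 5) * ((s2 * z 3 + t2 * w 3) * (s3 * z 4 + t3 * w 4) -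
      (s2 * z 4 + t2 * w 4) * (s3 * z 3 + t3 * w 3)) = 0 := by ring
  rw [← a1, ← a2, ← a3, ← b1, ← b2, ← b3, ← c1, ← c2, ← c3] at key
  norm_num at key

theorem derivedInPlane_of (h : ∀ x y : Fin 6 → ℝ, ∀ k, k < 4 → nilBracket n x y k = 0) :
    DerivedInPlane (NilAlg n) := by
  refine derivedInPlane_iff.2 ⟨![0, 0, 0, 0, 1, 0], ![0, 0, 0, 0, 0, 1], fun x y =>
    ⟨nilBracket n x y 4, nilBracket n x y 5, fun k => ?_⟩⟩
  fin_cases k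
  · simpa using h x y 0 (by decide)
  · simpa using h x y 1 (by decide)
  · simpa using h x y 2 (by decide)
  · simpa using h x y 3 (by decide)
  · simp
  · simp

theorem not_isAb {x y : Fin 6 → ℝ} (k : Fin 6) (h : nilBracket n x y k ≠ 0) :
    ¬ IsAb (NilAlg n) :=
  fun hab => h (congrFun (hab x y) k)

theorem not_isTwoStep {x y z : Fin 6 → ℝ} (k : Fin 6)
    (h : nilBracket n x (nilBracket n y z) k ≠ 0) : ¬ IsTwoStep (NilAlg n) :=
  fun h2 => h (congrFun (h2 x y z) k)

end Coordinates

/-! ### Values of `lieClass` on `h_1, …, h_16`. -/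

theorem lieClass_one : lieClass (NilAlg 1) = 1 :=
  if_pos fun x y => nilBracket_one x y

theorem lieClass_two : lieClass (NilAlg 2) = 2 := by
  have h1 : ¬ IsAb (NilAlg 2) :=
    not_isAb (x := ![1, 0, 0, 0, 0, 0]) (y := ![0, 1, 0, 0, 0, 0]) 4 (by simp [nilBracket_two])
  have h2 : IsTwoStep (NilAlg 2) := isTwoStep_iff.2 fun x y z k => by
    fin_cases k <;> simp [nilBracket_two]
  have h3 : ¬ DerivedInLine (NilAlg 2) := fun h => by
    have := h.minor ![1, 0, 0, 0, 0, 0] ![0, 1, 0, 0, 0, 0] ![0, 0, 1, 0, 0, 0]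
      ![0, 0, 0, 1, 0, 0] 4 5
    simp [nilBracket_two] at this
  have h4 : DerivedInPlane (NilAlg 2) := derivedInPlane_of fun x y k hk => by
    fin_cases k <;> simp [nilBracket_two] at hk ⊢
  have hc (x : Fin 6 → ℝ) : CentralizesDerived (L := NilAlg 2) x := fun y z => h2 x y z
  have hs : IsSmall (L := NilAlg 2) (![1, 0, 0, 0, 0, 0] : Fin 6 → ℝ) :=
    (isSmall_iff _).2 ⟨![0, 0, 0, 0, 1, 0], fun y => ⟨-y 1, fun k => by
      fin_cases k <;> simp [nilBracket_two]⟩⟩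
  have hs' : IsSmall (L := NilAlg 2) (![0, 0, 1, 0, 0, 0] : Fin 6 → ℝ) :=
    (isSmall_iff _).2 ⟨![0, 0, 0, 0, 0, 1], fun y => ⟨-y 3, fun k => by
      fin_cases k <;> simp [nilBracket_two]⟩⟩
  have h5 : ¬ SmallIsCentral (NilAlg 2) := fun h => by
    have := congrFun (h _ (hc _) hs ![0, 1, 0, 0, 0, 0]) 4
    change nilBracket 2 _ _ 4 = 0 at this
    simp [nilBracket_two] at this
  have h6 : ¬ SmallIsAdditive (NilAlg 2) := fun h => by
    have hm := IsSmall.minor (n := 2) (x := fun i => ![1, 0, 0, 0, 0, 0] i + ![0, 0, 1, 0, 0, 0] i)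
      (h _ _ (hc _) (hc _) hs hs') ![0, 1, 0, 0, 0, 0] ![0, 0, 0, 1, 0, 0] 4 5
    simp [nilBracket_two] at hm
  simp [lieClass, h1, h2, h3, h4, h5, h6]

theorem lieClass_three : lieClass (NilAlg 3) = 3 := by
  have h1 : ¬ IsAb (NilAlg 3) :=
    not_isAb (x := ![1, 0, 0, 0, 0, 0]) (y := ![0, 1, 0, 0, 0, 0]) 5 (by simp [nilBracket_three])
  have h2 : IsTwoStep (NilAlg 3) := isTwoStep_iff.2 fun x y z k => by
    fin_cases k <;> simp [nilBracket_three]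
  have h3 : DerivedInLine (NilAlg 3) := derivedInLine_iff.2 ⟨![0, 0, 0, 0, 0, 1], fun x y =>
    ⟨nilBracket 3 x y 5, fun k => by fin_cases k <;> simp [nilBracket_three]⟩⟩
  have h4 : HasCommutingPairs (NilAlg 3) := by
    let v (i : Fin 6) : NilAlg 3 := Pi.single (M := fun _ => ℝ) i 1
    refine ⟨v 0, v 1, v 2, v 3, fun h => ?_, fun h => ?_, ?_, ?_, ?_, ?_⟩
    · have h5 : nilBracket 3 (v 0) (v 1) 5 = 0 := congrFun h 5
      simp [nilBracket_three, v] at h5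
    · have h5 : nilBracket 3 (v 2) (v 3) 5 = 0 := congrFun h 5
      simp [nilBracket_three, v] at h5
    all_goals
      change nilBracket 3 _ _ = 0
      simp [nilBracket_three, v]
  simp [lieClass, h1, h2, h3, h4]

theorem lieClass_four : lieClass (NilAlg 4) = 4 := by
  have h1 : ¬ IsAb (NilAlg 4) :=
    not_isAb (x := ![1, 0, 0, 0, 0, 0]) (y := ![0, 1, 0, 0, 0, 0]) 4 (by simp [nilBracket_four])
  have h2 : IsTwoStep (NilAlg 4) := isTwoStep_iff.2 fun x y z k => by
    fin_cases k <;> simp [nilBracket_four]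
  have h3 : ¬ DerivedInLine (NilAlg 4) := fun h => by
    have := h.minor ![1, 0, 0, 0, 0, 0] ![0, 1, 0, 0, 0, 0] ![1, 0, 0, 0, 0, 0]
      ![0, 0, 0, 1, 0, 0] 4 5
    simp [nilBracket_four] at this
  have h4 : DerivedInPlane (NilAlg 4) := derivedInPlane_of fun x y k hk => by
    fin_cases k <;> simp [nilBracket_four] at hk ⊢
  have hc (x : Fin 6 → ℝ) : CentralizesDerived (L := NilAlg 4) x := fun y z => h2 x y z
  have hs (x : Fin 6 → ℝ) : IsSmall (L := NilAlg 4) x ↔ x 0 = 0 ∧ x 1 = 0 := by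
    refine ⟨fun h => ?_, fun h => (isSmall_iff _).2 ⟨![0, 0, 0, 0, 0, 1], fun y =>
      ⟨nilBracket 4 x y 5, fun k => by fin_cases k <;> simp [nilBracket_four, h.1, h.2]⟩⟩⟩
    -- The two minors reduce to `x 0 ^ 2 = 0` and `x 1 ^ 2 = 0`.
    have h1 := h.minor ![0, 1, 0, 0, 0, 0] ![0, 0, 0, 1, 0, 0] 4 5
    have h2 := h.minor ![1, 0, 0, 0, 0, 0] ![0, 0, 1, 0, 0, 0] 4 5
    simpa [nilBracket_four] using And.intro h1 h2
  have h5 : ¬ SmallIsCentral (NilAlg 4) := fun h => by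
    have := congrFun (h (![0, 0, 0, 1, 0, 0] : Fin 6 → ℝ) (hc _) ((hs _).2 (by simp))
      (![1, 0, 0, 0, 0, 0] : Fin 6 → ℝ)) 5
    change nilBracket 4 _ _ 5 = 0 at this
    simp [nilBracket_four] at this
  have h6 : SmallIsAdditive (NilAlg 4) := by
    intro x y _ _ hx hy
    change Fin 6 → ℝ at x y
    rw [hs] at hx hy
    exact (hs (x + y)).2 (by simp [hx, hy])
  have h7 : CentralIsBracket (NilAlg 4) := by
    intro c hc
    change Fin 6 → ℝ at c
    have h0 (y : Fin 6 → ℝ) (k : Fin 6) : nilBracket 4 c y k = 0 := congrFun (hc y) k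
    have c0 : c 0 = 0 := by simpa [nilBracket_four] using h0 ![0, 1, 0, 0, 0, 0] 4
    have c1 : c 1 = 0 := by simpa [nilBracket_four] using h0 ![1, 0, 0, 0, 0, 0] 4
    have c2 : c 2 = 0 := by simpa [nilBracket_four] using h0 ![0, 1, 0, 0, 0, 0] 5
    have c3 : c 3 = 0 := by simpa [nilBracket_four] using h0 ![1, 0, 0, 0, 0, 0] 5
    refine ⟨(![1, 0, 0, 0, 0, 0] : Fin 6 → ℝ), (![0, -c 4, 0, -c 5, 0, 0] : Fin 6 → ℝ), ?_⟩
    change c = nilBracket 4 _ _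
    funext k; fin_cases k <;> simp [nilBracket_four, c0, c1, c2, c3]
  simp [lieClass, h1, h2, h3, h4, h5, h6, h7]

theorem lieClass_five : lieClass (NilAlg 5) = 5 := by
  have h1 : ¬ IsAb (NilAlg 5) :=
    not_isAb (x := ![1, 0, 0, 0, 0, 0]) (y := ![0, 0, 1, 0, 0, 0]) 4 (by simp [nilBracket_five])
  have h2 : IsTwoStep (NilAlg 5) := isTwoStep_iff.2 fun x y z k => by
    fin_cases k <;> simp [nilBracket_five]
  have h3 : ¬ DerivedInLine (NilAlg 5) := fun h => by
    have := h.minor ![1, 0, 0, 0, 0, 0] ![0, 0, 1, 0, 0, 0] ![1, 0, 0, 0, 0, 0]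
      ![0, 0, 0, 1, 0, 0] 4 5
    simp [nilBracket_five] at this
  have h4 : DerivedInPlane (NilAlg 5) := derivedInPlane_of fun x y k hk => by
    fin_cases k <;> simp [nilBracket_five] at hk ⊢
  have h5 : SmallIsCentral (NilAlg 5) := by
    intro x _ hx y
    change Fin 6 → ℝ at x y
    -- The two minors say `x 2 ^ 2 + x 3 ^ 2 = 0` and `x 0 ^ 2 + x 1 ^ 2 = 0`, which over the reals
    -- leaves only central vectors.
    have h1 := IsSmall.minor hx ![1, 0, 0, 0, 0, 0] ![0, 1, 0, 0, 0, 0] 4 5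
    have h2 := IsSmall.minor hx ![0, 0, 1, 0, 0, 0] ![0, 0, 0, 1, 0, 0] 4 5
    simp [nilBracket_five] at h1 h2
    have x0 : x 0 = 0 := by nlinarith
    have x1 : x 1 = 0 := by nlinarith
    have x2 : x 2 = 0 := by nlinarith
    have x3 : x 3 = 0 := by nlinarith
    change nilBracket 5 x y = 0
    funext k; fin_cases k <;> simp [nilBracket_five, x0, x1, x2, x3]
  simp [lieClass, h1, h2, h3, h4, h5]

theorem lieClass_six : lieClass (NilAlg 6) = 6 := by
  have h1 : ¬ IsAb (NilAlg 6) :=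
    not_isAb (x := ![1, 0, 0, 0, 0, 0]) (y := ![0, 1, 0, 0, 0, 0]) 4 (by simp [nilBracket_six])
  have h2 : IsTwoStep (NilAlg 6) := isTwoStep_iff.2 fun x y z k => by
    fin_cases k <;> simp [nilBracket_six]
  have h3 : ¬ DerivedInLine (NilAlg 6) := fun h => by
    have := h.minor ![1, 0, 0, 0, 0, 0] ![0, 1, 0, 0, 0, 0] ![1, 0, 0, 0, 0, 0]
      ![0, 0, 1, 0, 0, 0] 4 5
    simp [nilBracket_six] at this
  have h4 : DerivedInPlane (NilAlg 6) := derivedInPlane_of fun x y k hk => by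
    fin_cases k <;> simp [nilBracket_six] at hk ⊢
  have hc (x : Fin 6 → ℝ) : CentralizesDerived (L := NilAlg 6) x := fun y z => h2 x y z
  have hs (x : Fin 6 → ℝ) : IsSmall (L := NilAlg 6) x ↔ x 0 = 0 := by
    refine ⟨fun h => ?_, fun h => (isSmall_iff _).2 ⟨![0, 0, 0, 0, x 1, x 2], fun y =>
      ⟨y 0, fun k => by fin_cases k <;> simp [nilBracket_six, h]⟩⟩⟩
    have h1 := h.minor ![0, 1, 0, 0, 0, 0] ![0, 0, 1, 0, 0, 0] 4 5
    simpa [nilBracket_six] using h1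
  have h5 : ¬ SmallIsCentral (NilAlg 6) := fun h => by
    have := congrFun (h (![0, 1, 0, 0, 0, 0] : Fin 6 → ℝ) (hc _) ((hs _).2 (by simp))
      (![1, 0, 0, 0, 0, 0] : Fin 6 → ℝ)) 4
    change nilBracket 6 _ _ 4 = 0 at this
    simp [nilBracket_six] at this
  have h6 : SmallIsAdditive (NilAlg 6) := by
    intro x y _ _ hx hy
    change Fin 6 → ℝ at x y
    rw [hs] at hx hy
    exact (hs (x + y)).2 (by simp [hx, hy])
  have h7 : ¬ CentralIsBracket (NilAlg 6) := by
    intro h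
    obtain ⟨x, y, hxy⟩ := h (![0, 0, 0, 1, 0, 0] : Fin 6 → ℝ) fun y => by
      change Fin 6 → ℝ at y
      change nilBracket 6 _ y = 0
      rw [nilBracket_six]
      funext k; fin_cases k <;> simp
    change Fin 6 → ℝ at x y
    have h3 : (1 : ℝ) = nilBracket 6 x y 3 := congrFun hxy 3
    simp [nilBracket_six] at h3
  simp [lieClass, h1, h2, h3, h4, h5, h6, h7]

theorem lieClass_seven : lieClass (NilAlg 7) = 7 := by
  have h1 : ¬ IsAb (NilAlg 7) :=
    not_isAb (x := ![1, 0, 0, 0, 0, 0]) (y := ![0, 1, 0, 0, 0, 0]) 3 (by simp [nilBracket_seven])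
  have h2 : IsTwoStep (NilAlg 7) := isTwoStep_iff.2 fun x y z k => by
    fin_cases k <;> simp [nilBracket_seven]
  have h3 : ¬ DerivedInLine (NilAlg 7) := fun h => by
    have := h.minor ![1, 0, 0, 0, 0, 0] ![0, 1, 0, 0, 0, 0] ![1, 0, 0, 0, 0, 0]
      ![0, 0, 1, 0, 0, 0] 3 4
    simp [nilBracket_seven] at this
  have h4 : ¬ DerivedInPlane (NilAlg 7) := not_derivedInPlane
    ![0, 1, 0, 0, 0, 0] ![1, 0, 0, 0, 0, 0] ![0, 0, 1, 0, 0, 0] ![1, 0, 0, 0, 0, 0]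
    ![0, 0, 1, 0, 0, 0] ![0, 1, 0, 0, 0, 0]
    (by simp [nilBracket_seven]) (by simp [nilBracket_seven]) (by simp [nilBracket_seven])
  simp [lieClass, h1, h2, h3, h4]

theorem lieClass_eight : lieClass (NilAlg 8) = 8 := by
  have h1 : ¬ IsAb (NilAlg 8) :=
    not_isAb (x := ![1, 0, 0, 0, 0, 0]) (y := ![0, 1, 0, 0, 0, 0]) 5 (by simp [nilBracket_eight])
  have h2 : IsTwoStep (NilAlg 8) := isTwoStep_iff.2 fun x y z k => by
    fin_cases k <;> simp [nilBracket_eight]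
  have h3 : DerivedInLine (NilAlg 8) := derivedInLine_iff.2 ⟨![0, 0, 0, 0, 0, 1], fun x y =>
    ⟨nilBracket 8 x y 5, fun k => by fin_cases k <;> simp [nilBracket_eight]⟩⟩
  have h4 : ¬ HasCommutingPairs (NilAlg 8) := by
    rintro ⟨x, y, z, w, hxy, hzw, hxz, -, hyz, -⟩
    change Fin 6 → ℝ at x y z w
    have h1 : nilBracket 8 x z 5 = 0 := congrFun hxz 5
    have h2 : nilBracket 8 y z 5 = 0 := congrFun hyz 5
    simp [nilBracket_eight] at h1 h2
    have hd : x 0 * y 1 - y 0 * x 1 ≠ 0 := fun h => hxy <| by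
      change nilBracket 8 x y = 0
      funext k; fin_cases k <;> simp [nilBracket_eight]
      linarith
    -- The first two coordinates of `x` and `y` span a plane, and the part of `z` in that plane has
    -- zero determinant with both, so it vanishes.
    have z0 : z 0 = 0 := by
      refine (mul_eq_zero.1 (?_ : (x 0 * y 1 - y 0 * x 1) * z 0 = 0)).resolve_left hd
      linear_combination x 0 * h2 - y 0 * h1
    have z1 : z 1 = 0 := by
      refine (mul_eq_zero.1 (?_ : (x 0 * y 1 - y 0 * x 1) * z 1 = 0)).resolve_left hd
      linear_combination x 1 * h2 - y 1 * h1
    apply hzw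
    change nilBracket 8 z w = 0
    funext k; fin_cases k <;> simp [nilBracket_eight, z0, z1]
  simp [lieClass, h1, h2, h3, h4]

theorem lieClass_nine : lieClass (NilAlg 9) = 9 := by
  have h1 : ¬ IsAb (NilAlg 9) :=
    not_isAb (x := ![1, 0, 0, 0, 0, 0]) (y := ![0, 1, 0, 0, 0, 0]) 4
      (by simp [nilBracket_nine])
  have h2 : ¬ IsTwoStep (NilAlg 9) :=
    not_isTwoStep (x := ![0, 1, 0, 0, 0, 0]) (y := ![1, 0, 0, 0, 0, 0])
      (z := ![0, 1, 0, 0, 0, 0]) 5 (by simp [nilBracket_nine])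
  have h3 : ThirdInLine (NilAlg 9) := thirdInLine_iff.2 ⟨![0, 0, 0, 0, 0, 1], fun x y z =>
    ⟨nilBracket 9 x (nilBracket 9 y z) 5, fun k => by
      fin_cases k <;> simp [nilBracket_nine]⟩⟩
  have h4 : DerivedInPlane (NilAlg 9) := derivedInPlane_of fun x y k hk => by
    fin_cases k <;> simp [nilBracket_nine] at hk ⊢
  simp [lieClass, h1, h2, h3, h4]

theorem lieClass_ten : lieClass (NilAlg 10) = 10 := by
  have h1 : ¬ IsAb (NilAlg 10) :=
    not_isAb (x := ![1, 0, 0, 0, 0, 0]) (y := ![0, 1, 0, 0, 0, 0]) 3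
      (by simp [nilBracket_ten])
  have h2 : ¬ IsTwoStep (NilAlg 10) :=
    not_isTwoStep (x := ![1, 0, 0, 0, 0, 0]) (y := ![1, 0, 0, 0, 0, 0])
      (z := ![0, 1, 0, 0, 0, 0]) 5 (by simp [nilBracket_ten])
  have h3 : ThirdInLine (NilAlg 10) := thirdInLine_iff.2 ⟨![0, 0, 0, 0, 0, 1], fun x y z =>
    ⟨nilBracket 10 x (nilBracket 10 y z) 5, fun k => by
      fin_cases k <;> simp [nilBracket_ten]⟩⟩
  have h4 : ¬ DerivedInPlane (NilAlg 10) := not_derivedInPlane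
    ![0, 1, 0, 0, 0, 0] ![1, 0, 0, 0, 0, 0] ![0, 0, 1, 0, 0, 0] ![1, 0, 0, 0, 0, 0]
    ![0, 0, 0, 1, 0, 0] ![1, 0, 0, 0, 0, 0]
    (by simp [nilBracket_ten]) (by simp [nilBracket_ten]) (by simp [nilBracket_ten])
  have hc (x : Fin 6 → ℝ) (hx : CentralizesDerived (L := NilAlg 10) x) : x 0 = 0 := by
    simpa [nilBracket_ten] using
      (centralizesDerived_iff x).1 hx ![1, 0, 0, 0, 0, 0] ![0, 1, 0, 0, 0, 0] 5
  have h5 : CentralizerAbelian (NilAlg 10) := by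
    intro x y hx hy
    change Fin 6 → ℝ at x y
    change nilBracket 10 x y = 0
    funext k; fin_cases k <;> simp [nilBracket_ten, hc x hx, hc y hy]
  simp [lieClass, h1, h2, h3, h4, h5]

theorem lieClass_eleven : lieClass (NilAlg 11) = 11 := by
  have h1 : ¬ IsAb (NilAlg 11) :=
    not_isAb (x := ![1, 0, 0, 0, 0, 0]) (y := ![0, 1, 0, 0, 0, 0]) 3
      (by simp [nilBracket_eleven])
  have h2 : ¬ IsTwoStep (NilAlg 11) :=
    not_isTwoStep (x := ![1, 0, 0, 0, 0, 0]) (y := ![1, 0, 0, 0, 0, 0])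
      (z := ![0, 1, 0, 0, 0, 0]) 5 (by simp [nilBracket_eleven])
  have h3 : ThirdInLine (NilAlg 11) := thirdInLine_iff.2 ⟨![0, 0, 0, 0, 0, 1], fun x y z =>
    ⟨nilBracket 11 x (nilBracket 11 y z) 5, fun k => by
      fin_cases k <;> simp [nilBracket_eleven]⟩⟩
  have h4 : ¬ DerivedInPlane (NilAlg 11) := not_derivedInPlane
    ![0, 1, 0, 0, 0, 0] ![1, 0, 0, 0, 0, 0] ![0, 0, 1, 0, 0, 0] ![1, 0, 0, 0, 0, 0]
    ![0, 0, 0, 1, 0, 0] ![1, 0, 0, 0, 0, 0]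
    (by simp [nilBracket_eleven]) (by simp [nilBracket_eleven]) (by simp [nilBracket_eleven])
  have hc (x : Fin 6 → ℝ) (hx : CentralizesDerived (L := NilAlg 11) x) : x 0 = 0 := by
    simpa [nilBracket_eleven] using
      (centralizesDerived_iff x).1 hx ![1, 0, 0, 0, 0, 0] ![0, 1, 0, 0, 0, 0] 5
  have hu : CentralizesDerived (L := NilAlg 11) (![0, 1, 0, 0, 0, 0] : Fin 6 → ℝ) :=
    (centralizesDerived_iff _).2 fun y z k => by fin_cases k <;> simp [nilBracket_eleven]
  have hv : CentralizesDerived (L := NilAlg 11) (![0, 0, 1, 0, 0, 0] : Fin 6 → ℝ) :=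
    (centralizesDerived_iff _).2 fun y z k => by fin_cases k <;> simp [nilBracket_eleven]
  have h5 : ¬ CentralizerAbelian (NilAlg 11) := fun h => by
    have : nilBracket 11 ![0, 1, 0, 0, 0, 0] ![0, 0, 1, 0, 0, 0] 5 = 0 :=
      congrFun (h _ _ hu hv) 5
    simp [nilBracket_eleven] at this
  have h6 : CentralizerBracketInThird (NilAlg 11) := by
    intro x y hx hy
    change Fin 6 → ℝ at x y
    refine ⟨(![-(x 1 * y 2 - y 1 * x 2), 0, 0, 0, 0, 0] : Fin 6 → ℝ),
      (![1, 0, 0, 0, 0, 0] : Fin 6 → ℝ), (![0, 1, 0, 0, 0, 0] : Fin 6 → ℝ), ?_⟩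
    change nilBracket 11 x y = nilBracket 11 _ (nilBracket 11 _ _)
    funext k; fin_cases k <;> simp [nilBracket_eleven, hc x hx, hc y hy]
  simp [lieClass, h1, h2, h3, h4, h5, h6]

theorem lieClass_twelve : lieClass (NilAlg 12) = 12 := by
  have h1 : ¬ IsAb (NilAlg 12) :=
    not_isAb (x := ![1, 0, 0, 0, 0, 0]) (y := ![0, 1, 0, 0, 0, 0]) 3
      (by simp [nilBracket_twelve])
  have h2 : ¬ IsTwoStep (NilAlg 12) :=
    not_isTwoStep (x := ![0, 1, 0, 0, 0, 0]) (y := ![1, 0, 0, 0, 0, 0])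
      (z := ![0, 1, 0, 0, 0, 0]) 5 (by simp [nilBracket_twelve])
  have h3 : ThirdInLine (NilAlg 12) := thirdInLine_iff.2 ⟨![0, 0, 0, 0, 0, 1], fun x y z =>
    ⟨nilBracket 12 x (nilBracket 12 y z) 5, fun k => by
      fin_cases k <;> simp [nilBracket_twelve]⟩⟩
  have h4 : ¬ DerivedInPlane (NilAlg 12) := not_derivedInPlane
    ![0, 1, 0, 0, 0, 0] ![1, 0, 0, 0, 0, 0] ![0, 0, 1, 0, 0, 0] ![1, 0, 0, 0, 0, 0]
    ![0, 0, 0, 1, 0, 0] ![0, 1, 0, 0, 0, 0]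
    (by simp [nilBracket_twelve]) (by simp [nilBracket_twelve]) (by simp [nilBracket_twelve])
  have hu : CentralizesDerived (L := NilAlg 12) (![1, 0, 0, 0, 0, 0] : Fin 6 → ℝ) :=
    (centralizesDerived_iff _).2 fun y z k => by fin_cases k <;> simp [nilBracket_twelve]
  have hv : CentralizesDerived (L := NilAlg 12) (![0, 0, 1, 0, 0, 0] : Fin 6 → ℝ) :=
    (centralizesDerived_iff _).2 fun y z k => by fin_cases k <;> simp [nilBracket_twelve]
  have h5 : ¬ CentralizerAbelian (NilAlg 12) := fun h => by
    have : nilBracket 12 ![1, 0, 0, 0, 0, 0] ![0, 0, 1, 0, 0, 0] 4 = 0 :=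
      congrFun (h _ _ hu hv) 4
    simp [nilBracket_twelve] at this
  have h6 : ¬ CentralizerBracketInThird (NilAlg 12) := fun h => by
    obtain ⟨u, v, w, h⟩ := h _ _ hu hv
    change Fin 6 → ℝ at u v w
    have : nilBracket 12 ![1, 0, 0, 0, 0, 0] ![0, 0, 1, 0, 0, 0] 4 =
      nilBracket 12 u (nilBracket 12 v w) 4 := congrFun h 4
    simp [nilBracket_twelve] at this
  simp [lieClass, h1, h2, h3, h4, h5, h6]

theorem lieClass_thirteen : lieClass (NilAlg 13) = 12 := by
  have h1 : ¬ IsAb (NilAlg 13) :=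
    not_isAb (x := ![1, 0, 0, 0, 0, 0]) (y := ![0, 1, 0, 0, 0, 0]) 3
      (by simp [nilBracket_thirteen])
  have h2 : ¬ IsTwoStep (NilAlg 13) :=
    not_isTwoStep (x := ![1, 0, 0, 0, 0, 0]) (y := ![1, 0, 0, 0, 0, 0])
      (z := ![0, 1, 0, 0, 0, 0]) 4 (by simp [nilBracket_thirteen])
  have h3 : ¬ ThirdInLine (NilAlg 13) := fun h => by
    have := h.minor ![1, 0, 0, 0, 0, 0] ![1, 0, 0, 0, 0, 0] ![0, 1, 0, 0, 0, 0]
      ![0, 1, 0, 0, 0, 0] ![1, 0, 0, 0, 0, 0] ![0, 1, 0, 0, 0, 0] 4 5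
    simp [nilBracket_thirteen] at this
  have h4 : CentralIsTripleBracket (NilAlg 13) := by
    intro c hc
    change Fin 6 → ℝ at c
    have h0 (y : Fin 6 → ℝ) (k : Fin 6) : nilBracket 13 c y k = 0 := congrFun (hc y) k
    have a1 := h0 ![0, 0, 0, 1, 0, 0] 4
    have a2 := h0 ![0, 0, 0, 1, 0, 0] 5
    have a3 := h0 ![1, 0, 0, 0, 0, 0] 4
    have a4 := h0 ![1, 0, 0, 0, 0, 0] 5
    have a5 := h0 ![0, 1, 0, 0, 0, 0] 5
    simp [nilBracket_thirteen] at a1 a2 a3 a4 a5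
    have c0 : c 0 = 0 := by linarith
    have c1 : c 1 = 0 := by linarith
    have c2 : c 2 = 0 := by linarith
    have c3 : c 3 = 0 := by linarith
    refine ⟨(![c 4, c 5, 0, 0, 0, 0] : Fin 6 → ℝ),
      (![1, 0, 0, 0, 0, 0] : Fin 6 → ℝ), (![0, 1, 0, 0, 0, 0] : Fin 6 → ℝ), ?_⟩
    change c = nilBracket 13 _ (nilBracket 13 _ _)
    funext k; fin_cases k <;> simp [nilBracket_thirteen, c0, c1, c2, c3]
  have hc (x : Fin 6 → ℝ) : CentralizesDerived (L := NilAlg 13) x ↔ x 0 = 0 ∧ x 1 = 0 := by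
    refine ⟨fun hx => ?_, fun h => (centralizesDerived_iff x).2 fun y z k => by
      fin_cases k <;> simp [nilBracket_thirteen, h.1, h.2]⟩
    have a1 := (centralizesDerived_iff x).1 hx ![1, 0, 0, 0, 0, 0] ![0, 1, 0, 0, 0, 0] 4
    have a2 := (centralizesDerived_iff x).1 hx ![1, 0, 0, 0, 0, 0] ![0, 1, 0, 0, 0, 0] 5
    simp [nilBracket_thirteen] at a1 a2
    exact ⟨by assumption, by assumption⟩
  have hs : IsSmall (L := NilAlg 13) (![0, 0, 1, 0, 0, 0] : Fin 6 → ℝ) :=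
    (isSmall_iff _).2 ⟨![0, 0, 0, 0, 1, 0], fun y => ⟨y 0, fun k => by
      fin_cases k <;> simp [nilBracket_thirteen]⟩⟩
  have h5 : ¬ SmallIsCentral (NilAlg 13) := fun h => by
    have : nilBracket 13 ![0, 0, 1, 0, 0, 0] ![1, 0, 0, 0, 0, 0] 4 = 0 :=
      congrFun (h _ ((hc _).2 (by simp)) hs _) 4
    simp [nilBracket_thirteen] at this
  have hs' : IsSmall (L := NilAlg 13) (![0, 0, -1, 1, 0, 0] : Fin 6 → ℝ) :=
    (isSmall_iff _).2 ⟨![0, 0, 0, 0, 0, 1], fun y => ⟨y 1, fun k => by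
      fin_cases k <;> simp [nilBracket_thirteen]⟩⟩
  have h6 : ¬ SmallIsAdditive (NilAlg 13) := fun h => by
    have hm := IsSmall.minor (n := 13)
      (x := fun i => ![0, 0, 1, 0, 0, 0] i + ![0, 0, -1, 1, 0, 0] i)
      (h _ _ ((hc _).2 (by simp)) ((hc _).2 (by simp)) hs hs')
      ![1, 0, 0, 0, 0, 0] ![0, 1, 0, 0, 0, 0] 4 5
    simp [nilBracket_thirteen] at hm
  simp [lieClass, h1, h2, h3, h4, h5, h6]

theorem lieClass_fourteen : lieClass (NilAlg 14) = 11 := by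
  have h1 : ¬ IsAb (NilAlg 14) :=
    not_isAb (x := ![1, 0, 0, 0, 0, 0]) (y := ![0, 1, 0, 0, 0, 0]) 3
      (by simp [nilBracket_fourteen])
  have h2 : ¬ IsTwoStep (NilAlg 14) :=
    not_isTwoStep (x := ![1, 0, 0, 0, 0, 0]) (y := ![1, 0, 0, 0, 0, 0])
      (z := ![0, 1, 0, 0, 0, 0]) 4 (by simp [nilBracket_fourteen])
  have h3 : ¬ ThirdInLine (NilAlg 14) := fun h => by
    have := h.minor ![1, 0, 0, 0, 0, 0] ![1, 0, 0, 0, 0, 0] ![0, 1, 0, 0, 0, 0]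
      ![0, 1, 0, 0, 0, 0] ![1, 0, 0, 0, 0, 0] ![0, 1, 0, 0, 0, 0] 4 5
    simp [nilBracket_fourteen] at this
  have h4 : CentralIsTripleBracket (NilAlg 14) := by
    intro c hc
    change Fin 6 → ℝ at c
    have h0 (y : Fin 6 → ℝ) (k : Fin 6) : nilBracket 14 c y k = 0 := congrFun (hc y) k
    have a1 := h0 ![0, 0, 0, 1, 0, 0] 4
    have a2 := h0 ![0, 0, 0, 1, 0, 0] 5
    have a3 := h0 ![1, 0, 0, 0, 0, 0] 4
    have a4 := h0 ![1, 0, 0, 0, 0, 0] 5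
    have a5 := h0 ![0, 1, 0, 0, 0, 0] 5
    simp [nilBracket_fourteen] at a1 a2 a3 a4 a5
    have c0 : c 0 = 0 := by linarith
    have c1 : c 1 = 0 := by linarith
    have c2 : c 2 = 0 := by linarith
    have c3 : c 3 = 0 := by linarith
    refine ⟨(![c 4, -c 5, 0, 0, 0, 0] : Fin 6 → ℝ),
      (![1, 0, 0, 0, 0, 0] : Fin 6 → ℝ), (![0, 1, 0, 0, 0, 0] : Fin 6 → ℝ), ?_⟩
    change c = nilBracket 14 _ (nilBracket 14 _ _)
    funext k; fin_cases k <;> simp [nilBracket_fourteen, c0, c1, c2, c3]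
  have hc (x : Fin 6 → ℝ) : CentralizesDerived (L := NilAlg 14) x ↔ x 0 = 0 ∧ x 1 = 0 := by
    refine ⟨fun hx => ?_, fun h => (centralizesDerived_iff x).2 fun y z k => by
      fin_cases k <;> simp [nilBracket_fourteen, h.1, h.2]⟩
    have a1 := (centralizesDerived_iff x).1 hx ![1, 0, 0, 0, 0, 0] ![0, 1, 0, 0, 0, 0] 4
    have a2 := (centralizesDerived_iff x).1 hx ![1, 0, 0, 0, 0, 0] ![0, 1, 0, 0, 0, 0] 5
    simp [nilBracket_fourteen] at a1 a2
    exact ⟨by assumption, by assumption⟩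
  have hs : IsSmall (L := NilAlg 14) (![0, 0, 1, 0, 0, 0] : Fin 6 → ℝ) :=
    (isSmall_iff _).2 ⟨![0, 0, 0, 0, 0, 1], fun y => ⟨y 0, fun k => by
      fin_cases k <;> simp [nilBracket_fourteen]⟩⟩
  have h5 : ¬ SmallIsCentral (NilAlg 14) := fun h => by
    have : nilBracket 14 ![0, 0, 1, 0, 0, 0] ![1, 0, 0, 0, 0, 0] 5 = 0 :=
      congrFun (h _ ((hc _).2 (by simp)) hs _) 5
    simp [nilBracket_fourteen] at this
  have hx3 (x : Fin 6 → ℝ) (h : IsSmall (L := NilAlg 14) x) (h0 : x 0 = 0 ∧ x 1 = 0) :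
      x 3 = 0 := by
    have := h.minor ![1, 0, 0, 0, 0, 0] ![0, 1, 0, 0, 0, 0] 4 5
    simpa [nilBracket_fourteen, h0.1, h0.2] using this
  have h6 : SmallIsAdditive (NilAlg 14) := by
    intro x y cx cy hx hy
    change Fin 6 → ℝ at x y
    rw [hc] at cx cy
    have x3 := hx3 x hx cx
    have y3 := hx3 y hy cy
    refine (isSmall_iff (x + y)).2 ⟨![0, 0, 0, 0, 0, 1], fun z =>
      ⟨nilBracket 14 (x + y) z 5, fun k => ?_⟩⟩
    fin_cases k <;> simp [nilBracket_fourteen, cx.1, cx.2, cy.1, cy.2, x3, y3]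
  simp [lieClass, h1, h2, h3, h4, h5, h6]

theorem lieClass_fifteen : lieClass (NilAlg 15) = 15 := by
  have h1 : ¬ IsAb (NilAlg 15) :=
    not_isAb (x := ![1, 0, 0, 0, 0, 0]) (y := ![0, 1, 0, 0, 0, 0]) 3
      (by simp [nilBracket_fifteen])
  have h2 : ¬ IsTwoStep (NilAlg 15) :=
    not_isTwoStep (x := ![1, 0, 0, 0, 0, 0]) (y := ![1, 0, 0, 0, 0, 0])
      (z := ![0, 1, 0, 0, 0, 0]) 5 (by simp [nilBracket_fifteen])
  have h3 : ¬ ThirdInLine (NilAlg 15) := fun h => by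
    have := h.minor ![1, 0, 0, 0, 0, 0] ![1, 0, 0, 0, 0, 0] ![0, 1, 0, 0, 0, 0]
      ![0, 1, 0, 0, 0, 0] ![1, 0, 0, 0, 0, 0] ![0, 1, 0, 0, 0, 0] 4 5
    simp [nilBracket_fifteen] at this
  have h4 : CentralIsTripleBracket (NilAlg 15) := by
    intro c hc
    change Fin 6 → ℝ at c
    have h0 (y : Fin 6 → ℝ) (k : Fin 6) : nilBracket 15 c y k = 0 := congrFun (hc y) k
    have a1 := h0 ![0, 0, 0, 1, 0, 0] 4
    have a2 := h0 ![0, 0, 0, 1, 0, 0] 5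
    have a3 := h0 ![1, 0, 0, 0, 0, 0] 4
    have a4 := h0 ![1, 0, 0, 0, 0, 0] 5
    have a5 := h0 ![0, 1, 0, 0, 0, 0] 5
    simp [nilBracket_fifteen] at a1 a2 a3 a4 a5
    have c0 : c 0 = 0 := by linarith
    have c1 : c 1 = 0 := by linarith
    have c2 : c 2 = 0 := by linarith
    have c3 : c 3 = 0 := by linarith
    refine ⟨(![c 5, -c 4, 0, 0, 0, 0] : Fin 6 → ℝ),
      (![1, 0, 0, 0, 0, 0] : Fin 6 → ℝ), (![0, 1, 0, 0, 0, 0] : Fin 6 → ℝ), ?_⟩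
    change c = nilBracket 15 _ (nilBracket 15 _ _)
    funext k; fin_cases k <;> simp [nilBracket_fifteen, c0, c1, c2, c3]
  have hc (x : Fin 6 → ℝ) : CentralizesDerived (L := NilAlg 15) x ↔ x 0 = 0 ∧ x 1 = 0 := by
    refine ⟨fun hx => ?_, fun h => (centralizesDerived_iff x).2 fun y z k => by
      fin_cases k <;> simp [nilBracket_fifteen, h.1, h.2]⟩
    have a1 := (centralizesDerived_iff x).1 hx ![1, 0, 0, 0, 0, 0] ![0, 1, 0, 0, 0, 0] 4
    have a2 := (centralizesDerived_iff x).1 hx ![1, 0, 0, 0, 0, 0] ![0, 1, 0, 0, 0, 0] 5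
    simp [nilBracket_fifteen] at a1 a2
    exact ⟨by assumption, by assumption⟩
  have h5 : SmallIsCentral (NilAlg 15) := by
    intro x hx hs y
    change Fin 6 → ℝ at x y
    obtain ⟨x0, x1⟩ := (hc x).1 hx
    have := IsSmall.minor hs ![1, 0, 0, 0, 0, 0] ![0, 1, 0, 0, 0, 0] 4 5
    simp [nilBracket_fifteen] at this
    have x2 : x 2 = 0 := by nlinarith
    have x3 : x 3 = 0 := by nlinarith
    change nilBracket 15 x y = 0
    funext k; fin_cases k <;> simp [nilBracket_fifteen, x0, x1, x2, x3]
  simp [lieClass, h1, h2, h3, h4, h5]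

theorem lieClass_sixteen : lieClass (NilAlg 16) = 7 := by
  have h1 : ¬ IsAb (NilAlg 16) :=
    not_isAb (x := ![1, 0, 0, 0, 0, 0]) (y := ![0, 1, 0, 0, 0, 0]) 3
      (by simp [nilBracket_sixteen])
  have h2 : ¬ IsTwoStep (NilAlg 16) :=
    not_isTwoStep (x := ![1, 0, 0, 0, 0, 0]) (y := ![1, 0, 0, 0, 0, 0])
      (z := ![0, 1, 0, 0, 0, 0]) 4 (by simp [nilBracket_sixteen])
  have h3 : ¬ ThirdInLine (NilAlg 16) := fun h => by
    have := h.minor ![1, 0, 0, 0, 0, 0] ![1, 0, 0, 0, 0, 0] ![0, 1, 0, 0, 0, 0]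
      ![0, 1, 0, 0, 0, 0] ![1, 0, 0, 0, 0, 0] ![0, 1, 0, 0, 0, 0] 4 5
    simp [nilBracket_sixteen] at this
  have h4 : ¬ CentralIsTripleBracket (NilAlg 16) := by
    intro h
    obtain ⟨x, y, z, hxy⟩ := h (![0, 0, 1, 0, 0, 0] : Fin 6 → ℝ) fun y => by
      change Fin 6 → ℝ at y
      change nilBracket 16 _ y = 0
      rw [nilBracket_sixteen]
      funext k; fin_cases k <;> simp
    change Fin 6 → ℝ at x y z
    have h2 : (1 : ℝ) = nilBracket 16 x (nilBracket 16 y z) 2 := congrFun hxy 2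
    simp [nilBracket_sixteen] at h2
  simp [lieClass, h1, h2, h3, h4]

/-- The isomorphism class of `h_n`, `n ≤ 16`, as far as `lieClass` sees it. -/
theorem lieClass_nilAlg {n : ℕ} (hn : n ∈ Finset.Icc 1 16) : lieClass (NilAlg n) =
    if n = 16 then 7 else if n = 13 then 12 else if n = 14 then 11 else n := by
  rw [Finset.mem_Icc] at hn
  obtain ⟨h1, h2⟩ := hn
  interval_cases n
  · exact lieClass_one
  · exact lieClass_two
  · exact lieClass_three
  · exact lieClass_four
  · exact lieClass_five
  · exact lieClass_six
  · exact lieClass_seven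
  · exact lieClass_eight
  · exact lieClass_nine
  · exact lieClass_ten
  · exact lieClass_eleven
  · exact lieClass_twelve
  · exact lieClass_thirteen
  · exact lieClass_fourteen
  · exact lieClass_fifteen
  · exact lieClass_sixteen

/-! ### The reduced structure equations on `ℂ³` -/

namespace Constants

variable (c : Constants)

/-- The 2-form `d ω^3`, in the coordinates given by `ω`. -/
def form (x y : Fin 3 → ℂ) : ℂ :=
  c.ρ * (x 0 * y 1 - y 0 * x 1) + c.A * (x 0 * conj (y 0) - y 0 * conj (x 0)) +
    c.B * (x 0 * conj (y 1) - y 0 * conj (x 1)) + c.C * (x 1 * conj (y 0) - y 1 * conj (x 0)) +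
    c.D * (x 1 * conj (y 1) - y 1 * conj (x 1))

/-- The bracket, in the coordinates given by `ω`. -/
def bracket (x y : Fin 3 → ℂ) : Fin 3 → ℂ :=
  ![0, -(c.ε * (x 0 * conj (y 0) - y 0 * conj (x 0))), -c.form x y]

@[simp] theorem bracket_zero (x y : Fin 3 → ℂ) : c.bracket x y 0 = 0 := rfl
@[simp] theorem bracket_one (x y : Fin 3 → ℂ) :
    c.bracket x y 1 = -(c.ε * (x 0 * conj (y 0) - y 0 * conj (x 0))) := rfl
@[simp] theorem bracket_two (x y : Fin 3 → ℂ) : c.bracket x y 2 = -c.form x y := rfl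

/-- The real Lie algebra with constants `c` has a basis of 1-forms with the structure equations
of `h_n`. -/
def HasModel (n : ℕ) : Prop :=
  ∃ e : Fin 6 → (Fin 3 → ℂ) →ₗ[ℝ] ℝ, (∀ x, (∀ k, e k x = 0) → x = 0) ∧
    ∀ x y k, e k (c.bracket x y) = nilBracket n (fun i => e i x) (fun i => e i y) k

variable {c}

theorem HasModel.exists_equiv {n : ℕ} (h : c.HasModel n) :
    ∃ ψ : (Fin 3 → ℂ) ≃ₗ[ℝ] NilAlg n, ∀ x y, ψ (c.bracket x y) = ⁅ψ x, ψ y⁆ := by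
  obtain ⟨e, he, hb⟩ := h
  have hinj : Function.Injective (LinearMap.pi e) := by
    rw [injective_iff_map_eq_zero]
    exact fun x hx => he x fun k => congrFun hx k
  have hd : Module.finrank ℝ (Fin 3 → ℂ) = Module.finrank ℝ (Fin 6 → ℝ) := by
    rw [Module.finrank_pi_fintype]
    simp
  let ψ : (Fin 3 → ℂ) ≃ₗ[ℝ] (Fin 6 → ℝ) := LinearEquiv.ofInjectiveOfFinrankEq _ hinj hd
  refine ⟨ψ, fun x y => ?_⟩
  funext k
  exact hb x y k

end Constants

/-! ### Coordinates given by a basis of `(1,0)`-forms -/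

section Coordinates

variable {g : Type*} [LieRing g] [LieAlgebra ℝ g] {J : g →ₗ[ℝ] g} {m : ℕ}

/-- The coordinates given by a basis of `(1,0)`-forms. -/
def coord (ω : Module.Basis (Fin m) ℂ (forms10 J)) : g →ₗ[ℝ] (Fin m → ℂ) :=
  LinearMap.pi fun i => (ω i : g →ₗ[ℝ] ℂ)

theorem coord_apply (ω : Module.Basis (Fin m) ℂ (forms10 J)) (x : g) (i : Fin m) :
    coord ω x i = (ω i : g →ₗ[ℝ] ℂ) x := rfl

theorem coord_J (ω : Module.Basis (Fin m) ℂ (forms10 J)) (x : g) :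
    coord ω (J x) = Complex.I • coord ω x :=
  funext fun i => (ω i).2 x

/-- Every real form `f` is the real part of the `(1,0)`-form `f - i f ∘ J`. Hence a vector killed by
all `ω^i` is killed by all real forms. -/
theorem coord_injective (hJ : ∀ x, J (J x) = -x) (ω : Module.Basis (Fin m) ℂ (forms10 J)) :
    Function.Injective (coord ω) := by
  rw [injective_iff_map_eq_zero]
  intro x hx
  have hα (α : forms10 J) : (α : g →ₗ[ℝ] ℂ) x = 0 := by
    have hi (i : Fin m) : (ω i : g →ₗ[ℝ] ℂ) x = 0 := congrFun hx i
    have h := congrArg (fun β : forms10 J => (β : g →ₗ[ℝ] ℂ) x) (ω.sum_repr α)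
    simp only [AddSubmonoidClass.coe_finsetSum, Submodule.coe_smul, LinearMap.sum_apply,
      LinearMap.smul_apply, hi, smul_zero, Finset.sum_const_zero] at h
    exact h.symm
  rw [← Module.forall_dual_apply_eq_zero_iff ℝ]
  intro f
  let F : g →ₗ[ℝ] ℂ := Complex.ofRealCLM.toLinearMap ∘ₗ f
  let α : g →ₗ[ℝ] ℂ := F - Complex.I • (F ∘ₗ J)
  have hmem : α ∈ forms10 J := by
    intro y
    simp only [α, F, LinearMap.sub_apply, LinearMap.smul_apply, LinearMap.comp_apply, hJ,
      map_neg, smul_eq_mul]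
    linear_combination (F (J y)) * Complex.I_mul_I
  have h0 := congrArg Complex.re (hα ⟨α, hmem⟩)
  simpa [α, F] using h0

/-- The range is a complex subspace, since `J` becomes multiplication by `i`. A complex functional
vanishing on it is a linear relation among the `ω^i`, hence zero. -/
theorem coord_surjective (ω : Module.Basis (Fin m) ℂ (forms10 J)) :
    Function.Surjective (coord ω) := by
  let W : Submodule ℂ (Fin m → ℂ) :=
    { carrier := Set.range (coord ω)
      add_mem' := by
        rintro _ _ ⟨x, rfl⟩ ⟨y, rfl⟩
        exact ⟨x + y, map_add _ _ _⟩
      zero_mem' := ⟨0, map_zero _⟩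
      smul_mem' := by
        rintro z _ ⟨x, rfl⟩
        refine ⟨z.re • x + z.im • J x, ?_⟩
        rw [map_add, map_smul, map_smul, coord_J]
        funext i
        simp only [Pi.add_apply, Pi.smul_apply, Complex.real_smul, smul_eq_mul]
        nth_rewrite 3 [← Complex.re_add_im z]
        ring }
  have hW : W = ⊤ := by
    by_contra hne
    obtain ⟨f, hf0, hf⟩ := Submodule.exists_le_ker_of_lt_top W (lt_top_iff_ne_top.2 hne)
    have hsum : ∑ i, f (Pi.single i 1) • ω i = 0 := by
      apply Subtype.ext
      ext x
      have h1 : f (coord ω x) = 0 := hf ⟨x, rfl⟩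
      rw [LinearMap.pi_apply_eq_sum_univ f] at h1
      simp only [smul_eq_mul, coord_apply] at h1
      simp only [AddSubmonoidClass.coe_finsetSum, Submodule.coe_smul, LinearMap.sum_apply,
        LinearMap.smul_apply, smul_eq_mul, ZeroMemClass.coe_zero, LinearMap.zero_apply]
      rw [← h1]
      refine Finset.sum_congr rfl fun i _ => ?_
      rw [mul_comm]
      congr 2
      funext j
      simp [Pi.single_apply, eq_comm]
    have h0 := Fintype.linearIndependent_iff.1 ω.linearIndependent _ hsum
    apply hf0
    apply LinearMap.pi_ext'
    intro i
    ext
    simpa using h0 i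
  intro v
  have : v ∈ W := hW ▸ Submodule.mem_top
  exact this

theorem coord_bijective (hJ : ∀ x, J (J x) = -x) (ω : Module.Basis (Fin m) ℂ (forms10 J)) :
    Function.Bijective (coord ω) :=
  ⟨coord_injective hJ ω, coord_surjective ω⟩

theorem card_eq_three (hJ : ∀ x, J (J x) = -x) (ω : Module.Basis (Fin m) ℂ (forms10 J))
    (hg : Module.finrank ℝ g = 6) : m = 3 := by
  have := (LinearEquiv.ofBijective _ (coord_bijective hJ ω)).finrank_eq
  rw [hg, Module.finrank_pi_fintype] at this
  simp at this
  omega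

theorem dForm_apply (α : g →ₗ[ℝ] ℂ) (x y : g) : dForm α x y = -α ⁅x, y⁆ := rfl

theorem wedge_apply (α β : g →ₗ[ℝ] ℂ) (x y : g) : wedge α β x y = α x * β y - α y * β x := rfl

theorem conjForm_apply (α : g →ₗ[ℝ] ℂ) (x : g) : conjForm α x = conj (α x) := rfl

variable {ω : Module.Basis (Fin 3) ℂ (forms10 J)} {c : Constants}

theorem IsReduced.dForm_two (h : IsReduced ω c) (x y : g) :
    dForm (ω 2 : g →ₗ[ℝ] ℂ) x y = c.form (coord ω x) (coord ω y) := by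
  rw [h.d_three]
  simp only [LinearMap.add_apply, LinearMap.smul_apply, wedge_apply, conjForm_apply, smul_eq_mul]
  rfl

theorem IsReduced.coord_lie (h : IsReduced ω c) (x y : g) :
    coord ω ⁅x, y⁆ = c.bracket (coord ω x) (coord ω y) := by
  funext i
  have h0 := LinearMap.congr_fun₂ h.d_one x y
  have h1 := LinearMap.congr_fun₂ h.d_two x y
  have h2 := h.dForm_two x y
  rw [dForm_apply] at h0 h1 h2
  fin_cases i
  · exact neg_eq_zero.1 h0
  · exact neg_eq_iff_eq_neg.1 h1
  · exact neg_eq_iff_eq_neg.1 h2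

theorem IsReduced.nonempty_lieEquiv (hJ : ∀ x, J (J x) = -x) (h : IsReduced ω c) {n : ℕ}
    (hc : c.HasModel n) : Nonempty (g ≃ₗ⁅ℝ⁆ NilAlg n) := by
  obtain ⟨ψ, hψ⟩ := hc.exists_equiv
  let φ := (LinearEquiv.ofBijective _ (coord_bijective hJ ω)).trans ψ
  have hφ (x y : g) : φ ⁅x, y⁆ = ⁅φ x, φ y⁆ := by
    change ψ (coord ω ⁅x, y⁆) = ⁅ψ (coord ω x), ψ (coord ω y)⁆
    rw [h.coord_lie, hψ]
  exact ⟨{ φ with map_lie' := hφ _ _ }⟩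

end Coordinates

/-! ### Decomposable 2-forms -/

section Decomposable

variable {V K : Type*} [AddCommGroup V] [Module ℝ V] [Field K] [Algebra ℝ K]

/-- Plücker relations: a 2-form `P` with `P ∧ P = 0` is decomposable. -/
theorem exists_eq_wedge (P : V →ₗ[ℝ] V →ₗ[ℝ] K)
    (hP : ∀ x y z w, P x y * P z w - P x z * P y w + P x w * P y z = 0) :
    ∃ u v : V →ₗ[ℝ] K, (∀ x y, P x y = u x * v y - u y * v x) ∧
      ∀ z, (∀ w, P w z = 0) → u z = 0 ∧ v z = 0 := by
  by_cases h0 : ∃ X Y, P X Y ≠ 0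
  · obtain ⟨X, Y, hXY⟩ := h0
    -- Contracting `P ∧ P = 0` with `X` and `Y` expresses `P` through the 1-forms `P X` and `P Y`.
    refine ⟨(P X Y)⁻¹ • P X, P Y, fun x y => ?_, fun z hz => by simp [hz]⟩
    simp only [LinearMap.smul_apply, smul_eq_mul]
    field_simp
    linear_combination hP X Y x y
  · push Not at h0
    exact ⟨0, 0, fun x y => by simp [h0], fun z _ => by simp⟩

/-- If `P = u ∧ v` is not zero and `P ∧ Q = 0` then `Q` is in the ideal generated by `u, v`. -/
theorem exists_eq_wedge_add (P Q : V →ₗ[ℝ] V →ₗ[ℝ] K)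
    (hP : ∀ x y z w, P x y * P z w - P x z * P y w + P x w * P y z = 0)
    (hPQ : ∀ x y z w, P x y * Q z w - P x z * Q y w + P x w * Q y z + P y z * Q x w
      - P y w * Q x z + P z w * Q x y = 0) (h0 : ∃ X Y, P X Y ≠ 0) :
    ∃ u v a b : V →ₗ[ℝ] K, (∀ x y, P x y = u x * v y - u y * v x) ∧
      (∀ x y, Q x y = u x * a y - u y * a x + (v x * b y - v y * b x)) ∧
      ∀ z, (∀ w, P w z = 0) → (∀ w, Q w z = 0) → u z = 0 ∧ v z = 0 ∧ a z = 0 ∧ b z = 0 := by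
  obtain ⟨X, Y, hXY⟩ := h0
  -- Contracting `P ∧ Q = 0` with `X` and `Y` gives `P X Y • Q` in terms of `P X`, `P Y`, `Q X`, `Q
  -- Y` and `P`. The correction of `Q Y` by a multiple of `P Y` absorbs the last term.
  refine ⟨(P X Y)⁻¹ • P X, P Y, Q Y - ((P X Y)⁻¹ * Q X Y) • P Y, -(P X Y)⁻¹ • Q X,
    fun x y => ?_, fun x y => ?_, fun z hz hz' => by simp [hz, hz']⟩
  · simp only [LinearMap.smul_apply, smul_eq_mul]
    field_simp
    linear_combination hP X Y x y
  · simp only [LinearMap.smul_apply, smul_eq_mul, LinearMap.sub_apply]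
    field_simp
    linear_combination P X Y * hPQ X Y x y - Q X Y * hP X Y x y

end Decomposable

/-- The first hypothesis says that `s` and `t` form a real basis of `ℂ`. -/
theorem eq_zero_of_re_mul_eq_zero {s t z : ℂ} (h : (conj s * t).im ≠ 0) (hs : (s * z).re = 0)
    (ht : (t * z).re = 0) : z = 0 := by
  simp only [Complex.mul_re, Complex.mul_im, Complex.conj_re, Complex.conj_im] at h hs ht
  apply Complex.ext
  · refine (mul_eq_zero.1 (?_ : (s.re * t.im + -s.im * t.re) * z.re = 0)).resolve_left h
    linear_combination t.im * hs - s.im * ht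
  · refine (mul_eq_zero.1 (?_ : (s.re * t.im + -s.im * t.re) * z.im = 0)).resolve_left h
    linear_combination t.re * hs - s.re * ht

theorem eq_zero_of_mul_add_mul_conj {s t z : ℂ} (h : ‖s‖ ≠ ‖t‖) (hz : s * z + t * conj z = 0) :
    z = 0 := by
  have h1 : ‖s * z‖ = ‖t * conj z‖ := by rw [eq_neg_of_add_eq_zero_left hz, norm_neg]
  rw [norm_mul, norm_mul, RCLike.norm_conj] at h1
  by_contra h0
  exact h (mul_right_cancel₀ (norm_ne_zero_iff.2 h0) h1)

/-! ### The 2-form `dω³` and the real models with `ε = 0`. -/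

namespace Constants

variable {c : Constants}

theorem two_mul_Δ₂ (c : Constants) : (2 * c.Δ₂ : ℂ) =
    c.B * conj c.B + c.C * conj c.C - c.A * conj c.D - conj c.A * c.D - c.ρ * conj c.ρ := by
  have h : ((c.A * conj c.D + conj c.A * c.D).re : ℂ) = c.A * conj c.D + conj c.A * c.D := by
    rw [Complex.re_eq_add_conj]
    simp only [map_add, map_mul, Complex.conj_conj]
    ring
  rw [Δ₂]
  push_cast
  rw [h, ← Complex.mul_conj', ← Complex.mul_conj', ← Complex.mul_conj']
  ring

/-- The volume form on `ℂ²`. -/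
def vol (x y z w : Fin 3 → ℂ) : ℂ :=
  let p (x y : Fin 3 → ℂ) : ℂ := x 0 * conj (y 0) - y 0 * conj (x 0)
  let q (x y : Fin 3 → ℂ) : ℂ := x 1 * conj (y 1) - y 1 * conj (x 1)
  p x y * q z w - p x z * q y w + p x w * q y z + p y z * q x w - p y w * q x z + p z w * q x y

theorem conj_vol (x y z w : Fin 3 → ℂ) : conj (vol x y z w) = vol x y z w := by
  simp only [vol, map_add, map_sub, map_mul, Complex.conj_conj]
  ring

/-- The left side is half of `Ω ∧ Ω`, where `Ω = dω³`. Together with `form_conj_polar`, which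
computes `Ω ∧ conj Ω`, it shows that `Δ₁` and `Δ₂` are the coefficients of the wedge square on the
span of `Ω` and `conj Ω`. -/
theorem form_plucker (x y z w : Fin 3 → ℂ) :
    c.form x y * c.form z w - c.form x z * c.form y w + c.form x w * c.form y z =
      c.Δ₁ * vol x y z w := by
  simp only [form, vol, Δ₁]
  ring

theorem form_conj_polar (x y z w : Fin 3 → ℂ) :
    c.form x y * conj (c.form z w) - c.form x z * conj (c.form y w)
      + c.form x w * conj (c.form y z) + c.form y z * conj (c.form x w)
      - c.form y w * conj (c.form x z) + c.form z w * conj (c.form x y) =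
      2 * c.Δ₂ * vol x y z w := by
  rw [two_mul_Δ₂]
  simp only [form, vol, map_add, map_sub, map_mul, Complex.conj_conj]
  ring

theorem form_swap (x y : Fin 3 → ℂ) : c.form x y = -c.form y x := by
  simp only [form]; ring

theorem form_add_left (x y z : Fin 3 → ℂ) : c.form (x + y) z = c.form x z + c.form y z := by
  simp only [form, Pi.add_apply, map_add]; ring

theorem form_smul_left (r : ℝ) (x y : Fin 3 → ℂ) : c.form (r • x) y = r * c.form x y := by
  simp only [form, Pi.smul_apply, Complex.real_smul, map_mul, Complex.conj_ofReal]; ring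

theorem form_add_right (x y z : Fin 3 → ℂ) : c.form x (y + z) = c.form x y + c.form x z := by
  rw [form_swap, form_add_left, form_swap y, form_swap z]; ring

theorem form_smul_right (r : ℝ) (x y : Fin 3 → ℂ) : c.form x (r • y) = r * c.form x y := by
  rw [form_swap, form_smul_left, form_swap y]; ring

theorem form_eq_zero_right (x y : Fin 3 → ℂ) (h0 : y 0 = 0) (h1 : y 1 = 0) :
    c.form x y = 0 := by
  simp [form, h0, h1]

/-- Testing against each unit vector and its multiple by `i` separates the complex linear from the
antilinear part in `y`. -/
theorem form_kernel {x : Fin 3 → ℂ} (hx : ∀ y, c.form x y = 0) :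
    -c.ρ * x 1 - c.A * conj (x 0) - c.B * conj (x 1) = 0 ∧
    c.ρ * x 0 - c.C * conj (x 0) - c.D * conj (x 1) = 0 ∧
    c.A * x 0 + c.C * x 1 = 0 ∧ c.B * x 0 + c.D * x 1 = 0 := by
  have h1 := hx ![1, 0, 0]
  have h2 := hx ![Complex.I, 0, 0]
  have h3 := hx ![0, 1, 0]
  have h4 := hx ![0, Complex.I, 0]
  simp [form] at h1 h2 h3 h4
  have hI := Complex.I_mul_I
  refine ⟨?_, ?_, ?_, ?_⟩
  · linear_combination (1 / 2) * h1 - (1 / 2) * Complex.I * h2 + (1 / 2) *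
      (-c.ρ * x 1 - c.A * conj (x 0) - c.B * conj (x 1) - c.A * x 0 - c.C * x 1) * hI
  · linear_combination (1 / 2) * h3 - (1 / 2) * Complex.I * h4 + (1 / 2) *
      (c.ρ * x 0 - c.C * conj (x 0) - c.D * conj (x 1) - c.B * x 0 - c.D * x 1) * hI
  · linear_combination (1 / 2) * h1 + (1 / 2) * Complex.I * h2 - (1 / 2) *
      (-c.ρ * x 1 - c.A * conj (x 0) - c.B * conj (x 1) - c.A * x 0 - c.C * x 1) * hI
  · linear_combination (1 / 2) * h3 + (1 / 2) * Complex.I * h4 - (1 / 2) *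
      (c.ρ * x 0 - c.C * conj (x 0) - c.D * conj (x 1) - c.B * x 0 - c.D * x 1) * hI

/-- A vector in the kernel of `Ω` is also in that of `conj Ω`. If `Ω ∧ Ω` or `Ω ∧ conj Ω` is a
volume form on the four-space, its component there must vanish. -/
theorem form_nondegenerate (h : c.Δ₁ ≠ 0 ∨ c.Δ₂ ≠ 0) {x : Fin 3 → ℂ}
    (hx : ∀ y, c.form x y = 0) : x 0 = 0 ∧ x 1 = 0 := by
  obtain ⟨h1, h2, h3, h4⟩ := form_kernel hx
  rcases h with h | h
  · rw [Δ₁] at h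
    constructor
    · refine (mul_eq_zero.1 (?_ : (c.A * c.D - c.B * c.C) * x 0 = 0)).resolve_left h
      linear_combination c.D * h3 - c.C * h4
    · refine (mul_eq_zero.1 (?_ : (c.A * c.D - c.B * c.C) * x 1 = 0)).resolve_left h
      linear_combination c.A * h4 - c.B * h3
  · have h' : (2 * c.Δ₂ : ℂ) ≠ 0 := mul_ne_zero two_ne_zero (Complex.ofReal_ne_zero.2 h)
    have k1 := congrArg conj h1
    have k2 := congrArg conj h2
    simp only [map_sub, map_mul, map_neg, map_zero, Complex.conj_conj] at k1 k2
    constructor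
    · refine (mul_eq_zero.1 (?_ : (2 * c.Δ₂ : ℂ) * x 0 = 0)).resolve_left h'
      rw [two_mul_Δ₂]
      linear_combination conj c.B * h4 + c.D * k1 - c.C * k2 - conj c.ρ * h2 -
        conj c.D * h3
    · refine (mul_eq_zero.1 (?_ : (2 * c.Δ₂ : ℂ) * x 1 = 0)).resolve_left h'
      rw [two_mul_Δ₂]
      linear_combination conj c.C * h3 + c.A * k2 - c.B * k1 + conj c.ρ * h1 -
        conj c.A * h4

variable (c) in
/-- The real 2-form `Re (s Ω)`, where `Ω = d ω^3`. -/
def reForm (s : ℂ) : (Fin 3 → ℂ) →ₗ[ℝ] (Fin 3 → ℂ) →ₗ[ℝ] ℝ :=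
  LinearMap.mk₂ ℝ (fun x y => (s * c.form x y).re)
    (fun x y z => by rw [form_add_left, mul_add, Complex.add_re])
    (fun r x y => by rw [form_smul_left, mul_left_comm, Complex.re_ofReal_mul, smul_eq_mul])
    (fun x y z => by rw [form_add_right, mul_add, Complex.add_re])
    (fun r x y => by rw [form_smul_right, mul_left_comm, Complex.re_ofReal_mul, smul_eq_mul])

theorem reForm_apply (s : ℂ) (x y : Fin 3 → ℂ) : c.reForm s x y = (s * c.form x y).re := rfl

variable (c) in
/-- The complex 2-form `s Ω + t conj Ω`, where `Ω = d ω^3`. -/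
def combForm (s t : ℂ) : (Fin 3 → ℂ) →ₗ[ℝ] (Fin 3 → ℂ) →ₗ[ℝ] ℂ :=
  LinearMap.mk₂ ℝ (fun x y => s * c.form x y + t * conj (c.form x y))
    (fun x y z => by rw [form_add_left, map_add]; ring)
    (fun r x y => by
      rw [form_smul_left, map_mul, Complex.conj_ofReal, Complex.real_smul]; ring)
    (fun x y z => by rw [form_add_right, map_add]; ring)
    (fun r x y => by
      rw [form_smul_right, map_mul, Complex.conj_ofReal, Complex.real_smul]; ring)

theorem combForm_apply (s t : ℂ) (x y : Fin 3 → ℂ) :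
    c.combForm s t x y = s * c.form x y + t * conj (c.form x y) := rfl

/-- The hypothesis says that `(s, t)` is a null vector of the quadratic form given by the wedge
square of `s Ω + t conj Ω`. Its roots are governed by `Δ₂ ^ 2 - ‖Δ₁‖ ^ 2`. -/
theorem combForm_plucker {s t : ℂ}
    (h : s ^ 2 * c.Δ₁ + t ^ 2 * conj c.Δ₁ + 2 * s * t * c.Δ₂ = 0) (x y z w : Fin 3 → ℂ) :
    c.combForm s t x y * c.combForm s t z w - c.combForm s t x z * c.combForm s t y w
      + c.combForm s t x w * c.combForm s t y z = 0 := by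
  have h1 := form_plucker (c := c) x y z w
  have h2 := congrArg conj h1
  have h3 := form_conj_polar (c := c) x y z w
  simp only [map_add, map_sub, map_mul, conj_vol] at h2
  simp only [combForm_apply]
  linear_combination s ^ 2 * h1 + t ^ 2 * h2 + s * t * h3 + vol x y z w * h

/-- The polarized version on real forms: the hypothesis makes `Re (s Ω) ∧ Re (t Ω)` vanish. -/
theorem reForm_polar {s t : ℂ} (h : (s * t * c.Δ₁).re + (s * conj t).re * c.Δ₂ = 0)
    (x y z w : Fin 3 → ℂ) :
    c.reForm s x y * c.reForm t z w - c.reForm s x z * c.reForm t y w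
      + c.reForm s x w * c.reForm t y z + c.reForm s y z * c.reForm t x w
      - c.reForm s y w * c.reForm t x z + c.reForm s z w * c.reForm t x y = 0 := by
  have h1 := form_plucker (c := c) x y z w
  have h2 := congrArg conj h1
  have h3 := form_conj_polar (c := c) x y z w
  simp only [map_add, map_sub, map_mul, conj_vol] at h2
  have h' := congrArg (fun r : ℝ => (r : ℂ)) h
  apply Complex.ofReal_injective
  simp only [reForm_apply]
  push_cast at h' ⊢
  simp only [Complex.re_eq_add_conj, map_mul, Complex.conj_conj] at h' ⊢
  linear_combination (1 / 2) * s * t * h1 + (1 / 2) * conj s * conj t * h2 +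
    (1 / 4) * (s * conj t + conj s * t) * h3 + vol x y z w * h'

theorem reForm_plucker {s : ℂ} (h : (s * s * c.Δ₁).re + (s * conj s).re * c.Δ₂ = 0)
    (x y z w : Fin 3 → ℂ) :
    c.reForm s x y * c.reForm s z w - c.reForm s x z * c.reForm s y w
      + c.reForm s x w * c.reForm s y z = 0 := by
  linear_combination (1 / 2) * reForm_polar h x y z w

/-- The real 1-form `Re (s ω^i)`. -/
def reCoord (s : ℂ) (i : Fin 3) : (Fin 3 → ℂ) →ₗ[ℝ] ℝ where
  toFun x := (s * x i).re
  map_add' x y := by rw [Pi.add_apply, mul_add, Complex.add_re]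
  map_smul' r x := by
    rw [Pi.smul_apply, Complex.real_smul, mul_left_comm, Complex.re_ofReal_mul]; rfl

theorem reCoord_apply (s : ℂ) (i : Fin 3) (x : Fin 3 → ℂ) : reCoord s i x = (s * x i).re := rfl

theorem form_bracket (hε : c.ε = 0) (x y z : Fin 3 → ℂ) : c.form z (c.bracket x y) = 0 :=
  form_eq_zero_right _ _ (by simp) (by simp [hε])

theorem ext_zero {x : Fin 3 → ℂ} (h : x 0 = 0 ∧ x 1 = 0) (h2 : x 2 = 0) : x = 0 := by
  funext i; fin_cases i
  exacts [h.1, h.2, h2]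

/-- Here the quadratic form `Re (s² Δ₁) + |s|² Δ₂` on `ℂ = ℝ²` is indefinite. Its two null lines
yield independent decomposable forms `Re (s Ω) = u ∧ v` and `Re (t Ω) = a ∧ b`, which become the two
differentials of `h_2`. -/
theorem hasModel_two (hε : c.ε = 0) (hd : 0 < ‖c.Δ₁‖ ^ 2 - c.Δ₂ ^ 2) : c.HasModel 2 := by
  have h1 : c.Δ₁ ≠ 0 := by
    intro h; rw [h, norm_zero] at hd; nlinarith [sq_nonneg c.Δ₂]
  set r := Real.sqrt (‖c.Δ₁‖ ^ 2 - c.Δ₂ ^ 2) with hr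
  have hr2 : r ^ 2 = ‖c.Δ₁‖ ^ 2 - c.Δ₂ ^ 2 := Real.sq_sqrt hd.le
  have hr0 : 0 < r := Real.sqrt_pos.2 hd
  -- If `a² = r²`, then `-Δ₂ + ai` has modulus `|Δ₁|`, so a square root `s` of its product with
  -- `conj Δ₁` has `|s| = |Δ₁|` and is a null vector.
  have key (a : ℝ) (ha : a ^ 2 = r ^ 2) : ∃ s : ℂ, s * s = (-c.Δ₂ + a * Complex.I) * conj c.Δ₁ ∧
      (s * s * c.Δ₁).re + (s * conj s).re * c.Δ₂ = 0 := by
    obtain ⟨s, hs⟩ := IsAlgClosed.exists_pow_nat_eq ((-c.Δ₂ + a * Complex.I) * conj c.Δ₁)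
      (n := 2) (by norm_num)
    rw [pow_two] at hs
    refine ⟨s, hs, ?_⟩
    have hn : ‖s‖ ^ 2 = ‖c.Δ₁‖ ^ 2 := by
      have h4 : ‖-(c.Δ₂ : ℂ) + a * Complex.I‖ ^ 2 = ‖c.Δ₁‖ ^ 2 := by
        rw [← Complex.normSq_eq_norm_sq, ← Complex.ofReal_neg, Complex.normSq_add_mul_I]
        linear_combination ha + hr2
      have h5 : ‖-(c.Δ₂ : ℂ) + a * Complex.I‖ = ‖c.Δ₁‖ :=
        (sq_eq_sq₀ (norm_nonneg _) (norm_nonneg _)).1 h4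
      rw [pow_two, ← norm_mul, hs, norm_mul, h5, RCLike.norm_conj, pow_two]
    rw [hs, Complex.mul_conj', ← Complex.ofReal_pow, Complex.ofReal_re, hn, mul_assoc,
      mul_comm (conj c.Δ₁), Complex.mul_conj', ← Complex.ofReal_pow, Complex.re_mul_ofReal]
    simp
    ring
  obtain ⟨s, hs, hs'⟩ := key r rfl
  obtain ⟨t, ht, ht'⟩ := key (-r) (by ring)
  -- If `conj s * t` were a real number `p`, then `(-Δ₂ - ri)² |Δ₁|² = p²`. The imaginary part
  -- forces `Δ₂ = 0`, and then the left side is negative.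
  have hst : (conj s * t).im ≠ 0 := by
    intro h0
    have h2 : (conj s * t) = ((conj s * t).re : ℂ) := Complex.ext rfl (by simpa using h0)
    set p := (conj s * t).re
    have h3 : conj (s * s) * (t * t) = (p ^ 2 : ℝ) := by
      push_cast
      rw [← h2, map_mul]; ring
    rw [hs, ht] at h3
    have h4 : conj c.Δ₁ * c.Δ₁ = (‖c.Δ₁‖ ^ 2 : ℝ) := by
      rw [mul_comm, Complex.mul_conj']; push_cast; rfl
    have h5 : ((-c.Δ₂ - r * Complex.I) ^ 2) * (‖c.Δ₁‖ ^ 2 : ℝ) = (p ^ 2 : ℝ) := by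
      rw [← h3, ← h4]
      simp only [map_mul, map_add, map_neg, Complex.conj_ofReal, Complex.conj_I,
        Complex.conj_conj]
      push_cast
      ring
    have h6 := congrArg Complex.re h5
    have h7 := congrArg Complex.im h5
    rw [Complex.re_mul_ofReal, Complex.ofReal_re] at h6
    rw [Complex.im_mul_ofReal, Complex.ofReal_im] at h7
    simp [pow_two] at h6 h7
    have h8 : 0 < ‖c.Δ₁‖ := norm_pos_iff.2 h1
    rcases h7 with h7 | h7
    · have h9 : c.Δ₂ = 0 := by
        rcases mul_eq_zero.1 (by linarith : r * c.Δ₂ = 0) with h | h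
        · exact absurd h hr0.ne'
        · exact h
      rw [h9] at h6
      nlinarith [mul_pos (mul_pos hr0 hr0) (mul_pos h8 h8), sq_nonneg p]
    · exact h1 h7
  obtain ⟨u, v, huv, hk⟩ := exists_eq_wedge (c.reForm s) (reForm_plucker hs')
  obtain ⟨a, b, hab, hk'⟩ := exists_eq_wedge (c.reForm t) (reForm_plucker ht')
  refine ⟨![u, v, a, b, reCoord s 2, reCoord t 2], fun x hx => ?_, fun x y k => ?_⟩
  · have x0 := hx 0; have x1 := hx 1; have x2 := hx 2; have x3 := hx 3
    have x4 := hx 4; have x5 := hx 5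
    simp at x0 x1 x2 x3 x4 x5
    refine ext_zero (form_nondegenerate (Or.inl h1) fun y => ?_)
      (eq_zero_of_re_mul_eq_zero hst x4 x5)
    refine eq_zero_of_re_mul_eq_zero hst ((huv x y).trans ?_) ((hab x y).trans ?_)
    · simp [x0, x1]
    · simp [x2, x3]
  · have hb (s : ℂ) (z : Fin 3 → ℂ) : c.reForm s z (c.bracket x y) = 0 := by
      rw [reForm_apply, form_bracket hε, mul_zero, Complex.zero_re]
    have k1 := hk (c.bracket x y) (hb s)
    have k2 := hk' (c.bracket x y) (hb t)
    have l1 := huv x y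
    have l2 := hab x y
    rw [reForm_apply] at l1 l2
    rw [nilBracket_two]
    fin_cases k
    · simpa using k1.1
    · simpa using k1.2
    · simpa using k2.1
    · simpa using k2.2
    · simp [reCoord_apply, l1]
    · simp [reCoord_apply, l2]

end Constants

namespace Constants

variable {c : Constants}

/-- The quadratic form is degenerate. Its null vector `s` is orthogonal to everything, so `Re (s Ω)
= u ∧ v` is decomposable and its product with `Re (i s Ω)` vanishes. The latter thus has the shape
`u ∧ a + v ∧ b`. The hypothesis `hind` keeps `u ∧ v` nonzero. -/
theorem hasModel_four (hε : c.ε = 0) (h1 : c.Δ₁ ≠ 0) (hd : ‖c.Δ₁‖ ^ 2 - c.Δ₂ ^ 2 = 0)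
    (hind : ∀ s : ℂ, s ≠ 0 → ∃ x y, (s * c.form x y).re ≠ 0) : c.HasModel 4 := by
  have h2 : c.Δ₂ ≠ 0 := by
    intro h; rw [h] at hd; simp at hd; exact h1 hd
  obtain ⟨s, hs⟩ := IsAlgClosed.exists_pow_nat_eq (-c.Δ₂ * conj c.Δ₁ : ℂ)
    (n := 2) (by norm_num)
  rw [pow_two] at hs
  have hs0 : s ≠ 0 := by
    rintro rfl
    simp [h1, h2] at hs
  have hn : ‖s‖ ^ 2 = ‖c.Δ₁‖ ^ 2 := by
    have h5 : ‖-(c.Δ₂ : ℂ)‖ = ‖c.Δ₁‖ := by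
      rw [norm_neg, Complex.norm_real, Real.norm_eq_abs]
      refine (sq_eq_sq₀ (abs_nonneg _) (norm_nonneg _)).1 ?_
      rw [sq_abs]; linarith
    rw [pow_two, ← norm_mul, hs, norm_mul, h5, RCLike.norm_conj, pow_two]
  have hs2 : s * s * c.Δ₁ = (-c.Δ₂ * ‖c.Δ₁‖ ^ 2 : ℝ) := by
    rw [hs]; push_cast; rw [← Complex.mul_conj']; ring
  have e1 : (s * s * c.Δ₁).re + (s * conj s).re * c.Δ₂ = 0 := by
    rw [hs2, Complex.mul_conj', ← Complex.ofReal_pow, Complex.ofReal_re, Complex.ofReal_re, hn]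
    ring
  have e2 : (s * (Complex.I * s) * c.Δ₁).re + (s * conj (Complex.I * s)).re * c.Δ₂ = 0 := by
    have a1 : s * (Complex.I * s) * c.Δ₁ = Complex.I * (s * s * c.Δ₁) := by ring
    have a2 : s * conj (Complex.I * s) = -Complex.I * ((‖s‖ ^ 2 : ℝ) : ℂ) := by
      push_cast
      rw [map_mul, Complex.conj_I, ← Complex.mul_conj']; ring
    rw [a1, a2, hs2]
    simp only [Complex.re_mul_ofReal]
    simp
  have hst : (conj s * (Complex.I * s)).im ≠ 0 := by
    have a2 : conj s * (Complex.I * s) = Complex.I * ((‖s‖ ^ 2 : ℝ) : ℂ) := by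
      push_cast
      rw [← Complex.mul_conj']; ring
    rw [a2, Complex.im_mul_ofReal]
    simpa using hs0
  obtain ⟨u, v, a, b, huv, hab, hk⟩ := exists_eq_wedge_add (c.reForm s)
    (c.reForm (Complex.I * s)) (reForm_plucker e1) (reForm_polar e2) (hind s hs0)
  refine ⟨![u, v, b, a, reCoord s 2, reCoord (Complex.I * s) 2], fun x hx => ?_,
    fun x y k => ?_⟩
  · have x0 := hx 0; have x1 := hx 1; have x2 := hx 2; have x3 := hx 3
    have x4 := hx 4; have x5 := hx 5
    simp at x0 x1 x2 x3
    refine ext_zero (form_nondegenerate (Or.inl h1) fun y => ?_)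
      (eq_zero_of_re_mul_eq_zero hst x4 x5)
    refine eq_zero_of_re_mul_eq_zero hst ((huv x y).trans ?_) ((hab x y).trans ?_)
    · simp [x0, x1]
    · simp [x0, x1, x2, x3]
  · have hb (s : ℂ) (z : Fin 3 → ℂ) : c.reForm s z (c.bracket x y) = 0 := by
      rw [reForm_apply, form_bracket hε, mul_zero, Complex.zero_re]
    obtain ⟨k1, k2, k3, k4⟩ := hk (c.bracket x y) (hb s) (hb _)
    have l1 := huv x y
    have l2 := hab x y
    rw [reForm_apply] at l1 l2
    rw [nilBracket_four]
    fin_cases k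
    · simpa using k1
    · simpa using k2
    · simpa using k4
    · simpa using k3
    · simp [reCoord_apply, l1]
    · change (Complex.I * s * -c.form x y).re = -(u x * a y - u y * a x + (v x * b y - v y * b x))
      rw [← l2, mul_neg, Complex.neg_re]

/-- Real part of a complex-valued 1-form. -/
def rePart (u : (Fin 3 → ℂ) →ₗ[ℝ] ℂ) : (Fin 3 → ℂ) →ₗ[ℝ] ℝ := Complex.reLm ∘ₗ u
/-- Imaginary part of a complex-valued 1-form. -/
def imPart (u : (Fin 3 → ℂ) →ₗ[ℝ] ℂ) : (Fin 3 → ℂ) →ₗ[ℝ] ℝ := Complex.imLm ∘ₗ u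

theorem rePart_apply (u : (Fin 3 → ℂ) →ₗ[ℝ] ℂ) (x : Fin 3 → ℂ) : rePart u x = (u x).re := rfl
theorem imPart_apply (u : (Fin 3 → ℂ) →ₗ[ℝ] ℂ) (x : Fin 3 → ℂ) : imPart u x = (u x).im := rfl

/-- The complex-valued 1-form `s ω^i + t conj ω^i`. -/
def combCoord (s t : ℂ) (i : Fin 3) : (Fin 3 → ℂ) →ₗ[ℝ] ℂ where
  toFun x := s * x i + t * conj (x i)
  map_add' x y := by rw [Pi.add_apply, map_add]; ring
  map_smul' r x := by
    rw [Pi.smul_apply, Complex.real_smul, map_mul, Complex.conj_ofReal, RingHom.id_apply,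
      Complex.real_smul]
    ring

theorem combCoord_apply (s t : ℂ) (i : Fin 3) (x : Fin 3 → ℂ) :
    combCoord s t i x = s * x i + t * conj (x i) := rfl

/-- The quadratic form is definite, so its null vectors are complex. One combination of `Ω` and
`conj Ω` is a product `u ∧ v` of complex 1-forms, and its real and imaginary parts are the
differentials of `h_5`. -/
theorem hasModel_five (hε : c.ε = 0) (hd : ‖c.Δ₁‖ ^ 2 - c.Δ₂ ^ 2 < 0) : c.HasModel 5 := by
  have h2 : c.Δ₂ ≠ 0 := by
    intro h; rw [h] at hd; nlinarith [sq_nonneg ‖c.Δ₁‖]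
  -- The sign of `r` is chosen so that `t` below is nonzero. This matters if `Δ₁ = 0`, when only the
  -- term in `conj Ω` is left.
  obtain ⟨r, hr, hr0, hr1⟩ : ∃ r : ℝ, r ^ 2 = c.Δ₂ ^ 2 - ‖c.Δ₁‖ ^ 2 ∧ r ≠ 0 ∧ c.Δ₂ + r ≠ 0 := by
    set r := Real.sqrt (c.Δ₂ ^ 2 - ‖c.Δ₁‖ ^ 2)
    have hr : r ^ 2 = c.Δ₂ ^ 2 - ‖c.Δ₁‖ ^ 2 := Real.sq_sqrt (by linarith)
    have hr0 : r ≠ 0 := (Real.sqrt_pos.2 (by linarith)).ne'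
    by_cases h : c.Δ₂ + r = 0
    · exact ⟨-r, by rw [neg_sq, hr], neg_ne_zero.2 hr0, fun h' => h2 (by linarith)⟩
    · exact ⟨r, hr, hr0, h⟩
  set t : ℝ := -c.Δ₂ - r with ht
  have hq : t ^ 2 + 2 * t * c.Δ₂ + ‖c.Δ₁‖ ^ 2 = 0 := by rw [ht]; linear_combination hr
  -- Different moduli make `z ↦ conj Δ₁ z + t conj z` injective, so neither `ω³` nor `Ω` loses
  -- information in the combination.
  have hne : ‖conj c.Δ₁‖ ≠ ‖(t : ℂ)‖ := by
    intro h
    have h' : ‖c.Δ₁‖ ^ 2 = t ^ 2 := by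
      rw [← RCLike.norm_conj, h, Complex.norm_real, Real.norm_eq_abs, sq_abs]
    rw [h'] at hq
    have : t * r = 0 := by
      rw [ht] at hq ⊢; linear_combination -(1 / 2) * hq
    rcases mul_eq_zero.1 this with h | h
    · exact hr1 (by rw [ht] at h; linarith)
    · exact hr0 h
  have hpl : conj c.Δ₁ ^ 2 * c.Δ₁ + (t : ℂ) ^ 2 * conj c.Δ₁ + 2 * conj c.Δ₁ * t * c.Δ₂ = 0 := by
    have hq' := congrArg (fun r : ℝ => (r : ℂ)) hq
    push_cast at hq'
    rw [← Complex.mul_conj'] at hq'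
    linear_combination conj c.Δ₁ * hq'
  obtain ⟨u, v, huv, hk⟩ := exists_eq_wedge (c.combForm (conj c.Δ₁) t) (combForm_plucker hpl)
  refine ⟨![rePart u, imPart u, rePart v, imPart v, rePart (combCoord (conj c.Δ₁) t 2),
    imPart (combCoord (conj c.Δ₁) t 2)], fun x hx => ?_, fun x y k => ?_⟩
  · have x0 := hx 0; have x1 := hx 1; have x2 := hx 2; have x3 := hx 3
    have x4 := hx 4; have x5 := hx 5
    have u0 : u x = 0 := Complex.ext x0 x1
    have v0 : v x = 0 := Complex.ext x2 x3
    have z0 : combCoord (conj c.Δ₁) t 2 x = 0 := Complex.ext x4 x5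
    refine ext_zero (form_nondegenerate (Or.inr h2) fun y => ?_)
      (eq_zero_of_mul_add_mul_conj hne z0)
    refine eq_zero_of_mul_add_mul_conj hne ((huv x y).trans ?_)
    simp [u0, v0]
  · obtain ⟨k1, k2⟩ := hk (c.bracket x y) fun w => by
      rw [combForm_apply, form_bracket hε]; simp
    have l1 := huv x y
    have l2 : combCoord (conj c.Δ₁) t 2 (c.bracket x y) = -(u x * v y - u y * v x) := by
      rw [← l1, combForm_apply, combCoord_apply, bracket_two, map_neg]; ring
    rw [nilBracket_five]
    fin_cases k
    · simp [rePart_apply, k1]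
    · simp [imPart_apply, k1]
    · simp [rePart_apply, k2]
    · simp [imPart_apply, k2]
    · simp [rePart_apply, imPart_apply, l2]; ring
    · simp [rePart_apply, imPart_apply, l2]; ring

end Constants

namespace Constants

variable {c : Constants}

/-- The complex-valued 1-form `p ω^1 + q ω^2`. -/
def linCoord (p q : ℂ) : (Fin 3 → ℂ) →ₗ[ℝ] ℂ where
  toFun x := p * x 0 + q * x 1
  map_add' x y := by simp only [Pi.add_apply]; ring
  map_smul' r x := by
    simp only [Pi.smul_apply, Complex.real_smul, RingHom.id_apply]; ring

theorem linCoord_apply (p q : ℂ) (x : Fin 3 → ℂ) : linCoord p q x = p * x 0 + q * x 1 := rfl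

theorem linCoord_eq_zero {p q p' q' : ℂ} (h : p * q' - q * p' ≠ 0) {x : Fin 3 → ℂ}
    (h1 : linCoord p q x = 0) (h2 : linCoord p' q' x = 0) : x 0 = 0 ∧ x 1 = 0 := by
  rw [linCoord_apply] at h1 h2
  constructor
  · refine (mul_eq_zero.1 (?_ : (p * q' - q * p') * x 0 = 0)).resolve_left h
    linear_combination q' * h1 - q * h2
  · refine (mul_eq_zero.1 (?_ : (p * q' - q * p') * x 1 = 0)).resolve_left h
    linear_combination p * h2 - p' * h1

theorem hasModel_one (hε : c.ε = 0) (h : ∀ x y, c.form x y = 0) : c.HasModel 1 := by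
  refine ⟨![reCoord 1 0, reCoord Complex.I 0, reCoord 1 1, reCoord Complex.I 1, reCoord 1 2,
    reCoord Complex.I 2], fun x hx => ?_, fun x y k => ?_⟩
  · have h1I : (conj (1 : ℂ) * Complex.I).im ≠ 0 := by simp
    funext i
    fin_cases i
    · exact eq_zero_of_re_mul_eq_zero h1I (hx 0) (hx 1)
    · exact eq_zero_of_re_mul_eq_zero h1I (hx 2) (hx 3)
    · exact eq_zero_of_re_mul_eq_zero h1I (hx 4) (hx 5)
  · rw [nilBracket_one]
    fin_cases k <;> simp [reCoord_apply, h, hε]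

theorem exists_coeff_eq_mul (h : c.Δ₁ = 0) : ∃ u₁ u₂ v₁ v₂ : ℂ,
    c.A = u₁ * v₁ ∧ c.B = u₁ * v₂ ∧ c.C = u₂ * v₁ ∧ c.D = u₂ * v₂ := by
  rw [Δ₁] at h
  by_cases hA : c.A = 0
  · by_cases hB : c.B = 0
    · exact ⟨0, 1, c.C, c.D, by simp [hA], by simp [hB], by simp, by simp⟩
    · refine ⟨1, c.D / c.B, c.A, c.B, by simp, by simp, ?_, by field_simp⟩
      field_simp
      linear_combination -h
  · refine ⟨1, c.C / c.A, c.A, c.B, by simp, by simp, by field_simp, ?_⟩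
    field_simp
    linear_combination h

/-- With `X` of rank at most one, `Ω = ω¹ ∧ ω² + U ∧ conj V` for linear forms `U` and `V` in `ω¹,
ω²`, and `Δ₂ = 0` says that `U ∧ V` is `ω¹ ∧ ω²` times a unit `w`. Rescaling by a square root of `w`
gives `Ω = (ζ + conj ζ) ∧ η`: a real form times a complex one. -/
theorem hasModel_six (hε : c.ε = 0) (hρ : c.ρ = 1) (h1 : c.Δ₁ = 0) (h2 : c.Δ₂ = 0) :
    c.HasModel 6 := by
  obtain ⟨u₁, u₂, v₁, v₂, hA, hB, hC, hD⟩ := exists_coeff_eq_mul h1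
  set w := u₁ * conj v₂ - u₂ * conj v₁ with hw
  have hw1 : w * conj w = 1 := by
    have h3 := two_mul_Δ₂ c
    rw [h2, hA, hB, hC, hD, hρ] at h3
    rw [hw]
    simp only [map_sub, map_mul, Complex.conj_conj, Complex.ofReal_zero, map_one] at h3 ⊢
    linear_combination -h3
  obtain ⟨τ, hτ⟩ := IsAlgClosed.exists_pow_nat_eq w (n := 2) (by norm_num)
  have hτ1 : τ * conj τ = 1 := by
    rw [Complex.mul_conj']
    rw [← hτ, Complex.mul_conj'] at hw1
    have h4 : ‖τ ^ 2‖ ^ 2 = 1 := by exact_mod_cast hw1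
    rw [norm_pow] at h4
    have h5 : ‖τ‖ ^ 2 = 1 := by nlinarith [sq_nonneg ‖τ‖]
    exact_mod_cast h5
  have hw0 : w ≠ 0 := by rintro h; rw [h] at hw1; simp at hw1
  have hτ0 : τ ≠ 0 := by rintro h; rw [h] at hτ1; simp at hτ1
  have hτ0' : conj τ ≠ 0 := by simpa using hτ0
  let η := linCoord (-conj τ * u₁) (-conj τ * u₂)
  let ζ := linCoord (conj τ * conj v₁) (conj τ * conj v₂)
  have hform (x y : Fin 3 → ℂ) :
      c.form x y = (ζ x + conj (ζ x)) * η y - (ζ y + conj (ζ y)) * η x := by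
    simp only [η, ζ, linCoord_apply, form, hA, hB, hC, hD, hρ, map_add, map_mul,
      Complex.conj_conj]
    have hw2 : conj τ ^ 2 * w = 1 := by
      rw [← hτ]; linear_combination (τ * conj τ + 1) * hτ1
    linear_combination -(x 0 * y 1 - y 0 * x 1) * hw2 + conj τ ^ 2 * (x 0 * y 1 - y 0 * x 1) * hw -
      (u₁ * v₁ * (x 0 * conj (y 0) - y 0 * conj (x 0)) +
        u₁ * v₂ * (x 0 * conj (y 1) - y 0 * conj (x 1)) +
        u₂ * v₁ * (x 1 * conj (y 0) - y 1 * conj (x 0)) +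
        u₂ * v₂ * (x 1 * conj (y 1) - y 1 * conj (x 1))) * hτ1
  refine ⟨![2 • rePart ζ, rePart η, imPart η, imPart ζ, reCoord 1 2, reCoord (-Complex.I) 2],
    fun x hx => ?_, fun x y k => ?_⟩
  · have x0 : 2 * (ζ x).re = 0 := by simpa [rePart_apply] using hx 0
    have e1 : ζ x = 0 := Complex.ext (by simpa using x0) (hx 3)
    have e2 : η x = 0 := Complex.ext (hx 1) (hx 2)
    refine ext_zero (linCoord_eq_zero ?_ e2 e1)
      (eq_zero_of_re_mul_eq_zero (s := 1) (t := -Complex.I) (by simp) (hx 4) (hx 5))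
    have h6 : -conj τ * u₁ * (conj τ * conj v₂) - -conj τ * u₂ * (conj τ * conj v₁) =
      -(conj τ) ^ 2 * w := by rw [hw]; ring
    rw [h6]
    exact mul_ne_zero (neg_ne_zero.2 (pow_ne_zero _ hτ0')) hw0
  · have hη : η (c.bracket x y) = 0 := by simp [η, linCoord_apply, hε]
    have hζ : ζ (c.bracket x y) = 0 := by simp [ζ, linCoord_apply, hε]
    rw [nilBracket_six]
    fin_cases k
    · simp [rePart_apply, hζ]
    · simp [rePart_apply, hη]
    · simp [imPart_apply, hη]
    · simp [imPart_apply, hζ]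
    · simp [reCoord_apply, rePart_apply, imPart_apply, hform]; ring
    · simp [reCoord_apply, rePart_apply, imPart_apply, hform]; ring

/-- Hermitian forms in two variables are diagonalizable. -/
theorem exists_hermitian_diagonal (a d : ℝ) (β : ℂ) (h : ¬(a = 0 ∧ d = 0 ∧ β = 0)) :
    ∃ (k l : ℝ) (p q p' q' : ℂ), k ≠ 0 ∧ (l = 0 ↔ (a * d : ℂ) - β * conj β = 0) ∧
      p * q' - q * p' ≠ 0 ∧ k * p * conj p + l * p' * conj p' = a ∧
      k * q * conj q + l * q' * conj q' = d ∧ k * p * conj q + l * p' * conj q' = β := by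
  by_cases ha : a = 0
  · by_cases hd : d = 0
    · have hβ : β ≠ 0 := fun hβ => h ⟨ha, hd, hβ⟩
      -- With zero diagonal, the off-diagonal term is half the difference of two squares, by
      -- polarization.
      refine ⟨1 / 2, -1 / 2, β, 1, β, -1, by norm_num, ?_, ?_, ?_, ?_, ?_⟩
      · simp [ha, hd, hβ]
      · intro h'
        apply hβ
        linear_combination -(1 / 2) * h'
      all_goals
        simp [ha, hd]
        try ring
    · have hd' : (d : ℂ) ≠ 0 := Complex.ofReal_ne_zero.2 hd
      -- Completing the square at the nonzero diagonal entry; the other coefficient is then the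
      -- determinant divided by that entry.
      refine ⟨1 / d, a - ‖β‖ ^ 2 / d, β, d, 1, 0, by simpa using hd, ?_, ?_, ?_, ?_, ?_⟩
      · rw [Complex.mul_conj', ← Complex.ofReal_pow, ← Complex.ofReal_mul, ← Complex.ofReal_sub,
          Complex.ofReal_eq_zero]
        field_simp
        rw [mul_zero]
      · simpa using hd
      all_goals
        push_cast
        rw [← Complex.mul_conj']
        simp
        try field_simp
        try ring
  · have ha' : (a : ℂ) ≠ 0 := Complex.ofReal_ne_zero.2 ha
    refine ⟨1 / a, d - ‖β‖ ^ 2 / a, a, conj β, 0, 1, by simpa using ha, ?_, ?_, ?_, ?_, ?_⟩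
    · rw [Complex.mul_conj', ← Complex.ofReal_pow, ← Complex.ofReal_mul, ← Complex.ofReal_sub,
        Complex.ofReal_eq_zero]
      field_simp
      rw [mul_comm d, mul_zero]
    · simpa using ha
    all_goals
      push_cast
      rw [← Complex.mul_conj']
      simp
      try field_simp
      try ring

/-- If `d ω^3` and its conjugate are proportional and do not vanish then the Lie algebra is
`h_3` or `h_8`. -/
theorem hasModel_three_or_eight (hε : c.ε = 0) (hρ : c.ρ = 0) {s : ℂ} (hs : s ≠ 0)
    (hs0 : ∀ x y, (s * c.form x y).re = 0) (h0 : c.X ≠ 0) :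
    (c.Δ₁ ≠ 0 → c.HasModel 3) ∧ (c.Δ₁ = 0 → c.HasModel 8) := by
  have hA := hs0 ![1, 0, 0] ![Complex.I, 0, 0]
  have hD := hs0 ![0, 1, 0] ![0, Complex.I, 0]
  have hB := hs0 ![1, 0, 0] ![0, 1, 0]
  have hB' := hs0 ![1, 0, 0] ![0, Complex.I, 0]
  simp [form, hρ] at hA hD hB hB'
  -- The vanishing of `Re (s Ω)` means that the matrix `s X` is Hermitian.
  have hA' : s * c.A = ((s * c.A).re : ℂ) := Complex.ext rfl (by simp; linarith)
  have hD' : s * c.D = ((s * c.D).re : ℂ) := Complex.ext rfl (by simp; linarith)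
  have hC' : s * c.C = conj (s * c.B) :=
    Complex.ext (by simp; linarith) (by simp; linarith)
  set a := (s * c.A).re
  set d := (s * c.D).re
  set β := s * c.B with hβ
  obtain ⟨k, l, p, q, p', q', hk, hl, hpq, e1, e2, e3⟩ := exists_hermitian_diagonal a d β (by
    rintro ⟨ha, hd, hb⟩
    rw [ha] at hA'; rw [hd] at hD'; rw [hb] at hC'
    rw [hβ] at hb
    apply h0
    ext i j
    fin_cases i <;> fin_cases j
    · simpa [X, hs] using hA'
    · simpa [X, hs] using hb
    · simpa [X, hs] using hC'
    · simpa [X, hs] using hD')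
  have hform (x y : Fin 3 → ℂ) : s * c.form x y =
      k * (linCoord p q x * conj (linCoord p q y) - linCoord p q y * conj (linCoord p q x)) +
      l * (linCoord p' q' x * conj (linCoord p' q' y) -
        linCoord p' q' y * conj (linCoord p' q' x)) := by
    have e3' := congrArg conj e3
    simp only [map_add, map_mul, Complex.conj_conj, Complex.conj_ofReal] at e3'
    rw [map_mul] at hC'
    simp only [form, hρ, linCoord_apply, map_add, map_mul]
    rw [hβ] at e3 e3'
    rw [map_mul] at e3'
    linear_combination (x 0 * conj (y 0) - y 0 * conj (x 0)) * (hA' - e1) -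
      (x 0 * conj (y 1) - y 0 * conj (x 1)) * e3 +
      (x 1 * conj (y 0) - y 1 * conj (x 0)) * (hC' - e3') +
      (x 1 * conj (y 1) - y 1 * conj (x 1)) * (hD' - e2)
  have hdet : l = 0 ↔ c.Δ₁ = 0 := by
    have : (a * d : ℂ) - β * conj β = s ^ 2 * c.Δ₁ := by
      rw [← hA', ← hD', ← hC', hβ, Δ₁]; ring
    rw [hl, this, mul_eq_zero]
    simp [hs]
  have hlin (p q : ℂ) (x y : Fin 3 → ℂ) : linCoord p q (c.bracket x y) = 0 := by
    simp [linCoord_apply, hε]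
  have hsIs : (conj s * (-Complex.I * s)).im ≠ 0 := by
    have a2 : conj s * (-Complex.I * s) = -Complex.I * ((‖s‖ ^ 2 : ℝ) : ℂ) := by
      push_cast
      rw [← Complex.mul_conj']; ring
    rw [a2, Complex.im_mul_ofReal]
    simpa using hs
  constructor
  · intro h1
    have hl0 : l ≠ 0 := fun h => h1 (hdet.1 h)
    -- For a complex form `P` one has `P ∧ conj P = -2i Re P ∧ Im P`. The factor `-2` is put into
    -- the real part, and `-i` into the last form `Re (-i s ω³)`; the form `Re (s ω³)` is closed.
    refine ⟨![(-2 * k) • rePart (linCoord p q), imPart (linCoord p q),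
      (-2 * l) • rePart (linCoord p' q'), imPart (linCoord p' q'), reCoord s 2,
      reCoord (-Complex.I * s) 2], fun x hx => ?_, fun x y j => ?_⟩
    · have x0 := hx 0; have x2 := hx 2
      simp [rePart_apply, hk, hl0] at x0 x2
      exact ext_zero (linCoord_eq_zero hpq (Complex.ext x0 (hx 1)) (Complex.ext x2 (hx 3)))
        (eq_zero_of_re_mul_eq_zero hsIs (hx 4) (hx 5))
    · rw [nilBracket_three]
      fin_cases j
      · simp [rePart_apply, hlin]
      · simp [imPart_apply, hlin]
      · simp [rePart_apply, hlin]
      · simp [imPart_apply, hlin]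
      · change (s * -c.form x y).re = 0
        rw [mul_neg, Complex.neg_re, hs0, neg_zero]
      · change (-Complex.I * s * -c.form x y).re = _
        rw [mul_neg, mul_assoc, hform]
        simp [rePart_apply, imPart_apply]
        ring
  · intro h1
    have hl0 : l = 0 := hdet.2 h1
    refine ⟨![(-2 * k) • rePart (linCoord p q), imPart (linCoord p q),
      rePart (linCoord p' q'), imPart (linCoord p' q'), reCoord s 2,
      reCoord (-Complex.I * s) 2], fun x hx => ?_, fun x y j => ?_⟩
    · have x0 := hx 0
      simp [rePart_apply, hk] at x0
      exact ext_zero (linCoord_eq_zero hpq (Complex.ext x0 (hx 1)) (Complex.ext (hx 2) (hx 3)))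
        (eq_zero_of_re_mul_eq_zero hsIs (hx 4) (hx 5))
    · rw [nilBracket_eight]
      fin_cases j
      · simp [rePart_apply, hlin]
      · simp [imPart_apply, hlin]
      · simp [rePart_apply, hlin]
      · simp [imPart_apply, hlin]
      · change (s * -c.form x y).re = 0
        rw [mul_neg, Complex.neg_re, hs0, neg_zero]
      · change (-Complex.I * s * -c.form x y).re = _
        rw [mul_neg, mul_assoc, hform, hl0]
        simp [rePart_apply, imPart_apply]
        ring

end Constants

/-- A singular `2 × 2` matrix has a left null vector. -/
theorem exists_left_null {K : Type*} [Field K] {a b c d : K} (h : a * d - b * c = 0) :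
    ∃ s t : K, (s ≠ 0 ∨ t ≠ 0) ∧ s * a + t * c = 0 ∧ s * b + t * d = 0 := by
  by_cases h1 : c = 0 ∧ a = 0
  · by_cases h2 : d = 0 ∧ b = 0
    · exact ⟨1, 0, Or.inl one_ne_zero, by simp [h1.2], by simp [h2.2]⟩
    · refine ⟨d, -b, ?_, by rw [h1.1, h1.2]; ring, by ring⟩
      rw [neg_ne_zero]
      tauto
  · refine ⟨c, -a, ?_, by ring, by linear_combination -h⟩
    rw [neg_ne_zero]
    tauto

/-- The real 1-form `r Re ω^i + s Im ω^i`. -/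
def realCoord (r s : ℝ) (i : Fin 3) : (Fin 3 → ℂ) →ₗ[ℝ] ℝ where
  toFun x := r * (x i).re + s * (x i).im
  map_add' x y := by simp only [Pi.add_apply, Complex.add_re, Complex.add_im]; ring
  map_smul' t x := by
    simp only [Pi.smul_apply, Complex.real_smul, Complex.re_ofReal_mul, Complex.im_ofReal_mul,
      RingHom.id_apply, smul_eq_mul]
    ring

theorem realCoord_apply (r s : ℝ) (i : Fin 3) (x : Fin 3 → ℂ) :
    realCoord r s i x = r * (x i).re + s * (x i).im := rfl

theorem eq_zero_of_realCoord {r s r' s' : ℝ} (h : r * s' - s * r' ≠ 0) {i : Fin 3}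
    {x : Fin 3 → ℂ} (h1 : realCoord r s i x = 0) (h2 : realCoord r' s' i x = 0) : x i = 0 := by
  rw [realCoord_apply] at h1 h2
  apply Complex.ext
  · refine (mul_eq_zero.1 (?_ : (r * s' - s * r') * (x i).re = 0)).resolve_left h
    linear_combination s' * h1 - s * h2
  · refine (mul_eq_zero.1 (?_ : (r * s' - s * r') * (x i).im = 0)).resolve_left h
    linear_combination r * h2 - r' * h1

/-! ### Real models with `ε = 1`: pencils of real `2 × 2` matrices. -/

namespace Constants

/-- With `ω^1 = a + i b` and `ω^2 = p + i q`, the structure equations read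
`d p = 0`, `d q = -2 a ∧ b`, `d ω^3 = M (a, b) ∧ p + N (a, b) ∧ q`. -/
structure IsPencil (c : Constants) (M N : Matrix (Fin 2) (Fin 2) ℝ) : Prop where
  eps : c.ε = 1
  re : ∀ x y, (c.form x y).re =
    (M 0 0 * (x 0).re + M 0 1 * (x 0).im) * (y 1).re -
    (M 0 0 * (y 0).re + M 0 1 * (y 0).im) * (x 1).re +
    (N 0 0 * (x 0).re + N 0 1 * (x 0).im) * (y 1).im -
    (N 0 0 * (y 0).re + N 0 1 * (y 0).im) * (x 1).im
  im : ∀ x y, (c.form x y).im =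
    (M 1 0 * (x 0).re + M 1 1 * (x 0).im) * (y 1).re -
    (M 1 0 * (y 0).re + M 1 1 * (y 0).im) * (x 1).re +
    (N 1 0 * (x 0).re + N 1 1 * (x 0).im) * (y 1).im -
    (N 1 0 * (y 0).re + N 1 1 * (y 0).im) * (x 1).im

variable {c : Constants} {M N : Matrix (Fin 2) (Fin 2) ℝ}

/-- The mixed coefficient of `det (x M + y N)`. -/
def polarDet (M N : Matrix (Fin 2) (Fin 2) ℝ) : ℝ :=
  M 0 0 * N 1 1 + N 0 0 * M 1 1 - M 0 1 * N 1 0 - N 0 1 * M 1 0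

/-- The discriminant of `det (x M + y N)`. -/
def disc (M N : Matrix (Fin 2) (Fin 2) ℝ) : ℝ :=
  polarDet M N ^ 2 - 4 * M.det * N.det

theorem left_mul_eq_zero (hN : N.det ≠ 0) {l m : ℝ} (h0 : l * N 0 0 + m * N 1 0 = 0)
    (h1 : l * N 0 1 + m * N 1 1 = 0) : l = 0 ∧ m = 0 := by
  rw [Matrix.det_fin_two] at hN
  constructor
  · refine (mul_eq_zero.1 (?_ : (N 0 0 * N 1 1 - N 0 1 * N 1 0) * l = 0)).resolve_left hN
    linear_combination N 1 1 * h0 - N 1 0 * h1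
  · refine (mul_eq_zero.1 (?_ : (N 0 0 * N 1 1 - N 0 1 * N 1 0) * m = 0)).resolve_left hN
    linear_combination N 0 0 * h1 - N 0 1 * h0

namespace IsPencil

theorem bracket_zero' (x y : Fin 3 → ℂ) (r s : ℝ) : realCoord r s 0 (c.bracket x y) = 0 := by
  simp [realCoord_apply]

theorem bracket_one' (h : c.IsPencil M N) (x y : Fin 3 → ℂ) (r s : ℝ) :
    realCoord r s 1 (c.bracket x y) =
      2 * s * ((x 0).re * (y 0).im - (y 0).re * (x 0).im) := by
  simp [realCoord_apply, h.eps]; ring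

theorem bracket_two' (h : c.IsPencil M N) (x y : Fin 3 → ℂ) (r s : ℝ) :
    realCoord r s 2 (c.bracket x y) =
    -(((r * M 0 0 + s * M 1 0) * (x 0).re + (r * M 0 1 + s * M 1 1) * (x 0).im) * (y 1).re -
      ((r * M 0 0 + s * M 1 0) * (y 0).re + (r * M 0 1 + s * M 1 1) * (y 0).im) * (x 1).re +
      ((r * N 0 0 + s * N 1 0) * (x 0).re + (r * N 0 1 + s * N 1 1) * (x 0).im) * (y 1).im -
      ((r * N 0 0 + s * N 1 0) * (y 0).re + (r * N 0 1 + s * N 1 1) * (y 0).im) * (x 1).im) := by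
  simp only [realCoord_apply, bracket_two, Complex.neg_re, Complex.neg_im, h.re, h.im]
  ring

/-- Criterion in terms of 1-forms `e^1, e^2` in `ω^1`, `e^3, e^4` in `ω^2`, `e^5, e^6` in `ω^3`. -/
theorem hasModel {n : ℕ} (r s : Fin 6 → ℝ) (i : Fin 6 → Fin 3) (a b d : Fin 6 × Fin 6)
    (ha : i a.1 = 0 ∧ i a.2 = 0 ∧ r a.1 * s a.2 - s a.1 * r a.2 ≠ 0)
    (hb : i b.1 = 1 ∧ i b.2 = 1 ∧ r b.1 * s b.2 - s b.1 * r b.2 ≠ 0)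
    (hd : i d.1 = 2 ∧ i d.2 = 2 ∧ r d.1 * s d.2 - s d.1 * r d.2 ≠ 0)
    (hbr : ∀ x y k, realCoord (r k) (s k) (i k) (c.bracket x y) =
      nilBracket n (fun j => realCoord (r j) (s j) (i j) x)
        (fun j => realCoord (r j) (s j) (i j) y) k) : c.HasModel n := by
  refine ⟨fun j => realCoord (r j) (s j) (i j), fun x hx => ?_, hbr⟩
  refine ext_zero ⟨?_, ?_⟩ ?_
  · refine eq_zero_of_realCoord ha.2.2 ?_ ?_
    · rw [← ha.1]; exact hx _
    · rw [← ha.2.1]; exact hx _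
  · refine eq_zero_of_realCoord hb.2.2 ?_ ?_
    · rw [← hb.1]; exact hx _
    · rw [← hb.2.1]; exact hx _
  · refine eq_zero_of_realCoord hd.2.2 ?_ ?_
    · rw [← hd.1]; exact hx _
    · rw [← hd.2.1]; exact hx _

/-- There are two real eigenvalues `κ ≠ κ'` with left null vectors `(l, m)` of `M - κN` and `(l',
m')` of `M - κ'N`. In the direction `(l, m)`, the differential of `ω³` is `(l, m)N ∧ (κp + q)`, and
similarly for the other. The forms `(l, m)N` and `(l', m')N` serve as `e^1, e^2`. -/
theorem hasModel_thirteen (h : c.IsPencil M N) (hN : N.det ≠ 0) (hd : 0 < disc M N) :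
    c.HasModel 13 := by
  set T := polarDet M N with hT
  set q := Real.sqrt (disc M N)
  have hq : q ^ 2 = disc M N := Real.sq_sqrt hd.le
  have hq0 : q ≠ 0 := (Real.sqrt_pos.2 hd).ne'
  have key (q' : ℝ) (hq' : q' ^ 2 = disc M N) : ∃ κ l m : ℝ, κ = (T + q') / (2 * N.det) ∧
      (l ≠ 0 ∨ m ≠ 0) ∧ l * M 0 0 + m * M 1 0 = κ * (l * N 0 0 + m * N 1 0) ∧
      l * M 0 1 + m * M 1 1 = κ * (l * N 0 1 + m * N 1 1) := by
    set κ := (T + q') / (2 * N.det) with hκ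
    have hκ' : 2 * N.det * κ = T + q' := by rw [hκ]; field_simp
    have hdet : (M 0 0 - κ * N 0 0) * (M 1 1 - κ * N 1 1) -
        (M 0 1 - κ * N 0 1) * (M 1 0 - κ * N 1 0) = 0 := by
      have : 4 * N.det * ((M 0 0 - κ * N 0 0) * (M 1 1 - κ * N 1 1) -
        (M 0 1 - κ * N 0 1) * (M 1 0 - κ * N 1 0)) = 0 := by
        have e : 4 * N.det * ((M 0 0 - κ * N 0 0) * (M 1 1 - κ * N 1 1) -
          (M 0 1 - κ * N 0 1) * (M 1 0 - κ * N 1 0)) =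
          (2 * N.det * κ) ^ 2 - 2 * (2 * N.det * κ) * T + 4 * M.det * N.det := by
          rw [hT, polarDet, Matrix.det_fin_two, Matrix.det_fin_two]; ring
        rw [e, hκ']
        rw [disc] at hq'
        linear_combination hq'
      exact (mul_eq_zero.1 this).resolve_left (by simpa using hN)
    obtain ⟨l, m, h0, h1, h2⟩ := exists_left_null hdet
    exact ⟨κ, l, m, rfl, h0, by linear_combination h1, by linear_combination h2⟩
  obtain ⟨κ, l, m, hκ, hlm, h1, h2⟩ := key q hq
  obtain ⟨κ', l', m', hκ', hlm', h1', h2'⟩ := key (-q) (by rw [neg_sq, hq])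
  have hne : κ - κ' ≠ 0 := by
    have : κ - κ' = q / N.det := by rw [hκ, hκ']; field_simp; ring
    rw [this]
    exact div_ne_zero hq0 hN
  have hlN := @left_mul_eq_zero N hN
  -- Null vectors belonging to different eigenvalues are independent: otherwise `N` would kill one
  -- of them.
  have hχ : l * m' - m * l' ≠ 0 := by
    intro h0
    have k1 : (κ - κ') * (l' * (l * N 0 0 + m * N 1 0)) = 0 := by
      linear_combination -l' * h1 + l * h1' + (κ' * N 1 0 - M 1 0) * h0
    have k2 : (κ - κ') * (l' * (l * N 0 1 + m * N 1 1)) = 0 := by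
      linear_combination -l' * h2 + l * h2' + (κ' * N 1 1 - M 1 1) * h0
    have k3 : (κ - κ') * (m' * (l * N 0 0 + m * N 1 0)) = 0 := by
      linear_combination -m' * h1 + m * h1' - (κ' * N 0 0 - M 0 0) * h0
    have k4 : (κ - κ') * (m' * (l * N 0 1 + m * N 1 1)) = 0 := by
      linear_combination -m' * h2 + m * h2' - (κ' * N 0 1 - M 0 1) * h0
    replace k1 := (mul_eq_zero.1 k1).resolve_left hne
    replace k2 := (mul_eq_zero.1 k2).resolve_left hne
    replace k3 := (mul_eq_zero.1 k3).resolve_left hne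
    replace k4 := (mul_eq_zero.1 k4).resolve_left hne
    have : l = 0 ∧ m = 0 := by
      rcases hlm' with hl | hm
      · exact hlN ((mul_eq_zero.1 k1).resolve_left hl) ((mul_eq_zero.1 k2).resolve_left hl)
      · exact hlN ((mul_eq_zero.1 k3).resolve_left hm) ((mul_eq_zero.1 k4).resolve_left hm)
    tauto
  -- The scale is fixed by `d e^4 = e^1 ∧ e^2`, since `dq = -2 a ∧ b` and `e^1 ∧ e^2` is `det N (l
  -- m' - m l')` times `a ∧ b`.
  set t := -(N.det * (l * m' - m * l')) / 2 with ht
  have ht0 : t ≠ 0 := div_ne_zero (neg_ne_zero.2 (mul_ne_zero hN hχ)) two_ne_zero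
  have hτ : (l * N 0 0 + m * N 1 0) * (l' * N 0 1 + m' * N 1 1) -
      (l * N 0 1 + m * N 1 1) * (l' * N 0 0 + m' * N 1 0) = -2 * t := by
    rw [ht, Matrix.det_fin_two]; ring
  refine hasModel
    ![l * N 0 0 + m * N 1 0, l' * N 0 0 + m' * N 1 0, t * (κ - κ'), t * κ', t * l, t * l']
    ![l * N 0 1 + m * N 1 1, l' * N 0 1 + m' * N 1 1, 0, t, t * m, t * m']
    ![0, 0, 1, 1, 2, 2] (0, 1) (2, 3) (4, 5) ⟨rfl, rfl, ?_⟩ ⟨rfl, rfl, ?_⟩ ⟨rfl, rfl, ?_⟩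
    fun x y k => ?_
  · change (l * N 0 0 + m * N 1 0) * (l' * N 0 1 + m' * N 1 1) -
      (l * N 0 1 + m * N 1 1) * (l' * N 0 0 + m' * N 1 0) ≠ 0
    rw [hτ]
    simpa using ht0
  · change t * (κ - κ') * t - 0 * (t * κ') ≠ 0
    simp [ht0, hne]
  · change t * l * (t * m') - t * m * (t * l') ≠ 0
    have : t * l * (t * m') - t * m * (t * l') = t ^ 2 * (l * m' - m * l') := by ring
    rw [this]
    exact mul_ne_zero (pow_ne_zero _ ht0) hχ
  · rw [nilBracket_thirteen]
    fin_cases k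
    · simp [bracket_zero']
    · simp [bracket_zero']
    · simp [h.bracket_one']
    · simp [h.bracket_one', realCoord_apply]
      linear_combination ((x 0).re * (y 0).im - (y 0).re * (x 0).im) * hτ
    · simp [h.bracket_two', realCoord_apply]
      linear_combination
        t * (-(x 0).re * (y 1).re + (y 0).re * (x 1).re) * h1 +
        t * (-(x 0).im * (y 1).re + (y 0).im * (x 1).re) * h2
    · simp [h.bracket_two', realCoord_apply]
      linear_combination
        t * (-(x 0).re * (y 1).re + (y 0).re * (x 1).re) * h1' +
        t * (-(x 0).im * (y 1).re + (y 0).im * (x 1).re) * h2'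

end IsPencil
end Constants

namespace Constants
variable {c : Constants} {M N : Matrix (Fin 2) (Fin 2) ℝ}
namespace IsPencil

/-- A left null vector of `M - κN` for the non-real root `κ = κ₁ + iκ₂`, split into real and
imaginary parts. These are independent because `κ₂ ≠ 0`. -/
theorem exists_complex_eigenvector (hd : disc M N < 0) : ∃ κ₁ κ₂ l m l' m' : ℝ,
    κ₂ ≠ 0 ∧ N.det * (l * m' - m * l') ≠ 0 ∧
    l * M 0 0 + m * M 1 0 =
      κ₁ * (l * N 0 0 + m * N 1 0) - κ₂ * (l' * N 0 0 + m' * N 1 0) ∧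
    l * M 0 1 + m * M 1 1 =
      κ₁ * (l * N 0 1 + m * N 1 1) - κ₂ * (l' * N 0 1 + m' * N 1 1) ∧
    l' * M 0 0 + m' * M 1 0 =
      κ₁ * (l' * N 0 0 + m' * N 1 0) + κ₂ * (l * N 0 0 + m * N 1 0) ∧
    l' * M 0 1 + m' * M 1 1 =
      κ₁ * (l' * N 0 1 + m' * N 1 1) + κ₂ * (l * N 0 1 + m * N 1 1) := by
  -- For singular `N` the discriminant is a square.
  have hN : N.det ≠ 0 := by
    intro h0
    rw [disc, h0, mul_zero, sub_zero] at hd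
    nlinarith [sq_nonneg (polarDet M N)]
  set T := polarDet M N with hT
  set q := Real.sqrt (-disc M N)
  have hq : q ^ 2 = -disc M N := Real.sq_sqrt (by linarith)
  have hq0 : q ≠ 0 := (Real.sqrt_pos.2 (by linarith)).ne'
  set κ₁ := T / (2 * N.det) with hκ₁
  set κ₂ := q / (2 * N.det) with hκ₂
  have hκ₂0 : κ₂ ≠ 0 := div_ne_zero hq0 (mul_ne_zero two_ne_zero hN)
  obtain ⟨l, m, hlm, h1, h2⟩ : ∃ l m : ℂ, (l ≠ 0 ∨ m ≠ 0) ∧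
      l * (M 0 0 - (κ₁ + κ₂ * Complex.I) * N 0 0) +
        m * (M 1 0 - (κ₁ + κ₂ * Complex.I) * N 1 0) = 0 ∧
      l * (M 0 1 - (κ₁ + κ₂ * Complex.I) * N 0 1) +
        m * (M 1 1 - (κ₁ + κ₂ * Complex.I) * N 1 1) = 0 := by
    refine exists_left_null ?_
    have e1 : 2 * N.det * κ₁ = T := by rw [hκ₁]; field_simp
    have e2 : 2 * N.det * κ₂ = q := by rw [hκ₂]; field_simp
    rw [disc, ← hT] at hq
    have e3 : N.det * κ₁ ^ 2 - κ₁ * T + M.det - N.det * κ₂ ^ 2 = 0 := by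
      refine (mul_eq_zero.1 (?_ : (4 * N.det) * _ = 0)).resolve_left (by simpa using hN)
      linear_combination (2 * N.det * κ₁ - T) * e1 - (2 * N.det * κ₂ + q) * e2 - hq
    have e4 : 2 * N.det * κ₁ * κ₂ - κ₂ * T = 0 := by linear_combination κ₂ * e1
    have e3' := congrArg (fun r : ℝ => (r : ℂ)) e3
    have e4' := congrArg (fun r : ℝ => (r : ℂ)) e4
    rw [hT, polarDet, Matrix.det_fin_two] at e4'
    rw [hT, polarDet, Matrix.det_fin_two, Matrix.det_fin_two] at e3'
    push_cast at e3' e4'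
    linear_combination e3' + Complex.I * e4' +
      (κ₂ : ℂ) ^ 2 * (N 0 0 * N 1 1 - N 0 1 * N 1 0) * Complex.I_sq
  have r1 := congrArg Complex.re h1
  have i1 := congrArg Complex.im h1
  have r2 := congrArg Complex.re h2
  have i2 := congrArg Complex.im h2
  simp at r1 i1 r2 i2
  have hχ : l.re * m.im - m.re * l.im ≠ 0 := by
    intro h0
    have k1 : κ₂ * ((l.re ^ 2 + l.im ^ 2) * N 0 0 + (l.re * m.re + l.im * m.im) * N 1 0) = 0 := by
      linear_combination l.im * r1 - l.re * i1 + (M 1 0 - κ₁ * N 1 0) * h0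
    have k2 : κ₂ * ((l.re ^ 2 + l.im ^ 2) * N 0 1 + (l.re * m.re + l.im * m.im) * N 1 1) = 0 := by
      linear_combination l.im * r2 - l.re * i2 + (M 1 1 - κ₁ * N 1 1) * h0
    have k3 : κ₂ * ((l.re * m.re + l.im * m.im) * N 0 0 + (m.re ^ 2 + m.im ^ 2) * N 1 0) = 0 := by
      linear_combination m.im * r1 - m.re * i1 - (M 0 0 - κ₁ * N 0 0) * h0
    have k4 : κ₂ * ((l.re * m.re + l.im * m.im) * N 0 1 + (m.re ^ 2 + m.im ^ 2) * N 1 1) = 0 := by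
      linear_combination m.im * r2 - m.re * i2 - (M 0 1 - κ₁ * N 0 1) * h0
    have kl := (left_mul_eq_zero hN ((mul_eq_zero.1 k1).resolve_left hκ₂0)
      ((mul_eq_zero.1 k2).resolve_left hκ₂0)).1
    have km := (left_mul_eq_zero hN ((mul_eq_zero.1 k3).resolve_left hκ₂0)
      ((mul_eq_zero.1 k4).resolve_left hκ₂0)).2
    have l0 : l = 0 := Complex.normSq_eq_zero.1 (by rw [Complex.normSq_apply, ← kl]; ring)
    have m0 : m = 0 := Complex.normSq_eq_zero.1 (by rw [Complex.normSq_apply, ← km]; ring)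
    exact hlm.elim (fun h => h l0) fun h => h m0
  exact ⟨κ₁, κ₂, l.re, m.re, l.im, m.im, hκ₂0, mul_ne_zero hN hχ, by linear_combination r1,
    by linear_combination r2, by linear_combination i1, by linear_combination i2⟩

/-- Along the real part of the eigenvector, `dω³` is `e^1 ∧ (κ₁ p + q) - κ₂ e^2 ∧ p`. Along the
imaginary part it is `e^2 ∧ (κ₁ p + q) + κ₂ e^1 ∧ p`. Up to scaling these are the last two
differentials of `h_15`. -/
theorem hasModel_fifteen (h : c.IsPencil M N) (hd : disc M N < 0) : c.HasModel 15 := by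
  obtain ⟨κ₁, κ₂, l, m, l', m', hκ₂0, hχ, r1, r2, i1, i2⟩ := exists_complex_eigenvector hd
  set t := -(N.det * (l * m' - m * l')) / 2 with ht
  have ht0 : t ≠ 0 := div_ne_zero (neg_ne_zero.2 hχ) two_ne_zero
  have hτ : (l * N 0 0 + m * N 1 0) * (l' * N 0 1 + m' * N 1 1) -
      (l * N 0 1 + m * N 1 1) * (l' * N 0 0 + m' * N 1 0) = -2 * t := by
    rw [ht, Matrix.det_fin_two]; ring
  refine hasModel
    ![l * N 0 0 + m * N 1 0, l' * N 0 0 + m' * N 1 0, -t * κ₂, t * κ₁, -t * l',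
      t * l]
    ![l * N 0 1 + m * N 1 1, l' * N 0 1 + m' * N 1 1, 0, t, -t * m', t * m]
    ![0, 0, 1, 1, 2, 2] (0, 1) (2, 3) (4, 5) ⟨rfl, rfl, ?_⟩ ⟨rfl, rfl, ?_⟩ ⟨rfl, rfl, ?_⟩
    fun x y k => ?_
  · change (l * N 0 0 + m * N 1 0) * (l' * N 0 1 + m' * N 1 1) -
      (l * N 0 1 + m * N 1 1) * (l' * N 0 0 + m' * N 1 0) ≠ 0
    rw [hτ]
    simpa using ht0
  · change -t * κ₂ * t - 0 * (t * κ₁) ≠ 0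
    simp [ht0, hκ₂0]
  · change -t * l' * (t * m) - -t * m' * (t * l) ≠ 0
    have : -t * l' * (t * m) - -t * m' * (t * l) =
      t ^ 2 * (l * m' - m * l') := by ring
    rw [this]
    exact mul_ne_zero (pow_ne_zero _ ht0) (right_ne_zero_of_mul hχ)
  · rw [nilBracket_fifteen]
    fin_cases k
    · simp [bracket_zero']
    · simp [bracket_zero']
    · simp [h.bracket_one']
    · simp [h.bracket_one', realCoord_apply]
      linear_combination ((x 0).re * (y 0).im - (y 0).re * (x 0).im) * hτ
    · simp [h.bracket_two', realCoord_apply]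
      linear_combination
        t * ((x 0).re * (y 1).re - (y 0).re * (x 1).re) * i1 +
        t * ((x 0).im * (y 1).re - (y 0).im * (x 1).re) * i2
    · simp [h.bracket_two', realCoord_apply]
      linear_combination
        -t * ((x 0).re * (y 1).re - (y 0).re * (x 1).re) * r1 -
        t * ((x 0).im * (y 1).re - (y 0).im * (x 1).re) * r2

/-- Proportional matrices leave one common factor: `dω³ = N(a, b) ∧ (κp + q)`. -/
theorem hasModel_sixteen (h : c.IsPencil M N) (hN : N.det ≠ 0) {κ : ℝ} (hM : M = κ • N) :
    c.HasModel 16 := by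
  have m00 : M 0 0 = κ * N 0 0 := by rw [hM]; rfl
  have m01 : M 0 1 = κ * N 0 1 := by rw [hM]; rfl
  have m10 : M 1 0 = κ * N 1 0 := by rw [hM]; rfl
  have m11 : M 1 1 = κ * N 1 1 := by rw [hM]; rfl
  set t := -N.det / 2 with ht
  have ht0 : t ≠ 0 := div_ne_zero (neg_ne_zero.2 hN) two_ne_zero
  have hτ : N 0 0 * N 1 1 - N 0 1 * N 1 0 = -2 * t := by
    rw [ht, Matrix.det_fin_two]; ring
  refine hasModel ![N 0 0, N 1 0, 1, t * κ, t, 0] ![N 0 1, N 1 1, 0, t, 0, t]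
    ![0, 0, 1, 1, 2, 2] (0, 1) (2, 3) (4, 5) ⟨rfl, rfl, ?_⟩ ⟨rfl, rfl, ?_⟩ ⟨rfl, rfl, ?_⟩
    fun x y k => ?_
  · change N 0 0 * N 1 1 - N 0 1 * N 1 0 ≠ 0
    rw [hτ]
    simpa using ht0
  · simpa using ht0
  · simpa using ht0
  · rw [nilBracket_sixteen]
    fin_cases k
    · simp [bracket_zero']
    · simp [bracket_zero']
    · simp [h.bracket_one']
    · simp [h.bracket_one', realCoord_apply]
      linear_combination ((x 0).re * (y 0).im - (y 0).re * (x 0).im) * hτ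
    · simp [h.bracket_two', realCoord_apply, m00, m01]
      ring
    · simp [h.bracket_two', realCoord_apply, m10, m11]
      ring

/-- The Jordan block case. With the double eigenvalue `κ` and a left null vector `(l, m)` of `M -
κN`, the orthogonal vector `(-m, l)` satisfies `(-m, l)(M - κN) = ν (l, m)N`, where `ν ≠ 0` because
`M` is not a multiple of `N`. -/
theorem hasModel_fourteen (h : c.IsPencil M N) (hN : N.det ≠ 0) (hd : disc M N = 0)
    (hM : ∀ κ : ℝ, M ≠ κ • N) : c.HasModel 14 := by
  set T := polarDet M N with hT
  set κ := T / (2 * N.det) with hκ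
  have hκ' : 2 * N.det * κ = T := by rw [hκ]; field_simp
  have hdet : (M 0 0 - κ * N 0 0) * (M 1 1 - κ * N 1 1) -
      (M 0 1 - κ * N 0 1) * (M 1 0 - κ * N 1 0) = 0 := by
    refine (mul_eq_zero.1 (?_ : 4 * N.det * _ = 0)).resolve_left (by simpa using hN)
    have e : 4 * N.det * ((M 0 0 - κ * N 0 0) * (M 1 1 - κ * N 1 1) -
      (M 0 1 - κ * N 0 1) * (M 1 0 - κ * N 1 0)) =
      (2 * N.det * κ) ^ 2 - 2 * (2 * N.det * κ) * T + 4 * M.det * N.det := by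
      rw [hT, polarDet, Matrix.det_fin_two, Matrix.det_fin_two]; ring
    rw [e, hκ']
    rw [disc] at hd
    linear_combination -hd
  obtain ⟨l, m, hlm, h1, h2⟩ := exists_left_null hdet
  have hpos : l ^ 2 + m ^ 2 ≠ 0 := by
    intro h0
    have : l = 0 := by nlinarith
    have : m = 0 := by nlinarith
    tauto
  set a := l * N 0 0 + m * N 1 0 with ha
  set b := l * N 0 1 + m * N 1 1 with hb
  set a' := -m * N 0 0 + l * N 1 0 with ha'
  set b' := -m * N 0 1 + l * N 1 1 with hb'
  have hab : a ^ 2 + b ^ 2 ≠ 0 := by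
    intro h0
    have a0 : a = 0 := by nlinarith
    have b0 : b = 0 := by nlinarith
    have := left_mul_eq_zero hN a0 b0
    tauto
  set u := -m * (M 0 0 - κ * N 0 0) + l * (M 1 0 - κ * N 1 0) with hu
  set v := -m * (M 0 1 - κ * N 0 1) + l * (M 1 1 - κ * N 1 1) with hv
  -- The cross product is the derivative of `det (M - κN)` at the double root, up to sign and a
  -- factor, once `(l, m)(M - κN) = 0` is used.
  have hcross : a * v - b * u = 0 := by
    have e : a * v - b * u = (l ^ 2 + m ^ 2) * (T - 2 * N.det * κ) -
        ((l * (M 0 0 - κ * N 0 0) + m * (M 1 0 - κ * N 1 0)) * b' -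
         (l * (M 0 1 - κ * N 0 1) + m * (M 1 1 - κ * N 1 1)) * a') := by
      rw [ha, hb, ha', hb', hu, hv, hT, polarDet, Matrix.det_fin_two]; ring
    rw [e, h1, h2, hκ']; ring
  set ν := (a * u + b * v) / (a ^ 2 + b ^ 2) with hν
  have hνu : u = ν * a := by
    rw [hν]; field_simp; linear_combination -b * hcross
  have hνv : v = ν * b := by
    rw [hν]; field_simp; linear_combination a * hcross
  have hν0 : ν ≠ 0 := by
    intro h0
    rw [h0, zero_mul] at hνu hνv
    apply hM κ
    have k1 : M 0 0 - κ * N 0 0 = 0 := by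
      refine (mul_eq_zero.1 (?_ : (l ^ 2 + m ^ 2) * _ = 0)).resolve_left hpos
      linear_combination l * h1 - m * hνu + m * hu
    have k2 : M 0 1 - κ * N 0 1 = 0 := by
      refine (mul_eq_zero.1 (?_ : (l ^ 2 + m ^ 2) * _ = 0)).resolve_left hpos
      linear_combination l * h2 - m * hνv + m * hv
    have k3 : M 1 0 - κ * N 1 0 = 0 := by
      refine (mul_eq_zero.1 (?_ : (l ^ 2 + m ^ 2) * _ = 0)).resolve_left hpos
      linear_combination m * h1 + l * hνu - l * hu
    have k4 : M 1 1 - κ * N 1 1 = 0 := by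
      refine (mul_eq_zero.1 (?_ : (l ^ 2 + m ^ 2) * _ = 0)).resolve_left hpos
      linear_combination m * h2 + l * hνv - l * hv
    ext i j
    fin_cases i <;> fin_cases j <;> simp <;> linarith
  set t := -(N.det * (l ^ 2 + m ^ 2)) / 2 with ht
  have ht0 : t ≠ 0 := div_ne_zero (neg_ne_zero.2 (mul_ne_zero hN hpos)) two_ne_zero
  have hτ : a * b' - b * a' = -2 * t := by
    rw [ht, Matrix.det_fin_two, ha, hb, ha', hb']; ring
  refine hasModel
    ![a, a', -t * ν, t * κ, t * l, t * m] ![b, b', 0, t, t * m, -t * l]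
    ![0, 0, 1, 1, 2, 2] (0, 1) (2, 3) (4, 5) ⟨rfl, rfl, ?_⟩ ⟨rfl, rfl, ?_⟩ ⟨rfl, rfl, ?_⟩
    fun x y k => ?_
  · change a * b' - b * a' ≠ 0
    rw [hτ]
    simpa using ht0
  · change -t * ν * t - 0 * (t * κ) ≠ 0
    simp [ht0, hν0]
  · change t * l * (-t * l) - t * m * (t * m) ≠ 0
    have : t * l * (-t * l) - t * m * (t * m) = -t ^ 2 * (l ^ 2 + m ^ 2) := by ring
    rw [this]
    exact mul_ne_zero (neg_ne_zero.2 (pow_ne_zero _ ht0)) hpos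
  · rw [nilBracket_fourteen]
    fin_cases k
    · simp [bracket_zero']
    · simp [bracket_zero']
    · simp [h.bracket_one']
    · simp [h.bracket_one', realCoord_apply]
      linear_combination ((x 0).re * (y 0).im - (y 0).re * (x 0).im) * hτ
    · simp [h.bracket_two', realCoord_apply]
      linear_combination
        -t * ((x 0).re * (y 1).re - (y 0).re * (x 1).re) * h1 -
        t * ((x 0).im * (y 1).re - (y 0).im * (x 1).re) * h2
    · simp [h.bracket_two', realCoord_apply]
      linear_combination
        t * ((x 0).re * (y 1).re - (y 0).re * (x 1).re) * (hνu - hu) +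
        t * ((x 0).im * (y 1).re - (y 0).im * (x 1).re) * (hνv - hv)

end IsPencil
end Constants

namespace Constants
variable {c : Constants} {M N : Matrix (Fin 2) (Fin 2) ℝ}
namespace IsPencil

/-- A left null vector `(l, m)` of a singular matrix `N ≠ 0`. -/
theorem exists_null (hN : N.det = 0) (hN0 : N ≠ 0) : ∃ l m : ℝ, l ^ 2 + m ^ 2 ≠ 0 ∧
    l * N 0 0 + m * N 1 0 = 0 ∧ l * N 0 1 + m * N 1 1 = 0 ∧
    ¬(-m * N 0 0 + l * N 1 0 = 0 ∧ -m * N 0 1 + l * N 1 1 = 0) := by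
  rw [Matrix.det_fin_two] at hN
  obtain ⟨l, m, hlm, h1, h2⟩ := exists_left_null hN
  have hpos : l ^ 2 + m ^ 2 ≠ 0 := by
    intro h0
    have : l = 0 := by nlinarith
    have : m = 0 := by nlinarith
    tauto
  refine ⟨l, m, hpos, h1, h2, fun ⟨h3, h4⟩ => hN0 ?_⟩
  have k1 : N 0 0 = 0 := by
    refine (mul_eq_zero.1 (?_ : (l ^ 2 + m ^ 2) * _ = 0)).resolve_left hpos
    linear_combination l * h1 - m * h3
  have k2 : N 0 1 = 0 := by
    refine (mul_eq_zero.1 (?_ : (l ^ 2 + m ^ 2) * _ = 0)).resolve_left hpos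
    linear_combination l * h2 - m * h4
  have k3 : N 1 0 = 0 := by
    refine (mul_eq_zero.1 (?_ : (l ^ 2 + m ^ 2) * _ = 0)).resolve_left hpos
    linear_combination m * h1 + l * h3
  have k4 : N 1 1 = 0 := by
    refine (mul_eq_zero.1 (?_ : (l ^ 2 + m ^ 2) * _ = 0)).resolve_left hpos
    linear_combination m * h2 + l * h4
  ext i j
  fin_cases i <;> fin_cases j <;> simp <;> assumption

/-- Since `(l, m)N = 0`, the form `q` drops out of one component: its differential is `e^1 ∧ p` with
`e^1 = (l, m)M`. In the other component the part `α e^1 ∧ p` is removed by subtracting `α` times the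
first, and `q` is shifted by `βp`. -/
theorem hasModel_twelve (h : c.IsPencil M N) (hN : N.det = 0) (hd : 0 < disc M N) :
    c.HasModel 12 := by
  have hT : polarDet M N ≠ 0 := by
    intro h0
    rw [disc, hN, h0] at hd
    simp at hd
  obtain ⟨l, m, hpos, h1, h2, -⟩ := exists_null hN fun h0 => hT (by simp [polarDet, h0])
  have hχ : (l * M 0 0 + m * M 1 0) * (-m * N 0 1 + l * N 1 1) -
      (l * M 0 1 + m * M 1 1) * (-m * N 0 0 + l * N 1 0) =
      (l ^ 2 + m ^ 2) * polarDet M N := by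
    rw [polarDet]
    linear_combination -(-m * M 0 1 + l * M 1 1) * h1 + (-m * M 0 0 + l * M 1 0) * h2
  set a := l * M 0 0 + m * M 1 0 with ha
  set b := l * M 0 1 + m * M 1 1 with hb
  set a' := -m * N 0 0 + l * N 1 0 with ha'
  set b' := -m * N 0 1 + l * N 1 1 with hb'
  have hχ0 : a * b' - b * a' ≠ 0 := by rw [hχ]; exact mul_ne_zero hpos hT
  set u := -m * M 0 0 + l * M 1 0 with hu
  set v := -m * M 0 1 + l * M 1 1 with hv
  set α := (u * b' - v * a') / (a * b' - b * a') with hα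
  set β := (a * v - b * u) / (a * b' - b * a') with hβ
  have hu' : u = α * a + β * a' := by
    rw [hα, hβ, div_mul_eq_mul_div, div_mul_eq_mul_div, ← add_div, eq_div_iff hχ0]; ring
  have hv' : v = α * b + β * b' := by
    rw [hα, hβ, div_mul_eq_mul_div, div_mul_eq_mul_div, ← add_div, eq_div_iff hχ0]; ring
  set t := -(a * b' - b * a') / 2 with ht
  have ht0 : t ≠ 0 := div_ne_zero (neg_ne_zero.2 hχ0) two_ne_zero
  have hτ : a * b' - b * a' = -2 * t := by rw [ht]; ring
  refine hasModel
    ![a, a', 1, t * β, l, t * (-m - α * l)] ![b, b', 0, t, m, t * (l - α * m)]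
    ![0, 0, 1, 1, 2, 2] (0, 1) (2, 3) (4, 5) ⟨rfl, rfl, hχ0⟩ ⟨rfl, rfl, ?_⟩ ⟨rfl, rfl, ?_⟩
    fun x y k => ?_
  · simpa using ht0
  · change l * (t * (l - α * m)) - m * (t * (-m - α * l)) ≠ 0
    have : l * (t * (l - α * m)) - m * (t * (-m - α * l)) = t * (l ^ 2 + m ^ 2) := by ring
    rw [this]
    exact mul_ne_zero ht0 hpos
  · rw [nilBracket_twelve]
    fin_cases k
    · simp [bracket_zero']
    · simp [bracket_zero']
    · simp [h.bracket_one']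
    · simp [h.bracket_one', realCoord_apply]
      linear_combination ((x 0).re * (y 0).im - (y 0).re * (x 0).im) * hτ
    · simp [h.bracket_two', realCoord_apply]
      linear_combination
        -((x 0).re * (y 1).im - (y 0).re * (x 1).im) * h1 -
        ((x 0).im * (y 1).im - (y 0).im * (x 1).im) * h2
    · simp [h.bracket_two', realCoord_apply]
      linear_combination
        t * ((x 0).re * (y 1).re - (y 0).re * (x 1).re) * (hu - hu' - α * ha) +
        t * ((x 0).im * (y 1).re - (y 0).im * (x 1).re) * (hv - hv' - α * hb) +
        t * ((x 0).re * (y 1).im - (y 0).re * (x 1).im) * (ha' + α * h1) +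
        t * ((x 0).im * (y 1).im - (y 0).im * (x 1).im) * (hb' + α * h2)

/-- A common left null vector makes a real component of `ω³` closed. In the other component `p` and
`q` are multiplied by independent forms in `a, b`, which is the shape of `h_9`. -/
theorem hasModel_nine (h : c.IsPencil M N) {l m : ℝ} (hpos : l ^ 2 + m ^ 2 ≠ 0)
    (h1 : l * N 0 0 + m * N 1 0 = 0) (h2 : l * N 0 1 + m * N 1 1 = 0)
    (h3 : l * M 0 0 + m * M 1 0 = 0) (h4 : l * M 0 1 + m * M 1 1 = 0)
    (hχ : (-m * M 0 0 + l * M 1 0) * (-m * N 0 1 + l * N 1 1) -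
      (-m * M 0 1 + l * M 1 1) * (-m * N 0 0 + l * N 1 0) ≠ 0) : c.HasModel 9 := by
  set a := -m * M 0 0 + l * M 1 0 with ha
  set b := -m * M 0 1 + l * M 1 1 with hb
  set a' := -m * N 0 0 + l * N 1 0 with ha'
  set b' := -m * N 0 1 + l * N 1 1 with hb'
  set t := -(a * b' - b * a') / 2 with ht
  have ht0 : t ≠ 0 := div_ne_zero (neg_ne_zero.2 hχ) two_ne_zero
  have hτ : a * b' - b * a' = -2 * t := by rw [ht]; ring
  refine hasModel
    ![a, a', l, t, 0, t * -m] ![b, b', m, 0, t, t * l]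
    ![0, 0, 2, 1, 1, 2] (0, 1) (3, 4) (2, 5) ⟨rfl, rfl, hχ⟩ ⟨rfl, rfl, ?_⟩ ⟨rfl, rfl, ?_⟩
    fun x y k => ?_
  · simpa using ht0
  · change l * (t * l) - m * (t * -m) ≠ 0
    have : l * (t * l) - m * (t * -m) = t * (l ^ 2 + m ^ 2) := by ring
    rw [this]
    exact mul_ne_zero ht0 hpos
  · rw [nilBracket_nine]
    fin_cases k
    · simp [bracket_zero']
    · simp [bracket_zero']
    · simp [h.bracket_two', h1, h2, h3, h4]
    · simp [h.bracket_one']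
    · simp [h.bracket_one', realCoord_apply]
      linear_combination ((x 0).re * (y 0).im - (y 0).re * (x 0).im) * hτ
    · simp [h.bracket_two', realCoord_apply]
      linear_combination
        t * ((x 0).re * (y 1).re - (y 0).re * (x 1).re) * ha +
        t * ((x 0).im * (y 1).re - (y 0).im * (x 1).re) * hb +
        t * ((x 0).re * (y 1).im - (y 0).re * (x 1).im) * ha' +
        t * ((x 0).im * (y 1).im - (y 0).im * (x 1).im) * hb'

/-- With `(l, m)N = 0` and vanishing mixed coefficient, `(l, m)M` is a multiple `ν` of the row `(-m,
l)N`; it is nonzero because there is no common null vector. Whether `(-m, l)M` is parallel to that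
same row is decided by `det M`, and this separates `h_10` from `h_11`. -/
theorem hasModel_ten_or_eleven (h : c.IsPencil M N) (hN : N.det = 0) (hT : polarDet M N = 0)
    (hN0 : N ≠ 0)
    (hn : ∀ l m : ℝ, l * N 0 0 + m * N 1 0 = 0 → l * N 0 1 + m * N 1 1 = 0 →
      l * M 0 0 + m * M 1 0 = 0 → l * M 0 1 + m * M 1 1 = 0 → l = 0 ∧ m = 0) :
    (M.det = 0 → c.HasModel 10) ∧ (M.det ≠ 0 → c.HasModel 11) := by
  obtain ⟨l, m, hpos, h1, h2, h0⟩ := exists_null hN hN0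
  have hχ : (l * M 0 0 + m * M 1 0) * (-m * N 0 1 + l * N 1 1) -
      (l * M 0 1 + m * M 1 1) * (-m * N 0 0 + l * N 1 0) = 0 := by
    rw [polarDet] at hT
    linear_combination -(-m * M 0 1 + l * M 1 1) * h1 + (-m * M 0 0 + l * M 1 0) * h2 +
      (l ^ 2 + m ^ 2) * hT
  have hn' := hn l m h1 h2
  have hM : M.det * (l ^ 2 + m ^ 2) = (l * M 0 0 + m * M 1 0) * (-m * M 0 1 + l * M 1 1) -
      (l * M 0 1 + m * M 1 1) * (-m * M 0 0 + l * M 1 0) := by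
    rw [Matrix.det_fin_two]; ring
  set n₁ := l * M 0 0 + m * M 1 0 with hn₁
  set n₂ := l * M 0 1 + m * M 1 1 with hn₂
  set a := -m * N 0 0 + l * N 1 0 with ha
  set b := -m * N 0 1 + l * N 1 1 with hb
  set u := -m * M 0 0 + l * M 1 0 with hu
  set v := -m * M 0 1 + l * M 1 1 with hv
  have hab : a ^ 2 + b ^ 2 ≠ 0 := by
    intro h3
    exact h0 ⟨by nlinarith, by nlinarith⟩
  set ν := (n₁ * a + n₂ * b) / (a ^ 2 + b ^ 2) with hν
  have e1 : n₁ = ν * a := by rw [hν]; field_simp; linear_combination b * hχ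
  have e2 : n₂ = ν * b := by rw [hν]; field_simp; linear_combination -a * hχ
  have hν0 : ν ≠ 0 := by
    intro h3
    rw [h3, zero_mul] at e1 e2
    obtain ⟨rfl, rfl⟩ := hn' e1 e2
    simp at hpos
  constructor
  · intro hM0
    have hχ' : a * v - b * u = 0 := by
      refine (mul_eq_zero.1 (?_ : ν * _ = 0)).resolve_left hν0
      rw [hM0, e1, e2] at hM
      linear_combination -hM
    set β := (u * a + v * b) / (a ^ 2 + b ^ 2) with hβ
    have e3 : u = β * a := by rw [hβ]; field_simp; linear_combination -b * hχ'
    have e4 : v = β * b := by rw [hβ]; field_simp; linear_combination a * hχ'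
    set t := -(a ^ 2 + b ^ 2) / 2 with ht
    have ht0 : t ≠ 0 := div_ne_zero (neg_ne_zero.2 hab) two_ne_zero
    have hτ : a * a - b * -b = -2 * t := by rw [ht]; ring
    refine hasModel
      ![a, -b, 1, t * β, l / ν, t * -m] ![b, a, 0, t, m / ν, t * l]
      ![0, 0, 1, 1, 2, 2] (0, 1) (2, 3) (4, 5) ⟨rfl, rfl, ?_⟩ ⟨rfl, rfl, ?_⟩ ⟨rfl, rfl, ?_⟩
      fun x y k => ?_
    · change a * a - b * -b ≠ 0
      rw [hτ]
      simpa using ht0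
    · simpa using ht0
    · change l / ν * (t * l) - m / ν * (t * -m) ≠ 0
      have : l / ν * (t * l) - m / ν * (t * -m) = t / ν * (l ^ 2 + m ^ 2) := by ring
      rw [this]
      exact mul_ne_zero (div_ne_zero ht0 hν0) hpos
    · rw [nilBracket_ten]
      fin_cases k
      · simp [bracket_zero']
      · simp [bracket_zero']
      · simp [h.bracket_one']
      · simp [h.bracket_one', realCoord_apply]
        linear_combination ((x 0).re * (y 0).im - (y 0).re * (x 0).im) * hτ
      · simp [h.bracket_two', realCoord_apply]
        field_simp
        linear_combination
          ((x 0).re * (y 1).re - (y 0).re * (x 1).re) * (hn₁ - e1) +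
          ((x 0).im * (y 1).re - (y 0).im * (x 1).re) * (hn₂ - e2) -
          ((x 0).re * (y 1).im - (y 0).re * (x 1).im) * h1 -
          ((x 0).im * (y 1).im - (y 0).im * (x 1).im) * h2
      · simp [h.bracket_two', realCoord_apply]
        linear_combination
          t * ((x 0).re * (y 1).re - (y 0).re * (x 1).re) * (hu - e3) +
          t * ((x 0).im * (y 1).re - (y 0).im * (x 1).re) * (hv - e4) +
          t * ((x 0).re * (y 1).im - (y 0).re * (x 1).im) * ha +
          t * ((x 0).im * (y 1).im - (y 0).im * (x 1).im) * hb
  · intro hM0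
    have hχ' : a * v - b * u ≠ 0 := by
      intro h3
      refine mul_ne_zero hM0 hpos ?_
      rw [hM, e1, e2]
      linear_combination ν * h3
    set t := -(a * v - b * u) / 2 with ht
    have ht0 : t ≠ 0 := div_ne_zero (neg_ne_zero.2 hχ') two_ne_zero
    have hτ : a * v - b * u = -2 * t := by rw [ht]; ring
    refine hasModel
      ![a, u, t, 0, t / ν * l, t * -m] ![b, v, 0, t, t / ν * m, t * l]
      ![0, 0, 1, 1, 2, 2] (0, 1) (2, 3) (4, 5) ⟨rfl, rfl, hχ'⟩ ⟨rfl, rfl, ?_⟩ ⟨rfl, rfl, ?_⟩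
      fun x y k => ?_
    · simpa using ht0
    · change t / ν * l * (t * l) - t / ν * m * (t * -m) ≠ 0
      have : t / ν * l * (t * l) - t / ν * m * (t * -m) = t * (t / ν) * (l ^ 2 + m ^ 2) := by ring
      rw [this]
      exact mul_ne_zero (mul_ne_zero ht0 (div_ne_zero ht0 hν0)) hpos
    · rw [nilBracket_eleven]
      fin_cases k
      · simp [bracket_zero']
      · simp [bracket_zero']
      · simp [h.bracket_one']
      · simp [h.bracket_one', realCoord_apply]
        linear_combination ((x 0).re * (y 0).im - (y 0).re * (x 0).im) * hτ
      · simp [h.bracket_two', realCoord_apply]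
        field_simp
        linear_combination
          ((x 0).re * (y 1).re - (y 0).re * (x 1).re) * (hn₁ - e1) +
          ((x 0).im * (y 1).re - (y 0).im * (x 1).re) * (hn₂ - e2) -
          ((x 0).re * (y 1).im - (y 0).re * (x 1).im) * h1 -
          ((x 0).im * (y 1).im - (y 0).im * (x 1).im) * h2
      · simp [h.bracket_two', realCoord_apply]
        linear_combination
          t * ((x 0).re * (y 1).re - (y 0).re * (x 1).re) * hu +
          t * ((x 0).im * (y 1).re - (y 0).im * (x 1).re) * hv +
          t * ((x 0).re * (y 1).im - (y 0).re * (x 1).im) * ha +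
          t * ((x 0).im * (y 1).im - (y 0).im * (x 1).im) * hb

theorem hasModel_seven (h : c.IsPencil M N) (hN : N = 0) (hM : M = (2 : ℝ) • 1) :
    c.HasModel 7 := by
  refine hasModel ![1, 0, 1, 0, 1 / 2, 0] ![0, 1, 0, -1 / 2, 0, 1 / 2]
    ![0, 0, 1, 1, 2, 2] (0, 1) (2, 3) (4, 5) ⟨rfl, rfl, ?_⟩ ⟨rfl, rfl, ?_⟩ ⟨rfl, rfl, ?_⟩
    fun x y k => ?_
  · simp
  · simp
  · simp
  · rw [nilBracket_seven]
    fin_cases k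
    · simp [bracket_zero']
    · simp [bracket_zero']
    · simp [h.bracket_one']
    · simp [h.bracket_one', realCoord_apply]
      ring
    · simp [h.bracket_two', realCoord_apply, hM, hN]
    · simp [h.bracket_two', realCoord_apply, hM, hN]

end IsPencil
end Constants

/-! ### The pencil belonging to the constants, and its degenerate cases. -/

namespace Constants

/-- The matrix of `z ↦ (ρ + B) z - C conj z`. -/
def matM (c : Constants) : Matrix (Fin 2) (Fin 2) ℝ :=
  !![c.ρ.re + c.B.re - c.C.re, -c.B.im - c.C.im; c.B.im - c.C.im, c.ρ.re + c.B.re + c.C.re]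

/-- The matrix of `z ↦ i ((ρ - B) z - C conj z)`. -/
def matN (c : Constants) : Matrix (Fin 2) (Fin 2) ℝ :=
  !![c.B.im + c.C.im, -(c.ρ.re - c.B.re + c.C.re); c.ρ.re - c.B.re - c.C.re, c.B.im - c.C.im]

variable {c : Constants}

/-- Substituting `ω² = p + iq` gives `dω³ = ((ρ + B) ω¹ - C conj ω¹) ∧ p + i ((ρ - B) ω¹ - C conj
ω¹) ∧ q` for real `ρ`. -/
theorem isPencil (hε : c.ε = 1) (hρ : c.ρ.im = 0) (hA : c.A = 0) (hD : c.D = 0) :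
    c.IsPencil c.matM c.matN where
  eps := hε
  re x y := by
    simp [form, hA, hD, matM, matN, hρ]
    ring
  im x y := by
    simp [form, hA, hD, matM, matN, hρ]
    ring

theorem det_matM (c : Constants) : c.matM.det =
    (c.ρ.re + c.B.re) ^ 2 + c.B.im ^ 2 - c.C.re ^ 2 - c.C.im ^ 2 := by
  rw [matM, Matrix.det_fin_two_of]; ring

theorem det_matN (c : Constants) : c.matN.det =
    (c.ρ.re - c.B.re) ^ 2 + c.B.im ^ 2 - c.C.re ^ 2 - c.C.im ^ 2 := by
  rw [matN, Matrix.det_fin_two_of]; ring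

theorem polarDet_mat (c : Constants) : polarDet c.matM c.matN = 4 * c.ρ.re * c.B.im := by
  simp [polarDet, matM, matN]; ring

theorem norm_sq_eq (z : ℂ) : ‖z‖ ^ 2 = z.re ^ 2 + z.im ^ 2 := by
  rw [Complex.sq_norm, Complex.normSq_apply]; ring

/-- This links the two halves of the table: the sign that governs `ε = 0` is also the discriminant
of the pencil. -/
theorem disc_mat (hρ : c.ρ.im = 0) (hA : c.A = 0) :
    disc c.matM c.matN = 16 * (‖c.Δ₁‖ ^ 2 - c.Δ₂ ^ 2) := by
  rw [disc, det_matM, det_matN, polarDet_mat, Δ₁, Δ₂, hA, zero_mul, zero_sub, norm_neg, norm_mul]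
  simp only [mul_pow, norm_sq_eq, hρ]
  simp
  ring

/-- For `ρ = 1` no real combination of `Re ω³` and `Im ω³` is closed: the term `ω¹ ∧ ω²` cannot
cancel in it. -/
theorem matM_null (hρ : c.ρ = 1) (l m : ℝ)
    (h1 : l * c.matN 0 0 + m * c.matN 1 0 = 0) (h2 : l * c.matN 0 1 + m * c.matN 1 1 = 0)
    (h3 : l * c.matM 0 0 + m * c.matM 1 0 = 0) (h4 : l * c.matM 0 1 + m * c.matM 1 1 = 0) :
    l = 0 ∧ m = 0 := by
  simp [matM, matN, hρ] at h1 h2 h3 h4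
  constructor
  · linear_combination (1 / 2) * h3 - (1 / 2) * h2
  · linear_combination (1 / 2) * h4 + (1 / 2) * h1

variable (hε : c.ε = 1) (hρ : c.ρ = 0 ∨ c.ρ = 1) (hA : c.A = 0) (hD : c.D = 0)

theorem rho_im (hρ : c.ρ = 0 ∨ c.ρ = 1) : c.ρ.im = 0 := by
  rcases hρ with h | h <;> simp [h]

include hε hρ hA hD

theorem hasModel_of_neg (hd : ‖c.Δ₁‖ ^ 2 - c.Δ₂ ^ 2 < 0) : c.HasModel 15 :=
  (isPencil hε (rho_im hρ) hA hD).hasModel_fifteen (by rw [disc_mat (rho_im hρ) hA]; linarith)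

theorem hasModel_of_pos (hd : 0 < ‖c.Δ₁‖ ^ 2 - c.Δ₂ ^ 2) :
    (c.matN.det = 0 → c.HasModel 12) ∧ (c.matN.det ≠ 0 → c.HasModel 13) :=
  ⟨fun h => (isPencil hε (rho_im hρ) hA hD).hasModel_twelve h
    (by rw [disc_mat (rho_im hρ) hA]; linarith),
  fun h => (isPencil hε (rho_im hρ) hA hD).hasModel_thirteen h
    (by rw [disc_mat (rho_im hρ) hA]; linarith)⟩

omit hρ in
-- For `C ≠ 0` the antilinear terms rule out both `N = 0` and `M = κN`. If `det N = 0`, the mixed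
-- coefficient shows that `B` is real, and `det M - det N = 4 Re B` is then nonzero.
theorem hasModel_of_zero (hρ : c.ρ = 1) (hB : c.B ≠ 0) (hC : c.C ≠ 0)
    (hd : ‖c.Δ₁‖ ^ 2 - c.Δ₂ ^ 2 = 0) :
    (c.matN.det = 0 → c.HasModel 11) ∧ (c.matN.det ≠ 0 → c.HasModel 14) := by
  have hp := isPencil hε (rho_im (Or.inr hρ)) hA hD
  have hdisc : disc c.matM c.matN = 0 := by
    rw [disc_mat (rho_im (Or.inr hρ)) hA, hd, mul_zero]
  constructor
  · intro hN
    have hT : polarDet c.matM c.matN = 0 := by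
      rw [disc, hN, mul_zero, sub_zero] at hdisc
      exact pow_eq_zero_iff two_ne_zero |>.1 hdisc
    refine (hp.hasModel_ten_or_eleven hN hT ?_ (matM_null hρ)).2 ?_
    · intro h0
      apply hC
      have e0 := congrFun (congrFun h0 0) 0
      have e1 := congrFun (congrFun h0 0) 1
      have e2 := congrFun (congrFun h0 1) 0
      have e3 := congrFun (congrFun h0 1) 1
      simp [matN] at e0 e1 e2 e3
      apply Complex.ext
      · simp; linarith
      · simp; linarith
    · rw [polarDet_mat, hρ] at hT
      rw [det_matN] at hN
      rw [det_matM]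
      rw [hρ] at hN ⊢
      simp at hT hN ⊢
      intro h0
      exact hB (Complex.ext (by simp; linarith) hT)
  · intro hN
    refine hp.hasModel_fourteen hN hdisc fun κ h0 => hC ?_
    have e0 := congrFun (congrFun h0 0) 0
    have e1 := congrFun (congrFun h0 0) 1
    have e2 := congrFun (congrFun h0 1) 0
    have e3 := congrFun (congrFun h0 1) 1
    simp [matN, matM] at e0 e1 e2 e3
    have k1 : c.C.re = -κ * c.C.im := by linarith
    have k2 : c.C.im = κ * c.C.re := by linarith
    have k3 : c.C.re = 0 := by
      refine (mul_eq_zero.1 (?_ : (1 + κ ^ 2) * c.C.re = 0)).resolve_left (by positivity)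
      linear_combination k1 - κ * k2
    exact Complex.ext k3 (by rw [k2, k3]; simp)

omit hρ in
-- For `ρ = 0` one has `N(z) = -M(iz)`, so both matrices have the same left null vectors, and the
-- determinant required by `IsPencil.hasModel_nine` is a sum of two squares.
theorem hasModel_nine (hρ : c.ρ = 0) (hB : c.B ≠ 0) (hBC : ‖c.B‖ = ‖c.C‖) : c.HasModel 9 := by
  have hp := isPencil hε (rho_im (Or.inl hρ)) hA hD
  have hnorm : c.B.re ^ 2 + c.B.im ^ 2 = c.C.re ^ 2 + c.C.im ^ 2 := by
    rw [← norm_sq_eq, ← norm_sq_eq, hBC]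
  have hN : c.matN.det = 0 := by
    rw [det_matN, hρ]
    simp
    linarith
  have hN0 : c.matN ≠ 0 := by
    intro h0
    apply hB
    have e0 := congrFun (congrFun h0 0) 0
    have e1 := congrFun (congrFun h0 0) 1
    have e2 := congrFun (congrFun h0 1) 0
    have e3 := congrFun (congrFun h0 1) 1
    simp [matN, hρ] at e0 e1 e2 e3
    apply Complex.ext
    · simp; linarith
    · simp; linarith
  obtain ⟨l, m, hpos, h1, h2, h0⟩ := IsPencil.exists_null hN hN0
  refine hp.hasModel_nine hpos h1 h2 ?_ ?_ ?_
  · simp [matM, matN, hρ] at h1 h2 ⊢; linarith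
  · simp [matM, matN, hρ] at h1 h2 ⊢; linarith
  · have e : (-m * c.matM 0 0 + l * c.matM 1 0) * (-m * c.matN 0 1 + l * c.matN 1 1) -
        (-m * c.matM 0 1 + l * c.matM 1 1) * (-m * c.matN 0 0 + l * c.matN 1 0) =
        (-m * c.matN 0 0 + l * c.matN 1 0) ^ 2 + (-m * c.matN 0 1 + l * c.matN 1 1) ^ 2 := by
      simp [matM, matN, hρ]; ring
    rw [e]
    intro h3
    exact h0 ⟨by nlinarith, by nlinarith⟩

omit hρ in
theorem hasModel_ten (hρ : c.ρ = 1) (hB : c.B = 0) (hC : ‖c.C‖ = 1) : c.HasModel 10 := by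
  have hp := isPencil hε (rho_im (Or.inr hρ)) hA hD
  have hnorm : c.C.re ^ 2 + c.C.im ^ 2 = 1 := by rw [← norm_sq_eq, hC, one_pow]
  refine (hp.hasModel_ten_or_eleven ?_ ?_ ?_ (matM_null hρ)).1 ?_
  · rw [det_matN, hρ, hB]; simp; linarith
  · rw [polarDet_mat, hB]; simp
  · intro h0
    have e0 := congrFun (congrFun h0 0) 0
    have e1 := congrFun (congrFun h0 0) 1
    have e2 := congrFun (congrFun h0 1) 0
    simp [matN, hρ, hB] at e0 e1 e2
    linarith
  · rw [det_matM, hρ, hB]; simp; linarith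

omit hρ in
theorem hasModel_seven (hρ : c.ρ = 1) (hB : c.B = 1) (hC : c.C = 0) : c.HasModel 7 := by
  refine (isPencil hε (rho_im (Or.inr hρ)) hA hD).hasModel_seven ?_ ?_
  · ext i j
    fin_cases i <;> fin_cases j <;> simp [matN, hρ, hB, hC]
  · ext i j
    fin_cases i <;> fin_cases j <;> simp [matM, hρ, hB, hC] <;> norm_num

omit hρ in
-- For `C = 0` the matrices are multiplication by `1 + B` and by `i (1 - B)`. When `|B| = 1` their
-- quotient, a Cayley transform, is the real number `κ`.
theorem hasModel_sixteen (hρ : c.ρ = 1) (hB : c.B ≠ 1) (hB' : ‖c.B‖ = 1) (hC : c.C = 0) :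
    c.HasModel 16 := by
  have hnorm : c.B.re ^ 2 + c.B.im ^ 2 = 1 := by rw [← norm_sq_eq, hB', one_pow]
  have hre : 1 - c.B.re ≠ 0 := by
    intro h0
    have h1 : c.B.re = 1 := by linarith
    rw [h1] at hnorm
    exact hB (Complex.ext h1 (by simp; nlinarith))
  refine (isPencil hε (rho_im (Or.inr hρ)) hA hD).hasModel_sixteen ?_
    (κ := c.B.im / (1 - c.B.re)) ?_
  · rw [det_matN, hρ, hC]
    simp
    intro h0
    exact hre (by nlinarith)
  · ext i j
    fin_cases i <;> fin_cases j <;> simp [matM, matN, hρ, hC] <;> field_simp <;> nlinarith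

end Constants

/-! ### Coordinates on the complexification and on `f^1` -/

/-- The bracket of `h_n ⊗ ℂ`. -/
def nilBracketC (n : ℕ) (x y : Fin 6 → ℂ) : Fin 6 → ℂ := fun k =>
  -((structureEqs n k).map fun p => x p.1 * y p.2 - y p.1 * x p.2).sum

theorem nilBracketC_add_left (n : ℕ) (x y z : Fin 6 → ℂ) :
    nilBracketC n (x + y) z = nilBracketC n x z + nilBracketC n y z := by
  funext k
  simp only [nilBracketC, Pi.add_apply]
  induction structureEqs n k with
  | nil => simp
  | cons p l ih => simp only [List.map_cons, List.sum_cons]; linear_combination ih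

theorem nilBracketC_add_right (n : ℕ) (x y z : Fin 6 → ℂ) :
    nilBracketC n x (y + z) = nilBracketC n x y + nilBracketC n x z := by
  funext k
  simp only [nilBracketC, Pi.add_apply]
  induction structureEqs n k with
  | nil => simp
  | cons p l ih => simp only [List.map_cons, List.sum_cons]; linear_combination ih

theorem nilBracketC_smul (n : ℕ) (s t : ℂ) (x y : Fin 6 → ℝ) :
    nilBracketC n (fun k => x k • s) (fun k => y k • t) =
      fun k => nilBracket n x y k • (s * t) := by
  funext k
  simp only [nilBracketC, nilBracket]
  induction structureEqs n k with
  | nil => simp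
  | cons p l ih =>
    simp only [List.map_cons, List.sum_cons, Complex.real_smul] at ih ⊢
    push_cast at ih ⊢
    linear_combination ih

/-- Coordinates on `h_n ⊗ ℂ`. -/
def nilCoord (n : ℕ) : ℂ ⊗[ℝ] NilAlg n ≃ₗ[ℂ] (Fin 6 → ℂ) :=
  TensorProduct.piScalarRight ℝ ℂ ℂ (Fin 6)

theorem nilCoord_tmul (n : ℕ) (s : ℂ) (x : NilAlg n) :
    nilCoord n (s ⊗ₜ x) = fun k => (show Fin 6 → ℝ from x) k • s :=
  TensorProduct.piScalarRightHom_tmul ..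

theorem cx_lie_add {g : Type*} [LieRing g] [LieAlgebra ℝ g] (a b c : Cx g) :
    ⁅a, b + c⁆ = ⁅a, b⁆ + ⁅a, c⁆ := LieRing.lie_add a b c

theorem cx_lie_zero {g : Type*} [LieRing g] [LieAlgebra ℝ g] (a : Cx g) :
    ⁅a, (0 : Cx g)⁆ = 0 := by
  have h := cx_lie_add a 0 0
  rw [add_zero] at h
  exact left_eq_add.mp h

theorem nilCoord_lie (n : ℕ) (x y : ℂ ⊗[ℝ] NilAlg n) :
    nilCoord n ⁅x, y⁆ = nilBracketC n (nilCoord n x) (nilCoord n y) := by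
  have h0l (z : Fin 6 → ℂ) : nilBracketC n 0 z = 0 := by
    have := nilBracketC_add_left n 0 0 z
    rw [add_zero] at this
    exact left_eq_add.mp this
  have h0r (z : Fin 6 → ℂ) : nilBracketC n z 0 = 0 := by
    have := nilBracketC_add_right n z 0 0
    rw [add_zero] at this
    exact left_eq_add.mp this
  induction x using TensorProduct.induction_on with
  | zero => rw [zero_lie, map_zero, h0l]
  | add a b ha hb => rw [add_lie, map_add, map_add, nilBracketC_add_left, ha, hb]
  | tmul s a =>
    induction y using TensorProduct.induction_on with
    | zero => rw [cx_lie_zero, map_zero, h0r]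
    | add c d hc hd => rw [cx_lie_add, map_add, map_add, nilBracketC_add_right, hc, hd]
    | tmul t b =>
      rw [LieAlgebra.ExtendScalars.bracket_tmul, nilCoord_tmul, nilCoord_tmul, nilCoord_tmul,
        nilBracketC_smul]
      rfl

namespace Constants

/-- The complex bilinear extension of the bracket: `x'` and `y'` stand for the conjugates of `x`
and `y`. -/
def bracketC (c : Constants) (x x' y y' : Fin 3 → ℂ) : Fin 3 → ℂ :=
  ![0, -(c.ε * (x 0 * y' 0 - y 0 * x' 0)),
    -(c.ρ * (x 0 * y 1 - y 0 * x 1) + c.A * (x 0 * y' 0 - y 0 * x' 0) +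
      c.B * (x 0 * y' 1 - y 0 * x' 1) + c.C * (x 1 * y' 0 - y 1 * x' 0) +
      c.D * (x 1 * y' 1 - y 1 * x' 1))]

/-- The complex conjugate constants. -/
def bar (c : Constants) : Constants :=
  ⟨conj c.ε, conj c.ρ, conj c.A, conj c.B, conj c.C, conj c.D⟩

/-- The bracket of `f^1`, in the coordinates dual to `ω^j` on `g^{1,0}` and to the conjugates of
`ω^j` on `g^{*(0,1)}`. -/
def courantBracket (c : Constants) (v w : Fin 6 → ℂ) : Fin 6 → ℂ :=
  ![0, 0, -(c.ρ * (v 0 * w 1 - w 0 * v 1)),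
    -(conj c.ε * (v 0 * w 4 - w 0 * v 4) + conj c.A * (v 0 * w 5 - w 0 * v 5) +
      conj c.B * (v 1 * w 5 - w 1 * v 5)),
    -(conj c.C * (v 0 * w 5 - w 0 * v 5) + conj c.D * (v 1 * w 5 - w 1 * v 5)), 0]

/-- The algebra `f^1` has a basis of 1-forms with the structure equations of `h_n`. -/
def HasComplexModel (c : Constants) (n : ℕ) : Prop :=
  ∃ e : Fin 6 → (Fin 6 → ℂ) →ₗ[ℂ] ℂ, (∀ x, (∀ k, e k x = 0) → x = 0) ∧
    ∀ x y k, e k (c.courantBracket x y) = nilBracketC n (fun i => e i x) (fun i => e i y) k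

theorem bracketC_add_left (c : Constants) (x x' y y' z z' : Fin 3 → ℂ) :
    c.bracketC (x + y) (x' + y') z z' = c.bracketC x x' z z' + c.bracketC y y' z z' := by
  funext k
  fin_cases k <;> simp [bracketC] <;> ring

theorem bracketC_add_right (c : Constants) (x x' y y' z z' : Fin 3 → ℂ) :
    c.bracketC z z' (x + y) (x' + y') = c.bracketC z z' x x' + c.bracketC z z' y y' := by
  funext k
  fin_cases k <;> simp [bracketC] <;> ring

theorem bracketC_smul (c : Constants) (s t : ℂ) (x x' y y' : Fin 3 → ℂ) :
    c.bracketC (s • x) (s • x') (t • y) (t • y') = (s * t) • c.bracketC x x' y y' := by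
  funext k
  fin_cases k <;> simp [bracketC] <;> ring

end Constants

section Coordinates

variable {g : Type*} [LieRing g] [LieAlgebra ℝ g] {J : g →ₗ[ℝ] g}
  {ω : Module.Basis (Fin 3) ℂ (forms10 J)} {c : Constants}

/-- Complex linear extension of the coordinates given by `ω`. -/
def coordC (ω : Module.Basis (Fin 3) ℂ (forms10 J)) : Cx g →ₗ[ℂ] (Fin 3 → ℂ) :=
  LinearMap.liftBaseChange ℂ (coord ω)

/-- Complex linear extension of the conjugate coordinates. -/
def coordBar (ω : Module.Basis (Fin 3) ℂ (forms10 J)) : Cx g →ₗ[ℂ] (Fin 3 → ℂ) :=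
  LinearMap.liftBaseChange ℂ (LinearMap.pi fun i => conjForm (ω i : g →ₗ[ℝ] ℂ))

theorem coordC_tmul (s : ℂ) (x : g) : coordC ω (s ⊗ₜ x) = s • coord ω x :=
  LinearMap.liftBaseChange_tmul ..

theorem coordBar_tmul (s : ℂ) (x : g) :
    coordBar ω (s ⊗ₜ x) = s • fun i => conj (coord ω x i) :=
  LinearMap.liftBaseChange_tmul ..

theorem coordC_JC (z : Cx g) : coordC ω (JC J z) = Complex.I • coordC ω z := by
  induction z using TensorProduct.induction_on with
  | zero => simp
  | add a b ha hb => rw [map_add, map_add, map_add, smul_add, ha, hb]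
  | tmul s a => rw [LinearMap.baseChange_tmul, coordC_tmul, coordC_tmul, coord_J, smul_comm]

theorem coordBar_JC (z : Cx g) : coordBar ω (JC J z) = -Complex.I • coordBar ω z := by
  induction z using TensorProduct.induction_on with
  | zero => simp
  | add a b ha hb => rw [map_add, map_add, map_add, smul_add, ha, hb]
  | tmul s a =>
    rw [LinearMap.baseChange_tmul, coordBar_tmul, coordBar_tmul, coord_J]
    funext i
    simp
    ring

/-- The vector of `g_ℂ` of type `(0,1)` with `coordBar ω` equal to the `j`-th unit vector. -/
def unitBar (ω : Module.Basis (Fin 3) ℂ (forms10 J)) (j : Fin 3) : Cx g :=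
  (1 / 2 : ℂ) ⊗ₜ Function.surjInv (coord_surjective ω) (Pi.single j 1) +
    (Complex.I / 2) ⊗ₜ J (Function.surjInv (coord_surjective ω) (Pi.single j 1))

theorem coordC_unitBar (j : Fin 3) : coordC ω (unitBar ω j) = 0 := by
  rw [unitBar, map_add, coordC_tmul, coordC_tmul, coord_J, Function.surjInv_eq (coord_surjective ω), smul_smul,
    ← add_smul]
  convert zero_smul ℂ _
  linear_combination Complex.I_mul_I / 2

theorem coordBar_unitBar (j : Fin 3) : coordBar ω (unitBar ω j) = Pi.single j 1 := by
  rw [unitBar, map_add, coordBar_tmul, coordBar_tmul, coord_J, Function.surjInv_eq (coord_surjective ω)]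
  funext i
  obtain rfl | h := eq_or_ne i j
  · simp
    linear_combination -Complex.I_mul_I / 2
  · simp [h]

theorem sum_coordBar (z : Cx g) :
    coordBar ω (∑ j, coordBar ω z j • unitBar ω j) = coordBar ω z := by
  simp only [map_sum, map_smul, coordBar_unitBar]
  funext i
  simp [Finset.sum_apply, Pi.single_apply]

/-- The witness is the `(1,0)` part `(x - iJx)/2` of a real vector `x` with the given coordinates.
-/
theorem coordC_surjective (v : Fin 3 → ℂ) : ∃ z : Cx g, coordC ω z = v ∧ coordBar ω z = 0 := by
  obtain ⟨x, rfl⟩ := coord_surjective ω v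
  refine ⟨(1 / 2 : ℂ) ⊗ₜ x - (Complex.I / 2) ⊗ₜ J x, ?_, ?_⟩
  · rw [map_sub, coordC_tmul, coordC_tmul, coord_J, smul_smul, ← sub_smul]
    convert one_smul ℂ _
    linear_combination -Complex.I_mul_I / 2
  · rw [map_sub, coordBar_tmul, coordBar_tmul, coord_J]
    funext i
    simp
    linear_combination (conj (coord ω x i) / 2) * Complex.I_mul_I

theorem coordC_coordBar_injective (hJ : ∀ x, J (J x) = -x) :
    Function.Injective ((coordC ω).prod (coordBar ω)) := by
  have e := LinearEquiv.ofBijective _ (coord_bijective hJ ω)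
  have hfin : Module.Finite ℝ g := Module.Finite.equiv e.symm
  have hd : Module.finrank ℂ (Cx g) = Module.finrank ℂ ((Fin 3 → ℂ) × (Fin 3 → ℂ)) := by
    rw [Module.finrank_baseChange, e.finrank_eq, Module.finrank_pi_fintype]
    simp
  rw [LinearMap.injective_iff_surjective_of_finrank_eq_finrank hd]
  rintro ⟨p, q⟩
  obtain ⟨z, hz, hz'⟩ := coordC_surjective (ω := ω) p
  refine ⟨z + ∑ j, q j • unitBar ω j, ?_⟩
  change (coordC ω _, coordBar ω _) = _
  simp only [map_add, map_sum, map_smul, coordC_unitBar, coordBar_unitBar, hz, hz']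
  refine Prod.ext (by simp) (funext fun i => ?_)
  simp [Finset.sum_apply, Pi.single_apply]

/-- `coordBar` turns `J` into multiplication by `-i`, hence kills the `i`-eigenspace. Conversely,
both coordinate maps detect that `J` is `i` where `coordBar` vanishes. -/
theorem JC_eq_iff (hJ : ∀ x, J (J x) = -x) (z : Cx g) :
    JC J z = Complex.I • z ↔ coordBar ω z = 0 := by
  constructor
  · intro h
    have h1 := coordBar_JC (ω := ω) z
    rw [h, map_smul, ← sub_eq_zero, ← sub_smul] at h1
    refine (smul_eq_zero.1 h1).resolve_left ?_
    simp [Complex.ext_iff]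
  · intro h
    apply coordC_coordBar_injective hJ (ω := ω)
    change (coordC ω _, coordBar ω _) = (coordC ω _, coordBar ω _)
    rw [coordC_JC, coordBar_JC, map_smul, map_smul, h, smul_zero, smul_zero]

theorem IsReduced.coordC_lie (h : IsReduced ω c) (x y : Cx g) :
    coordC ω ⁅x, y⁆ = c.bracketC (coordC ω x) (coordBar ω x) (coordC ω y) (coordBar ω y) := by
  induction x using TensorProduct.induction_on with
  | zero =>
    rw [zero_lie]
    funext k
    fin_cases k <;> simp [Constants.bracketC]
  | add a b ha hb => simp only [add_lie, map_add, Constants.bracketC_add_left, ha, hb]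
  | tmul s a =>
    induction y using TensorProduct.induction_on with
    | zero =>
      rw [cx_lie_zero]
      funext k
      fin_cases k <;> simp [Constants.bracketC]
    | add p q hp hq => simp only [cx_lie_add, map_add, Constants.bracketC_add_right, hp, hq]
    | tmul t b =>
      rw [LieAlgebra.ExtendScalars.bracket_tmul, coordC_tmul, coordC_tmul, coordC_tmul,
        coordBar_tmul, coordBar_tmul, Constants.bracketC_smul, h.coord_lie]
      rfl

theorem IsReduced.coordBar_lie (h : IsReduced ω c) (x y : Cx g) :
    coordBar ω ⁅x, y⁆ =
      c.bar.bracketC (coordBar ω x) (coordC ω x) (coordBar ω y) (coordC ω y) := by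
  induction x using TensorProduct.induction_on with
  | zero =>
    rw [zero_lie]
    funext k
    fin_cases k <;> simp [Constants.bracketC]
  | add a b ha hb => simp only [add_lie, map_add, Constants.bracketC_add_left, ha, hb]
  | tmul s a =>
    induction y using TensorProduct.induction_on with
    | zero =>
      rw [cx_lie_zero]
      funext k
      fin_cases k <;> simp [Constants.bracketC]
    | add p q hp hq => simp only [cx_lie_add, map_add, Constants.bracketC_add_right, hp, hq]
    | tmul t b =>
      rw [LieAlgebra.ExtendScalars.bracket_tmul, coordC_tmul, coordC_tmul, coordBar_tmul,
        coordBar_tmul, coordBar_tmul, Constants.bracketC_smul, h.coord_lie]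
      congr 1
      funext k
      fin_cases k <;> simp [Constants.bracketC, Constants.bar, Constants.form]

variable {hJ : IsComplexStructure J}

/-- Subtracting its `(0,1)` components from `z` leaves a vector of type `(1,0)`, on which the form
vanishes. -/
theorem f1_snd_apply (u : f1 J hJ) (z : Cx g) :
    u.1.2 z = ∑ j, coordBar ω z j * u.1.2 (unitBar ω j) := by
  have h1 : u.1.2 (z - ∑ j, coordBar ω z j • unitBar ω j) = 0 := by
    apply u.2.2
    rw [JC_eq_iff (ω := ω) hJ.sq, map_sub, sum_coordBar, sub_self]
  rw [map_sub, sub_eq_zero] at h1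
  rw [h1]
  simp [map_sum]

/-- Coordinates on `f^1`. -/
def f1Coord (hJ : IsComplexStructure J) (ω : Module.Basis (Fin 3) ℂ (forms10 J)) :
    f1 J hJ →ₗ[ℂ] (Fin 6 → ℂ) where
  toFun u := ![coordC ω u.1.1 0, coordC ω u.1.1 1, coordC ω u.1.1 2,
    u.1.2 (unitBar ω 0), u.1.2 (unitBar ω 1), u.1.2 (unitBar ω 2)]
  map_add' u v := by
    funext k
    have h1 : ((u + v : f1 J hJ) : Courant (Cx g)).1 = u.1.1 + v.1.1 := rfl
    have h2 (z) : ((u + v : f1 J hJ) : Courant (Cx g)).2 z = u.1.2 z + v.1.2 z := rfl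
    simp only [h1, h2]
    fin_cases k <;> simp
  map_smul' s u := by
    funext k
    have h1 : ((s • u : f1 J hJ) : Courant (Cx g)).1 = s • u.1.1 := rfl
    have h2 (z) : ((s • u : f1 J hJ) : Courant (Cx g)).2 z = s * u.1.2 z := rfl
    simp only [h1, h2]
    fin_cases k <;> simp

theorem f1Coord_injective : Function.Injective (f1Coord hJ ω) := by
  rw [injective_iff_map_eq_zero]
  intro u hu
  have hq : coordBar ω u.1.1 = 0 := (JC_eq_iff hJ.sq _).1 u.2.1
  have hp : coordC ω u.1.1 = 0 := by
    funext k
    fin_cases k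
    · exact congrFun hu 0
    · exact congrFun hu 1
    · exact congrFun hu 2
  apply Subtype.ext
  refine courant_ext ?_ fun z => ?_
  · apply coordC_coordBar_injective hJ.sq (ω := ω)
    change (coordC ω _, coordBar ω _) = (coordC ω 0, coordBar ω 0)
    rw [hp, hq, map_zero, map_zero]
  · rw [f1_snd_apply (ω := ω), Fin.sum_univ_three]
    have h0 : u.1.2 (unitBar ω 0) = 0 := congrFun hu 3
    have h1 : u.1.2 (unitBar ω 1) = 0 := congrFun hu 4
    have h2 : u.1.2 (unitBar ω 2) = 0 := congrFun hu 5
    rw [h0, h1, h2]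
    simp [courant_zero_snd]

theorem f1Coord_surjective : Function.Surjective (f1Coord hJ ω) := by
  intro v
  obtain ⟨z, hz, hz'⟩ := coordC_surjective (ω := ω) ![v 0, v 1, v 2]
  let α : Module.Dual ℂ (Cx g) :=
    ∑ j, ![v 3, v 4, v 5] j • (LinearMap.proj j ∘ₗ coordBar ω)
  have hα (y : Cx g) : α y = ∑ j, ![v 3, v 4, v 5] j * coordBar ω y j := by
    simp [α, LinearMap.sum_apply]
  refine ⟨⟨(z, α), (JC_eq_iff (ω := ω) hJ.sq _).2 hz', fun y hy => ?_⟩, ?_⟩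
  · change α y = 0
    rw [hα, (JC_eq_iff hJ.sq _).1 hy]
    simp
  · change ![coordC ω z 0, coordC ω z 1, coordC ω z 2, α (unitBar ω 0), α (unitBar ω 1),
      α (unitBar ω 2)] = v
    rw [hz, hα, hα, hα, coordBar_unitBar, coordBar_unitBar, coordBar_unitBar]
    funext k
    fin_cases k <;> simp [Fin.sum_univ_three]

/-- On vectors of type `(1,0)` only the `ρ` term of the bracket survives. The action on forms is
read off from the `(0,1)` part of brackets of `(1,0)` with `(0,1)` vectors, which is where the
conjugate constants enter. -/
theorem IsReduced.f1Coord_lie (h : IsReduced ω c) (u v : f1 J hJ) :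
    f1Coord hJ ω ⁅u, v⁆ = c.courantBracket (f1Coord hJ ω u) (f1Coord hJ ω v) := by
  have hu : coordBar ω u.1.1 = 0 := (JC_eq_iff hJ.sq _).1 u.2.1
  have hv : coordBar ω v.1.1 = 0 := (JC_eq_iff hJ.sq _).1 v.2.1
  have h1 : (⁅u, v⁆ : f1 J hJ).1.1 = ⁅u.1.1, v.1.1⁆ := rfl
  have h2 (z) : (⁅u, v⁆ : f1 J hJ).1.2 z = -v.1.2 ⁅u.1.1, z⁆ + u.1.2 ⁅v.1.1, z⁆ :=
    courant_snd u.1 v.1 z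
  have h3 (j : Fin 3) : (⁅u, v⁆ : f1 J hJ).1.2 (unitBar ω j) = _ :=
    (h2 _).trans (congrArg₂ (fun a b => -a + b)
      (f1_snd_apply (ω := ω) v _) (f1_snd_apply (ω := ω) u _))
  simp only [h.coordBar_lie, hu, hv, coordC_unitBar, coordBar_unitBar, Fin.sum_univ_three] at h3
  funext k
  change ![coordC ω (⁅u, v⁆ : f1 J hJ).1.1 0, coordC ω (⁅u, v⁆ : f1 J hJ).1.1 1,
    coordC ω (⁅u, v⁆ : f1 J hJ).1.1 2,
    (⁅u, v⁆ : f1 J hJ).1.2 (unitBar ω 0), (⁅u, v⁆ : f1 J hJ).1.2 (unitBar ω 1),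
    (⁅u, v⁆ : f1 J hJ).1.2 (unitBar ω 2)] k = _
  rw [h1, h.coordC_lie, hu, hv, h3, h3, h3]
  fin_cases k <;>
    simp [Constants.bracketC, Constants.courantBracket, Constants.bar, f1Coord] <;> ring

theorem IsReduced.nonempty_f1_lieEquiv (h : IsReduced ω c) {n : ℕ} (hc : c.HasComplexModel n) :
    Nonempty (f1 J hJ ≃ₗ⁅ℂ⁆ ℂ ⊗[ℝ] NilAlg n) := by
  obtain ⟨e, he, hb⟩ := hc
  have hinj : Function.Injective (LinearMap.pi e) := by
    rw [injective_iff_map_eq_zero]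
    exact fun x hx => he x fun k => congrFun hx k
  let ψ : (Fin 6 → ℂ) ≃ₗ[ℂ] (Fin 6 → ℂ) := LinearEquiv.ofInjectiveOfFinrankEq _ hinj rfl
  let φ := ((LinearEquiv.ofBijective (f1Coord hJ ω) ⟨f1Coord_injective, f1Coord_surjective⟩).trans
    ψ).trans (nilCoord n).symm
  have hφ (x y : f1 J hJ) : φ ⁅x, y⁆ = ⁅φ x, φ y⁆ := by
    apply (nilCoord n).injective
    rw [nilCoord_lie]
    change nilCoord n ((nilCoord n).symm (ψ (f1Coord hJ ω ⁅x, y⁆))) =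
      nilBracketC n (nilCoord n ((nilCoord n).symm (ψ (f1Coord hJ ω x))))
        (nilCoord n ((nilCoord n).symm (ψ (f1Coord hJ ω y))))
    simp only [LinearEquiv.apply_symm_apply, h.f1Coord_lie]
    funext k
    exact hb _ _ k
  exact ⟨{ φ with map_lie' := hφ _ _ }⟩

end Coordinates

/-! ### The structure of `f^1` -/

namespace Constants

variable {c : Constants}

/-- The linear form with coefficients `a`. -/
def rowForm (a : Fin 6 → ℂ) : (Fin 6 → ℂ) →ₗ[ℂ] ℂ where
  toFun x := a 0 * x 0 + a 1 * x 1 + a 2 * x 2 + a 3 * x 3 + a 4 * x 4 + a 5 * x 5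
  map_add' x y := by simp only [Pi.add_apply]; ring
  map_smul' t x := by simp only [Pi.smul_apply, smul_eq_mul, RingHom.id_apply]; ring

theorem rowForm_apply (a x : Fin 6 → ℂ) : rowForm a x =
    a 0 * x 0 + a 1 * x 1 + a 2 * x 2 + a 3 * x 3 + a 4 * x 4 + a 5 * x 5 := rfl

theorem eq_zero_of_comb {p q p' q' s t : ℂ} (h : p * q' - q * p' ≠ 0) (h1 : p * s + q * t = 0)
    (h2 : p' * s + q' * t = 0) : s = 0 ∧ t = 0 := by
  constructor
  · refine (mul_eq_zero.1 (?_ : (p * q' - q * p') * s = 0)).resolve_left h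
    linear_combination q' * h1 - q * h2
  · refine (mul_eq_zero.1 (?_ : (p * q' - q * p') * t = 0)).resolve_left h
    linear_combination p * h2 - p' * h1

theorem ext_six {x : Fin 6 → ℂ} (h01 : x 0 = 0 ∧ x 1 = 0) (h2 : x 2 = 0)
    (h34 : x 3 = 0 ∧ x 4 = 0) (h5 : x 5 = 0) : x = 0 := by
  funext k
  fin_cases k
  exacts [h01.1, h01.2, h2, h34.1, h34.2, h5]

theorem hasComplexModel_of {n : ℕ} (M : Fin 6 → Fin 6 → ℂ)
    (h0 : ∀ x, (∀ k, rowForm (M k) x = 0) → x = 0)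
    (h : ∀ x y k, rowForm (M k) (c.courantBracket x y) =
      nilBracketC n (fun i => rowForm (M i) x) (fun i => rowForm (M i) y) k) :
    c.HasComplexModel n := ⟨fun k => rowForm (M k), h0, h⟩

theorem hasComplexModel_one (hε : c.ε = 0) (hρ : c.ρ = 0) (hX : c.X = 0) :
    c.HasComplexModel 1 := by
  have hA : c.A = 0 := congrFun₂ hX 0 0
  have hB : c.B = 0 := congrFun₂ hX 0 1
  have hC : c.C = 0 := congrFun₂ hX 1 0
  have hD : c.D = 0 := congrFun₂ hX 1 1
  refine ⟨fun k => LinearMap.proj k, fun x hx => funext hx, fun x y k => ?_⟩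
  fin_cases k <;>
    simp [courantBracket, nilBracketC, structureEqs, hε, hρ, hA, hB, hC, hD]

/-- For `ε = ρ = 0` the only nonzero differentials are the two entries of `conj X` applied to the
first two coordinates, wedged with the sixth. Rank two gives two products with a common factor. -/
theorem hasComplexModel_six_of_rank_two (hε : c.ε = 0) (hρ : c.ρ = 0) (h1 : c.Δ₁ ≠ 0) :
    c.HasComplexModel 6 := by
  have h1' : conj c.A * conj c.D - conj c.B * conj c.C ≠ 0 := by
    rw [← map_mul, ← map_mul, ← map_sub]
    exact (map_ne_zero (starRingEnd ℂ)).2 h1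
  refine hasComplexModel_of ![![0, 0, 0, 0, 0, 1], ![-conj c.A, -conj c.B, 0, 0, 0, 0],
    ![-conj c.C, -conj c.D, 0, 0, 0, 0], ![0, 0, 1, 0, 0, 0], ![0, 0, 0, 1, 0, 0],
    ![0, 0, 0, 0, 1, 0]] (fun x hx => ?_) (fun x y k => ?_)
  · have e0 := hx 0; have e1 := hx 1; have e2 := hx 2
    have e3 := hx 3; have e4 := hx 4; have e5 := hx 5
    simp [rowForm_apply] at e0 e1 e2 e3 e4 e5
    refine ext_six (eq_zero_of_comb h1' ?_ ?_) e3 ⟨e4, e5⟩ e0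
    · linear_combination -e1
    · linear_combination -e2
  · fin_cases k <;>
      simp [courantBracket, nilBracketC, structureEqs, rowForm_apply, hε, hρ] <;> ring

theorem hasComplexModel_seven (hε : c.ε = 0) (hρ : c.ρ = 1) (h1 : c.Δ₁ ≠ 0) :
    c.HasComplexModel 7 := by
  have h1' : conj c.A * conj c.D - conj c.B * conj c.C ≠ 0 := by
    rw [← map_mul, ← map_mul, ← map_sub]
    exact (map_ne_zero (starRingEnd ℂ)).2 h1
  refine hasComplexModel_of ![![conj c.A, conj c.B, 0, 0, 0, 0],
    ![conj c.C, conj c.D, 0, 0, 0, 0], ![0, 0, 0, 0, 0, 1],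
    ![0, 0, conj c.A * conj c.D - conj c.B * conj c.C, 0, 0, 0], ![0, 0, 0, 1, 0, 0],
    ![0, 0, 0, 0, 1, 0]] (fun x hx => ?_) (fun x y k => ?_)
  · have e0 := hx 0; have e1 := hx 1; have e2 := hx 2
    have e3 := hx 3; have e4 := hx 4; have e5 := hx 5
    simp only [rowForm_apply] at e0 e1 e2 e3 e4 e5
    simp at e0 e1 e2 e3 e4 e5
    exact ext_six (eq_zero_of_comb h1' e0 e1) (e3.resolve_left h1') ⟨e4, e5⟩ e2
  · fin_cases k <;>
      simp [courantBracket, nilBracketC, structureEqs, rowForm_apply, hε, hρ] <;> ring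

theorem exists_coeff_of_rank_one (h1 : c.Δ₁ = 0) (hX : c.X ≠ 0) : ∃ u₁ u₂ v₁ v₂ : ℂ,
    c.A = u₁ * v₁ ∧ c.B = u₁ * v₂ ∧ c.C = u₂ * v₁ ∧ c.D = u₂ * v₂ ∧
    u₁ * conj u₁ + u₂ * conj u₂ ≠ 0 ∧ v₁ * conj v₁ + v₂ * conj v₂ ≠ 0 := by
  obtain ⟨u₁, u₂, v₁, v₂, hA, hB, hC, hD⟩ := exists_coeff_eq_mul h1
  have key (s t : ℂ) (h : s * conj s + t * conj t = 0) : s = 0 ∧ t = 0 := by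
    rw [Complex.mul_conj', Complex.mul_conj'] at h
    have h' : ‖s‖ ^ 2 + ‖t‖ ^ 2 = 0 := by exact_mod_cast h
    constructor <;> rw [← norm_eq_zero] <;> nlinarith [sq_nonneg ‖s‖, sq_nonneg ‖t‖]
  refine ⟨u₁, u₂, v₁, v₂, hA, hB, hC, hD, fun h => hX ?_, fun h => hX ?_⟩ <;>
  · obtain ⟨h1, h2⟩ := key _ _ h
    ext i j
    fin_cases i <;> fin_cases j <;> simp [X, hA, hB, hC, hD, h1, h2]

/-- With `X = u vᵀ`, the combination of the fourth and fifth coordinates with coefficients `u`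
carries the single nonzero differential; the one with coefficients `conj u₂, -conj u₁` is closed.
The factor `|u|²` comes from `u` paired with `conj u`. -/
theorem hasComplexModel_eight (hε : c.ε = 0) (hρ : c.ρ = 0) (h1 : c.Δ₁ = 0) (hX : c.X ≠ 0) :
    c.HasComplexModel 8 := by
  obtain ⟨u₁, u₂, v₁, v₂, hA, hB, hC, hD, hu, hv⟩ := exists_coeff_of_rank_one h1 hX
  refine hasComplexModel_of
    ![![(u₁ * conj u₁ + u₂ * conj u₂) * conj v₁, (u₁ * conj u₁ + u₂ * conj u₂) * conj v₂,
      0, 0, 0, 0], ![0, 0, 0, 0, 0, 1], ![0, 0, 0, conj u₂, -conj u₁, 0], ![0, 0, 1, 0, 0, 0],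
    ![-v₂, v₁, 0, 0, 0, 0], ![0, 0, 0, u₁, u₂, 0]] (fun x hx => ?_) (fun x y k => ?_)
  · have e0 := hx 0; have e1 := hx 1; have e2 := hx 2
    have e3 := hx 3; have e4 := hx 4; have e5 := hx 5
    simp only [rowForm_apply] at e0 e1 e2 e3 e4 e5
    simp at e0 e1 e2 e3 e4 e5
    refine ext_six (eq_zero_of_comb (p := conj v₁) (q := conj v₂) (p' := -v₂) (q' := v₁) ?_ ?_ ?_)
      e3 (eq_zero_of_comb (p := u₁) (q := u₂) (p' := conj u₂) (q' := -conj u₁) ?_ ?_ ?_) e1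
    · intro h; apply hv; linear_combination h
    · refine (mul_eq_zero.1 (?_ : (u₁ * conj u₁ + u₂ * conj u₂) * _ = 0)).resolve_left hu
      linear_combination e0
    · linear_combination e4
    · intro h; apply hu; linear_combination -h
    · linear_combination e5
    · linear_combination e2
  · fin_cases k <;>
      simp [courantBracket, nilBracketC, structureEqs, rowForm_apply, hε, hρ, hA, hB, hC, hD] <;>
      ring

/-- The form `conj v₁, conj v₂` is a common factor of the product coming from `X` and, up to scale,
of the product of the first two coordinates coming from `ρ`. -/
theorem hasComplexModel_six_of_rank_one (hε : c.ε = 0) (hρ : c.ρ = 1) (h1 : c.Δ₁ = 0)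
    (hX : c.X ≠ 0) : c.HasComplexModel 6 := by
  obtain ⟨u₁, u₂, v₁, v₂, hA, hB, hC, hD, hu, hv⟩ := exists_coeff_of_rank_one h1 hX
  refine hasComplexModel_of
    ![![conj v₁, conj v₂, 0, 0, 0, 0], ![-v₂, v₁, 0, 0, 0, 0],
    ![0, 0, 0, 0, 0, u₁ * conj u₁ + u₂ * conj u₂], ![0, 0, 0, conj u₂, -conj u₁, 0],
    ![0, 0, v₁ * conj v₁ + v₂ * conj v₂, 0, 0, 0], ![0, 0, 0, u₁, u₂, 0]]
    (fun x hx => ?_) (fun x y k => ?_)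
  · have e0 := hx 0; have e1 := hx 1; have e2 := hx 2
    have e3 := hx 3; have e4 := hx 4; have e5 := hx 5
    simp only [rowForm_apply] at e0 e1 e2 e3 e4 e5
    simp [-mul_eq_zero] at e0 e1 e2 e3 e4 e5
    refine ext_six (eq_zero_of_comb (p := conj v₁) (q := conj v₂) (p' := -v₂) (q' := v₁) ?_ ?_ ?_)
      ((mul_eq_zero.1 e4).resolve_left hv)
      (eq_zero_of_comb (p := u₁) (q := u₂) (p' := conj u₂) (q' := -conj u₁) ?_ ?_ ?_)
      ((mul_eq_zero.1 e2).resolve_left hu)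
    · intro h; apply hv; linear_combination h
    · linear_combination e0
    · linear_combination e1
    · intro h; apply hu; linear_combination -h
    · linear_combination e5
    · linear_combination e3
  · fin_cases k <;>
      simp [courantBracket, nilBracketC, structureEqs, rowForm_apply, hε, hρ, hA, hB, hC, hD] <;>
      ring

theorem hasComplexModel_eight_of_rank_zero (hε : c.ε = 0) (hρ : c.ρ = 1) (hX : c.X = 0) :
    c.HasComplexModel 8 := by
  have hA : c.A = 0 := congrFun₂ hX 0 0
  have hB : c.B = 0 := congrFun₂ hX 0 1
  have hC : c.C = 0 := congrFun₂ hX 1 0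
  have hD : c.D = 0 := congrFun₂ hX 1 1
  refine ⟨fun k => LinearMap.proj (![0, 1, 3, 4, 5, 2] k), fun x hx => ?_, fun x y k => ?_⟩
  · exact ext_six ⟨hx 0, hx 1⟩ (hx 5) ⟨hx 2, hx 3⟩ (hx 4)
  · fin_cases k <;>
      simp [courantBracket, nilBracketC, structureEqs, hε, hρ, hA, hB, hC, hD]

/-! In the remaining cases `ε = 1`, and the forms defining the isomorphism are multiples of the
coordinates. -/

theorem hasComplexModel_of_scale {n : ℕ} (i : Fin 6 → Fin 6) (s : Fin 6 → ℂ) (hs : ∀ k, s k ≠ 0)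
    (hi : ∀ j, ∃ k, i k = j)
    (h : ∀ x y k, s k * c.courantBracket x y (i k) =
      nilBracketC n (fun j => s j * x (i j)) (fun j => s j * y (i j)) k) :
    c.HasComplexModel n := by
  refine ⟨fun k => s k • LinearMap.proj (i k), fun x hx => funext fun j => ?_, h⟩
  obtain ⟨k, rfl⟩ := hi j
  exact (mul_eq_zero.1 (hx k)).resolve_left (hs k)

theorem hasComplexModel_three (hε : c.ε = 1) (hρ : c.ρ = 0) (hA : c.A = 0) (hD : c.D = 0)
    (hB : c.B ≠ 0) (hC : c.C = 0) : c.HasComplexModel 3 := by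
  refine hasComplexModel_of_scale ![0, 4, 1, 5, 2, 3] ![1, 1, conj c.B, 1, 1, 1]
    (fun k => ?_) (by decide) (fun x y k => ?_)
  · fin_cases k <;> simp [hB]
  · fin_cases k <;>
      simp [courantBracket, nilBracketC, structureEqs, hε, hρ, hA, hD, hC] <;> ring

theorem hasComplexModel_seventeen (hε : c.ε = 1) (hρ : c.ρ = 0) (hA : c.A = 0) (hD : c.D = 0)
    (hB : c.B = 0) (hC : c.C ≠ 0) : c.HasComplexModel 17 := by
  refine hasComplexModel_of_scale ![0, 5, 1, 2, 4, 3] ![1, conj c.C, 1, 1, 1, 1]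
    (fun k => ?_) (by decide) (fun x y k => ?_)
  · fin_cases k <;> simp [hC]
  · fin_cases k <;>
      simp [courantBracket, nilBracketC, structureEqs, hε, hρ, hA, hD, hB] <;> ring

theorem hasComplexModel_nine (hε : c.ε = 1) (hρ : c.ρ = 0) (hA : c.A = 0) (hD : c.D = 0)
    (hB : c.B ≠ 0) (hC : c.C ≠ 0) : c.HasComplexModel 9 := by
  have hC' : conj c.C ≠ 0 := by simpa using hC
  refine hasComplexModel_of_scale ![5, 0, 2, 1, 4, 3]
    ![-conj c.C, 1, 1, conj c.B / conj c.C, 1, 1] (fun k => ?_) (by decide) (fun x y k => ?_)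
  · fin_cases k <;> simp [hC, hB]
  · fin_cases k <;>
      simp [courantBracket, nilBracketC, structureEqs, hε, hρ, hA, hD] <;> field_simp <;> ring

theorem hasComplexModel_six (hε : c.ε = 1) (hρ : c.ρ = 1) (hA : c.A = 0) (hD : c.D = 0)
    (hB : c.B = 0) (hC : c.C = 0) : c.HasComplexModel 6 := by
  refine hasComplexModel_of_scale ![0, 1, 4, 5, 2, 3] 1
    (fun k => one_ne_zero) (by decide) (fun x y k => ?_)
  fin_cases k <;>
    simp [courantBracket, nilBracketC, structureEqs, hε, hρ, hA, hD, hB, hC]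

theorem hasComplexModel_four (hε : c.ε = 1) (hρ : c.ρ = 1) (hA : c.A = 0) (hD : c.D = 0)
    (hB : c.B ≠ 0) (hC : c.C = 0) : c.HasComplexModel 4 := by
  refine hasComplexModel_of_scale ![0, 1, 5, 4, 2, 3] ![1, 1, conj c.B, 1, 1, 1]
    (fun k => ?_) (by decide) (fun x y k => ?_)
  · fin_cases k <;> simp [hB]
  · fin_cases k <;>
      simp [courantBracket, nilBracketC, structureEqs, hε, hρ, hA, hD, hC] <;> ring

theorem hasComplexModel_ten (hε : c.ε = 1) (hρ : c.ρ = 1) (hA : c.A = 0) (hD : c.D = 0)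
    (hB : c.B = 0) (hC : c.C ≠ 0) : c.HasComplexModel 10 := by
  refine hasComplexModel_of_scale ![0, 5, 1, 4, 2, 3] ![1, conj c.C, 1, 1, 1, 1]
    (fun k => ?_) (by decide) (fun x y k => ?_)
  · fin_cases k <;> simp [hC]
  · fin_cases k <;>
      simp [courantBracket, nilBracketC, structureEqs, hε, hρ, hA, hD, hB] <;> ring

theorem hasComplexModel_eleven (hε : c.ε = 1) (hρ : c.ρ = 1) (hA : c.A = 0) (hD : c.D = 0)
    (hB : c.B ≠ 0) (hC : c.C ≠ 0) : c.HasComplexModel 11 := by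
  have hC' : conj c.C ≠ 0 := by simpa using hC
  refine hasComplexModel_of_scale ![0, 5, 1, 4, 2, 3]
    ![1, conj c.C, -(conj c.B / conj c.C), 1, -(conj c.B / conj c.C), 1]
    (fun k => ?_) (by decide) (fun x y k => ?_)
  · fin_cases k <;> simp [hC, hB]
  · fin_cases k <;>
      simp [courantBracket, nilBracketC, structureEqs, hε, hρ, hA, hD] <;> field_simp <;> ring

end Constants

/-! ### The span of `d ω^3` and its conjugate -/

namespace Constants

/-- The forms `d ω^3` and `d (conj ω^3)` are linearly dependent. -/
def Dependent (c : Constants) : Prop := ∃ s : ℂ, s ≠ 0 ∧ ∀ x y, (s * c.form x y).re = 0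

open Classical in
/-- The dimension of the span of `d ω^3` and its conjugate. -/
def dim (c : Constants) : ℕ :=
  if ∀ x y, c.form x y = 0 then 0 else if c.Dependent then 1 else 2

variable {c : Constants}

theorem form_eq_zero_iff : (∀ x y, c.form x y = 0) ↔ c.ρ = 0 ∧ c.X = 0 := by
  constructor
  · intro h
    have h1 := h ![1, 0, 0] ![Complex.I, 0, 0]
    have h2 := h ![0, 1, 0] ![0, Complex.I, 0]
    have h3 := h ![1, 0, 0] ![0, 1, 0]
    have h4 := h ![1, 0, 0] ![0, Complex.I, 0]
    have h5 := h ![Complex.I, 0, 0] ![0, 1, 0]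
    simp [form] at h1 h2 h3 h4 h5
    have hI := Complex.I_ne_zero
    have h4' : c.ρ - c.B - c.C = 0 :=
      (mul_eq_zero.1 (by linear_combination h4 : Complex.I * _ = 0)).resolve_left hI
    have h5' : c.ρ + c.B + c.C = 0 :=
      (mul_eq_zero.1 (by linear_combination h5 : Complex.I * _ = 0)).resolve_left hI
    have hI' : ¬(-Complex.I - Complex.I = 0) := fun h => hI (by linear_combination -h / 2)
    have hA : c.A = 0 := h1.resolve_right hI'
    have hD : c.D = 0 := h2.resolve_right hI'
    have hρ : c.ρ = 0 := by linear_combination (h4' + h5') / 2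
    have hB : c.B = 0 := by linear_combination (h3 - h4') / 2
    have hC : c.C = 0 := by linear_combination h5' - hρ - hB
    refine ⟨hρ, ?_⟩
    ext i j
    fin_cases i <;> fin_cases j <;> simp [X, hA, hB, hC, hD]
  · rintro ⟨hρ, hX⟩ x y
    have hA : c.A = 0 := congrFun₂ hX 0 0
    have hB : c.B = 0 := congrFun₂ hX 0 1
    have hC : c.C = 0 := congrFun₂ hX 1 0
    have hD : c.D = 0 := congrFun₂ hX 1 1
    simp [form, hρ, hA, hB, hC, hD]

theorem dependent_of {s : ℂ} (hs : s ≠ 0) (hρ : c.ρ = 0) (hA : s * c.A = conj (s * c.A))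
    (hD : s * c.D = conj (s * c.D)) (hB : s * c.C = conj (s * c.B)) : c.Dependent := by
  refine ⟨s, hs, fun x y => ?_⟩
  have h : s * c.form x y + conj (s * c.form x y) = 0 := by
    have hC : conj (s * c.C) = s * c.B := by rw [hB, Complex.conj_conj]
    simp only [form, hρ, map_add, map_mul, map_sub, Complex.conj_conj, map_zero] at hA hD hB hC ⊢
    linear_combination (x 0 * conj (y 0) - y 0 * conj (x 0)) * hA +
      (x 1 * conj (y 1) - y 1 * conj (x 1)) * hD +
      (x 1 * conj (y 0) - y 1 * conj (x 0)) * hB - (x 0 * conj (y 1) - y 0 * conj (x 1)) * hC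
  have h' := congrArg Complex.re h
  simp only [Complex.add_re, Complex.conj_re, Complex.zero_re] at h'
  linarith

/-- The term with `ρ` is the only one of type `(2,0)`, and nothing in `s Ω + conj (s Ω)` can cancel
it. -/
theorem Dependent.rho (h : c.Dependent) : c.ρ = 0 := by
  obtain ⟨s, hs, h⟩ := h
  have h1 := h ![1, 0, 0] ![0, 1, 0]
  have h2 := h ![Complex.I, 0, 0] ![0, Complex.I, 0]
  have h3 := h ![1, 0, 0] ![0, Complex.I, 0]
  have h4 := h ![Complex.I, 0, 0] ![0, 1, 0]
  simp [form] at h1 h2 h3 h4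
  have : s * c.ρ = 0 := Complex.ext (by simp; linarith) (by simp; linarith)
  exact (mul_eq_zero.1 this).resolve_left hs

/-- If `s X` is Hermitian and `ρ = 0`, then `|s|² Δ₂ = -s² Δ₁`. -/
theorem Dependent.diff (h : c.Dependent) : ‖c.Δ₁‖ ^ 2 - c.Δ₂ ^ 2 = 0 := by
  have hρ := h.rho
  obtain ⟨s, hs, h⟩ := h
  have h1 := h ![1, 0, 0] ![Complex.I, 0, 0]
  have h2 := h ![0, 1, 0] ![0, Complex.I, 0]
  have h3 := h ![1, 0, 0] ![0, 1, 0]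
  have h4 := h ![1, 0, 0] ![0, Complex.I, 0]
  simp [form, hρ] at h1 h2 h3 h4
  have hA : conj (s * c.A) = s * c.A := Complex.ext (by simp) (by simp; linarith)
  have hD : conj (s * c.D) = s * c.D := Complex.ext (by simp) (by simp; linarith)
  have hB : s * c.C = conj (s * c.B) := Complex.ext (by simp; linarith) (by simp; linarith)
  have hC : conj (s * c.C) = s * c.B := by rw [hB, Complex.conj_conj]
  simp only [map_mul] at hA hD hB hC
  have key : (s * conj s) * c.Δ₂ = -(s * s * c.Δ₁) := by
    have := two_mul_Δ₂ c
    rw [Δ₁]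
    rw [hρ, zero_mul, sub_zero] at this
    linear_combination (s * conj s) / 2 * this + s * c.B * (-hB) / 2 + s * c.C / 2 * hC -
      s * c.A / 2 * hD - s * c.D / 2 * hA
  have hn := congrArg norm key
  rw [norm_mul, norm_mul, norm_neg, norm_mul, norm_mul, Complex.norm_conj, Complex.norm_real] at hn
  have hs' : ‖s‖ * ‖s‖ ≠ 0 := by simp [hs]
  have := mul_left_cancel₀ hs' hn
  rw [← this, Real.norm_eq_abs, sq_abs, sub_self]

/-- For `X = u vᵀ` the condition `Δ₂ = 0` says that `v` is proportional to `conj u`. Then `X` is a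
multiple of the Hermitian matrix `u u*`, and multiplying by the conjugate of its trace makes it
Hermitian. -/
theorem dependent_of_rank_one (hρ : c.ρ = 0) (h1 : c.Δ₁ = 0) (h2 : c.Δ₂ = 0) (hX : c.X ≠ 0) :
    c.Dependent := by
  obtain ⟨u₁, u₂, v₁, v₂, hA, hB, hC, hD, hu, hv⟩ := exists_coeff_of_rank_one h1 hX
  have hw : (u₁ * conj v₂ - u₂ * conj v₁) * conj (u₁ * conj v₂ - u₂ * conj v₁) = 0 := by
    have h3 := two_mul_Δ₂ c
    rw [h2, hA, hB, hC, hD, hρ] at h3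
    simp only [map_sub, map_mul, Complex.conj_conj, Complex.ofReal_zero, map_zero] at h3 ⊢
    linear_combination -h3
  rw [Complex.mul_conj, Complex.ofReal_eq_zero, Complex.normSq_eq_zero] at hw
  have hw' := congrArg conj hw
  simp only [map_sub, map_mul, Complex.conj_conj, map_zero] at hw'
  refine dependent_of (s := conj (u₁ * v₁ + u₂ * v₂)) ?_ hρ ?_ ?_ ?_
  · intro h
    rw [map_eq_zero] at h
    apply mul_ne_zero hu hv
    linear_combination (conj u₁ * conj v₁ + conj u₂ * conj v₂) * h +
      (conj u₁ * v₂ - conj u₂ * v₁) * hw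
  all_goals
    simp only [hA, hB, hC, hD, map_add, map_mul, Complex.conj_conj]
  · linear_combination conj u₂ * v₁ * hw - u₂ * conj v₁ * hw'
  · linear_combination u₂ * conj v₁ * hw' - conj u₂ * v₁ * hw
  · linear_combination -conj u₁ * v₁ * hw - u₂ * conj v₂ * hw'

theorem dependent_of_norm_eq (hρ : c.ρ = 0) (hA : c.A = 0) (hD : c.D = 0) (hC : c.C ≠ 0)
    (h : ‖c.B‖ = ‖c.C‖) : c.Dependent := by
  obtain ⟨s, hs⟩ := IsAlgClosed.exists_pow_nat_eq (conj c.B / c.C) (n := 2) (by norm_num)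
  have hn : ‖s‖ ^ 2 = 1 := by
    rw [← norm_pow, hs, norm_div, Complex.norm_conj, h, div_self (norm_ne_zero_iff.2 hC)]
  have hs1 : s * conj s = 1 := by rw [Complex.mul_conj']; exact_mod_cast hn
  have hs0 : s ≠ 0 := by rintro rfl; simp at hs1
  refine dependent_of hs0 hρ (by simp [hA]) (by simp [hD]) ?_
  rw [eq_div_iff hC] at hs
  rw [map_mul]
  linear_combination conj s * hs - s * c.C * hs1

end Constants

theorem dimSpan_eq {g : Type*} [LieRing g] [LieAlgebra ℝ g] {J : g →ₗ[ℝ] g}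
    {ω : Module.Basis (Fin 3) ℂ (forms10 J)} {c : Constants} (h : IsReduced ω c) :
    dimSpan ω = c.dim := by
  have hα := h.dForm_two
  have hβ (x y : g) : dForm (conjForm (ω 2 : g →ₗ[ℝ] ℂ)) x y =
      conj (c.form (coord ω x) (coord ω y)) := by
    rw [← hα, dForm_apply, dForm_apply, conjForm_apply, map_neg]
  rw [dimSpan, Constants.dim]
  set α := dForm (ω 2 : g →ₗ[ℝ] ℂ)
  set β := dForm (conjForm (ω 2 : g →ₗ[ℝ] ℂ))
  split_ifs with h0 h1
  · have ha : α = 0 := LinearMap.ext₂ fun x y => by rw [hα, h0]; rfl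
    have hb : β = 0 := LinearMap.ext₂ fun x y => by rw [hβ, h0, map_zero]; rfl
    rw [ha, hb, Set.pair_eq_singleton, Submodule.span_zero_singleton, finrank_bot]
  · obtain ⟨s, hs, h1⟩ := h1
    have hs' : conj s ≠ 0 := by simpa using hs
    have hb : β = (-(s / conj s)) • α := LinearMap.ext₂ fun x y => by
      rw [hβ, LinearMap.smul_apply, LinearMap.smul_apply, hα, smul_eq_mul]
      have h2 := h1 (coord ω x) (coord ω y)
      have h3 := Complex.add_conj (s * c.form (coord ω x) (coord ω y))
      rw [h2, map_mul] at h3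
      field_simp
      push_cast at h3
      linear_combination h3
    have ha : α ≠ 0 := by
      intro ha
      apply h0
      intro x y
      obtain ⟨x, rfl⟩ := coord_surjective ω x
      obtain ⟨y, rfl⟩ := coord_surjective ω y
      rw [← hα, ha]
      rfl
    have hspan : Submodule.span ℂ {α, β} = Submodule.span ℂ {α} := by
      rw [Set.pair_comm, Submodule.span_insert_eq_span]
      rw [hb]
      exact Submodule.smul_mem _ _ (Submodule.mem_span_singleton_self α)
    rw [hspan, finrank_span_singleton ha]
  · have hind : LinearIndependent ℂ ![α, β] := by
      rw [LinearIndependent.pair_iff]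
      intro s t hst
      have hf (x y : Fin 3 → ℂ) : s * c.form x y + t * conj (c.form x y) = 0 := by
        obtain ⟨x, rfl⟩ := coord_surjective ω x
        obtain ⟨y, rfl⟩ := coord_surjective ω y
        rw [← hβ, ← hα]
        exact LinearMap.congr_fun₂ hst x y
      -- Adding the relation to its conjugate makes the real part of `(s + conj t) Ω` vanish;
      -- subtracting does the same for `i (s - conj t) Ω`. As `Ω` and `conj Ω` are not dependent,
      -- both factors are zero.
      have h2 : s + conj t = 0 := by
        by_contra hne
        refine h1 ⟨_, hne, fun x y => ?_⟩
        have h3 := hf x y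
        have h4 := congrArg conj h3
        simp only [map_add, map_mul, Complex.conj_conj, map_zero] at h4
        have h5 := Complex.add_conj ((s + conj t) * c.form x y)
        simp only [map_add, map_mul, Complex.conj_conj] at h5
        have h6 : ((2 * ((s + conj t) * c.form x y).re : ℝ) : ℂ) = 0 := by
          rw [← h5]; linear_combination h3 + h4
        have h7 := Complex.ofReal_eq_zero.1 h6
        linarith
      have h2' : Complex.I * (s - conj t) = 0 := by
        by_contra hne
        refine h1 ⟨_, hne, fun x y => ?_⟩
        have h3 := hf x y
        have h4 := congrArg conj h3
        simp only [map_add, map_mul, Complex.conj_conj, map_zero] at h4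
        have h5 := Complex.add_conj ((Complex.I * (s - conj t)) * c.form x y)
        simp only [map_sub, map_mul, Complex.conj_conj, Complex.conj_I] at h5
        have h6 : ((2 * ((Complex.I * (s - conj t)) * c.form x y).re : ℝ) : ℂ) = 0 := by
          rw [← h5]; linear_combination Complex.I * (h3 - h4)
        have h7 := Complex.ofReal_eq_zero.1 h6
        linarith
      have h3 := (mul_eq_zero.1 h2').resolve_left Complex.I_ne_zero
      have hs : s = 0 := by linear_combination (h2 + h3) / 2
      refine ⟨hs, ?_⟩
      rw [hs, zero_add, map_eq_zero] at h2
      exact h2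
    have := finrank_span_eq_card hind
    rwa [Matrix.range_cons, Matrix.range_cons, Matrix.range_empty, Set.union_empty,
      Set.singleton_union, Fintype.card_fin] at this

/-! ### The rank of `X` -/

namespace Constants

variable {c : Constants}

theorem rank_X_eq_two (h : c.Δ₁ ≠ 0) : c.X.rank = 2 := by
  rw [Matrix.rank_of_isUnit, Fintype.card_fin]
  rw [Matrix.isUnit_iff_isUnit_det, isUnit_iff_ne_zero]
  rw [X, Matrix.det_fin_two_of]
  exact h

theorem rank_X_eq_one (h : c.Δ₁ = 0) (hX : c.X ≠ 0) : c.X.rank = 1 := by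
  obtain ⟨u₁, u₂, v₁, v₂, hA, hB, hC, hD⟩ := exists_coeff_eq_mul h
  have hle : c.X.rank ≤ 1 := by
    have : c.X = Matrix.vecMulVec ![u₁, u₂] ![v₁, v₂] := by
      ext i j
      fin_cases i <;> fin_cases j <;> simp [X, Matrix.vecMulVec_apply, hA, hB, hC, hD]
    rw [this]
    exact Matrix.rank_vecMulVec_le _ _
  have h0 : c.X.rank ≠ 0 := by
    rw [Matrix.rank, Ne, Submodule.finrank_eq_zero, LinearMap.range_eq_bot]
    intro h
    apply hX
    rw [← Matrix.toLin'_apply', ← map_zero Matrix.toLin'] at h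
    exact Matrix.toLin'.injective h
  omega

end Constants

/-! ### The rows of the table -/

/-- The constants `c` obey the constraints of the row `r`. -/
structure Row.HoldsFor (r : Row) (c : Constants) : Prop where
  eps : r.ε.Holds ‖c.ρ‖ ‖c.ε‖
  rho : r.ρ.Holds ‖c.ρ‖ ‖c.ρ‖
  rank : c.X.rank = r.rank
  delta_one : r.Δ₁.Holds ‖c.ρ‖ ‖c.Δ₁‖
  delta_two : r.Δ₂.Holds ‖c.ρ‖ |c.Δ₂|
  diff : r.diff.Holds ‖c.ρ‖ (‖c.Δ₁‖ ^ 2 - c.Δ₂ ^ 2)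
  dim : c.dim = r.d
  absB : r.B.Holds ‖c.ρ‖ ‖c.B‖
  absC : r.C.Holds ‖c.ρ‖ ‖c.C‖

/-- After this, rows are a matter of the constants alone, without reference to `g`. -/
theorem Row.holds_iff {r : Row} {g : Type*} [LieRing g] [LieAlgebra ℝ g] {J : g →ₗ[ℝ] g}
    {ω : Module.Basis (Fin 3) ℂ (forms10 J)} {c : Constants} (h : IsReduced ω c) :
    r.Holds ω c ↔ r.HoldsFor c := by
  constructor
  · rintro ⟨h1, h2, h3, h4, h5, h6, h7, h8, h9⟩
    exact ⟨h1, h2, h3, h4, h5, h6, (dimSpan_eq h).symm.trans h7, h8, h9⟩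
  · rintro ⟨h1, h2, h3, h4, h5, h6, h7, h8, h9⟩
    exact ⟨h1, h2, h3, h4, h5, h6, (dimSpan_eq h).trans h7, h8, h9⟩

/-- The kind of an entry of the table. -/
def Entry.code : Entry → ℕ
  | .zero => 0
  | .pos => 1
  | .neg => 2
  | .free => 3
  | .absRho => 4

open Classical in
/-- The sign of a real number, coded as the entries of the table. -/
def signCode (v : ℝ) : ℕ := if v = 0 then 0 else if 0 < v then 1 else 2

theorem signCode_of_pos {v : ℝ} (h : 0 < v) : signCode v = 1 := by
  rw [signCode, if_neg h.ne', if_pos h]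

theorem Entry.Holds.code_eq {e : Entry} {r v : ℝ} (h : e.Holds r v) (he : e.code < 3) :
    e.code = signCode v := by
  match e, h, he with
  | .zero, h, _ => rw [show v = 0 from h, signCode, if_pos rfl]; rfl
  | .pos, h, _ => rw [signCode_of_pos h]; rfl
  | .neg, h, _ =>
    have h' : v < 0 := h
    rw [signCode, if_neg h'.ne, if_neg h'.not_gt]
    rfl

/-- Entries of a row that distinguish it from the other rows. -/
def Row.signature (r : Row) : ℕ × ℕ × ℕ × ℕ × ℕ × ℕ :=
  (r.ε.code, r.ρ.code, r.rank, r.diff.code, r.d,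
    if r.ε.code = 1 then if r.C.code = 0 then 0 else 1 else 0)

theorem table_code : ∀ r ∈ table, r.ε.code < 3 ∧ r.ρ.code < 3 ∧ r.diff.code < 3 ∧
    (r.ε.code = 1 → r.C.code < 2 ∨ r.C.code = 4 ∧ r.ρ.code = 1) := by
  decide

theorem table_signature : (table.map Row.signature).Nodup := by
  decide

/-- The entry for `|C|` is only needed when `ε = 1`. There it may be `|ρ|`, but only in rows with `ρ
≠ 0`, so it counts as positive. -/
theorem Row.HoldsFor.signature_eq {r : Row} (hr : r ∈ table) {c : Constants} (h : r.HoldsFor c) :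
    r.signature = (signCode ‖c.ε‖, signCode ‖c.ρ‖, c.X.rank, signCode (‖c.Δ₁‖ ^ 2 - c.Δ₂ ^ 2),
      c.dim, if signCode ‖c.ε‖ = 1 then signCode ‖c.C‖ else 0) := by
  obtain ⟨h1, h2, h3, h4⟩ := table_code r hr
  rw [Row.signature, ← h.eps.code_eq h1, ← h.rho.code_eq h2, ← h.diff.code_eq h3, h.rank, h.dim]
  congr 5
  split_ifs with h5 h6
  · rw [← h.absC.code_eq (by omega), h6]
  · obtain h7 | ⟨h7, h8⟩ := h4 h5
    · rw [← h.absC.code_eq (by omega)]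
      omega
    · have h9 := h.absC
      have h10 := h.rho.code_eq h2
      rw [h8] at h10
      obtain ⟨C, hC⟩ : ∃ C, C = r.C := ⟨_, rfl⟩
      rw [← hC] at h7 h9
      cases C <;> simp [Entry.code] at h7
      rw [show ‖c.C‖ = ‖c.ρ‖ from h9, ← h10]
  · rfl

theorem Row.HoldsFor.unique {r r' : Row} (hr : r ∈ table) (hr' : r' ∈ table) {c : Constants}
    (h : r.HoldsFor c) (h' : r'.HoldsFor c) : r = r' :=
  List.inj_on_of_nodup_map table_signature hr hr'
    ((h.signature_eq hr).trans (h'.signature_eq hr').symm)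

/-- `h_7` and `h_16`, `h_12` and `h_13`, and `h_11` and `h_14` stand in common rows, so identifying
them in `lieClass` costs nothing. -/
theorem table_lieClass : ∀ r ∈ table, ∀ k ∈ r.g, k ∈ Finset.Icc 1 16 ∧ ∀ k' ∈ Finset.Icc 1 16,
    (if k = 16 then 7 else if k = 13 then 12 else if k = 14 then 11 else k) =
      (if k' = 16 then 7 else if k' = 13 then 12 else if k' = 14 then 11 else k') →
    k' ∈ r.g := by
  decide

/-- The algebraic conditions on the constants of a reduced basis. -/
structure Constants.Reduced (c : Constants) : Prop where
  eps : c.ε = 0 ∨ c.ε = 1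
  rho : c.ρ = 0 ∨ c.ρ = 1
  coeff : c.ε = 1 → c.A = 0 ∧ c.D = 0
  nonzero : c.ε = 1 → c.ρ = 1 ∨ c.B ≠ 0 ∨ c.C ≠ 0

theorem IsReduced.reduced {g : Type*} [LieRing g] [LieAlgebra ℝ g] {J : g →ₗ[ℝ] g}
    {ω : Module.Basis (Fin 3) ℂ (forms10 J)} {c : Constants} (h : IsReduced ω c) : c.Reduced := by
  refine ⟨h.eps, h.rho, h.coeff, fun hε => ?_⟩
  by_contra! hn
  obtain ⟨hA, hD⟩ := h.coeff hε
  apply h.nonzero hε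
  refine LinearMap.ext₂ fun x y => ?_
  rw [h.dForm_two, Constants.form_eq_zero_iff.2]
  · rfl
  · refine ⟨h.rho.resolve_right hn.1, ?_⟩
    ext i j
    fin_cases i <;> fin_cases j <;> simp [Constants.X, hA, hD, hn.2]

namespace Constants

variable {c : Constants}

theorem dim_eq_two (h : ¬c.Dependent) : c.dim = 2 := by
  rw [dim, if_neg, if_neg h]
  intro h0
  exact h ⟨1, one_ne_zero, fun x y => by rw [h0, mul_zero, Complex.zero_re]⟩

theorem dim_eq_one (h : c.Dependent) (hX : c.X ≠ 0) : c.dim = 1 := by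
  rw [dim, if_neg, if_pos h]
  exact fun h0 => hX (form_eq_zero_iff.1 h0).2

theorem not_dependent_of_diff (h : ‖c.Δ₁‖ ^ 2 - c.Δ₂ ^ 2 ≠ 0) : ¬c.Dependent :=
  fun h' => h h'.diff

theorem not_dependent_of_rho (h : c.ρ = 1) : ¬c.Dependent :=
  fun h' => one_ne_zero (h.symm.trans h'.rho)

theorem X_ne_zero (h : c.Δ₁ ≠ 0) : c.X ≠ 0 := by
  intro h'
  apply h
  have : c.X.det = c.Δ₁ := by rw [X, Matrix.det_fin_two_of, Δ₁]
  rw [← this, h', Matrix.det_fin_two]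
  simp

theorem hind_of_not_dependent (h : ¬c.Dependent) :
    ∀ s : ℂ, s ≠ 0 → ∃ x y, (s * c.form x y).re ≠ 0 := by
  intro s hs
  by_contra! h'
  exact h ⟨s, hs, h'⟩

/-- A row holding for `c`, together with the corresponding Lie algebras. -/
def HasRow (c : Constants) : Prop :=
  ∃ r ∈ table, r.HoldsFor c ∧ c.HasComplexModel r.f ∧ ∃ k ∈ r.g, c.HasModel k

theorem HasRow.intro {c : Constants} (i : Fin 25) (h : (table.get i).HoldsFor c)
    (hf : c.HasComplexModel (table.get i).f) {k : ℕ} (hk : k ∈ (table.get i).g)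
    (hg : c.HasModel k) : c.HasRow :=
  ⟨_, List.get_mem table i, h, hf, k, hk, hg⟩

theorem hasRow_of_eps_zero_of_rho_zero (hε : c.ε = 0) (hρ : c.ρ = 0) : c.HasRow := by
  have nε : ‖c.ε‖ = 0 := by rw [hε, norm_zero]
  have nρ : ‖c.ρ‖ = 0 := by rw [hρ, norm_zero]
  by_cases hX : c.X = 0
  · have hA : c.A = 0 := congrFun₂ hX 0 0
    have hB : c.B = 0 := congrFun₂ hX 0 1
    have hC : c.C = 0 := congrFun₂ hX 1 0
    have hf := form_eq_zero_iff.2 ⟨hρ, hX⟩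
    have h1 : ‖c.Δ₁‖ = 0 := by simp [Δ₁, hA, hB]
    have h2 : c.Δ₂ = 0 := by simp [Δ₂, hA, hB, hC, hρ]
    exact HasRow.intro 0 ⟨nε, nρ, by rw [hX]; exact Matrix.rank_zero, h1,
      by rw [h2]; exact abs_zero, by rw [h1, h2]; show (0 : ℝ) ^ 2 - 0 ^ 2 = 0; norm_num,
      by rw [dim, if_pos hf]; rfl, by rw [hB]; exact norm_zero, by rw [hC]; exact norm_zero⟩
      (hasComplexModel_one hε hρ hX) (List.mem_singleton.2 rfl) (hasModel_one hε hf)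
  by_cases h1 : c.Δ₁ = 0
  · have n1 : ‖c.Δ₁‖ = 0 := by rw [h1, norm_zero]
    have hr := rank_X_eq_one h1 hX
    by_cases h2 : c.Δ₂ = 0
    · have hdep := dependent_of_rank_one hρ h1 h2 hX
      obtain ⟨s, hs, hs0⟩ := id hdep
      exact HasRow.intro 1 ⟨nε, nρ, hr, n1, by rw [h2]; exact abs_zero, hdep.diff,
        dim_eq_one hdep hX, trivial, trivial⟩ (hasComplexModel_eight hε hρ h1 hX)
        (List.mem_singleton.2 rfl) ((hasModel_three_or_eight hε hρ hs hs0 hX).2 h1)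
    · have hd : ‖c.Δ₁‖ ^ 2 - c.Δ₂ ^ 2 < 0 := by rw [n1]; have := sq_pos_of_ne_zero h2; linarith
      exact HasRow.intro 2 ⟨nε, nρ, hr, n1, abs_pos.2 h2, hd,
        dim_eq_two (not_dependent_of_diff hd.ne), trivial, trivial⟩
        (hasComplexModel_eight hε hρ h1 hX) (List.mem_singleton.2 rfl) (hasModel_five hε hd)
  have n1 : 0 < ‖c.Δ₁‖ := norm_pos_iff.2 h1
  have hr := rank_X_eq_two h1
  have hf := hasComplexModel_six_of_rank_two hε hρ h1
  obtain hd | hd | hd := lt_trichotomy (‖c.Δ₁‖ ^ 2 - c.Δ₂ ^ 2) 0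
  · have h2 : c.Δ₂ ≠ 0 := by rintro h; rw [h] at hd; nlinarith
    exact HasRow.intro 6 ⟨nε, nρ, hr, n1, abs_pos.2 h2, hd,
      dim_eq_two (not_dependent_of_diff hd.ne), trivial, trivial⟩ hf
      (List.mem_singleton.2 rfl) (hasModel_five hε hd)
  · have h2 : c.Δ₂ ≠ 0 := by rintro h; rw [h] at hd; nlinarith
    by_cases hdep : c.Dependent
    · obtain ⟨s, hs, hs0⟩ := hdep
      exact HasRow.intro 4 ⟨nε, nρ, hr, n1, abs_pos.2 h2, hd,
        dim_eq_one ⟨s, hs, hs0⟩ hX, trivial, trivial⟩ hf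
        (List.mem_singleton.2 rfl) ((hasModel_three_or_eight hε hρ hs hs0 hX).1 h1)
    · exact HasRow.intro 5 ⟨nε, nρ, hr, n1, abs_pos.2 h2, hd,
        dim_eq_two hdep, trivial, trivial⟩ hf
        (List.mem_singleton.2 rfl) (hasModel_four hε h1 hd (hind_of_not_dependent hdep))
  · exact HasRow.intro 3 ⟨nε, nρ, hr, n1, trivial, hd,
      dim_eq_two (not_dependent_of_diff hd.ne'), trivial, trivial⟩ hf
      (List.mem_singleton.2 rfl) (hasModel_two hε hd)

theorem hasRow_of_eps_zero_of_rho_one (hε : c.ε = 0) (hρ : c.ρ = 1) : c.HasRow := by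
  have nε : ‖c.ε‖ = 0 := by rw [hε, norm_zero]
  have nρ : 0 < ‖c.ρ‖ := by rw [hρ, norm_one]; exact one_pos
  have hdim := dim_eq_two (not_dependent_of_rho hρ)
  by_cases hX : c.X = 0
  · have hA : c.A = 0 := congrFun₂ hX 0 0
    have hB : c.B = 0 := congrFun₂ hX 0 1
    have hC : c.C = 0 := congrFun₂ hX 1 0
    have n1 : ‖c.Δ₁‖ = 0 := by simp [Δ₁, hA, hB]
    have h2 : c.Δ₂ ≠ 0 := by simp [Δ₂, hA, hB, hC, hρ]
    have hd : ‖c.Δ₁‖ ^ 2 - c.Δ₂ ^ 2 < 0 := by rw [n1]; have := sq_pos_of_ne_zero h2; linarith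
    exact HasRow.intro 7 ⟨nε, nρ, by rw [hX]; exact Matrix.rank_zero, n1,
      abs_pos.2 h2, hd, hdim, by rw [hB]; exact norm_zero, by rw [hC]; exact norm_zero⟩
      (hasComplexModel_eight_of_rank_zero hε hρ hX) (List.mem_singleton.2 rfl)
      (hasModel_five hε hd)
  by_cases h1 : c.Δ₁ = 0
  · have n1 : ‖c.Δ₁‖ = 0 := by rw [h1, norm_zero]
    have hr := rank_X_eq_one h1 hX
    have hf := hasComplexModel_six_of_rank_one hε hρ h1 hX
    by_cases h2 : c.Δ₂ = 0
    · exact HasRow.intro 8 ⟨nε, nρ, hr, n1, by rw [h2]; exact abs_zero,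
        by rw [n1, h2]; show (0 : ℝ) ^ 2 - 0 ^ 2 = 0; norm_num, hdim, trivial, trivial⟩ hf
        (List.mem_singleton.2 rfl) (hasModel_six hε hρ h1 h2)
    · have hd : ‖c.Δ₁‖ ^ 2 - c.Δ₂ ^ 2 < 0 := by rw [n1]; have := sq_pos_of_ne_zero h2; linarith
      exact HasRow.intro 9 ⟨nε, nρ, hr, n1, abs_pos.2 h2, hd, hdim, trivial, trivial⟩ hf
        (List.mem_singleton.2 rfl) (hasModel_five hε hd)
  have n1 : 0 < ‖c.Δ₁‖ := norm_pos_iff.2 h1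
  have hr := rank_X_eq_two h1
  have hf := hasComplexModel_seven hε hρ h1
  obtain hd | hd | hd := lt_trichotomy (‖c.Δ₁‖ ^ 2 - c.Δ₂ ^ 2) 0
  · have h2 : c.Δ₂ ≠ 0 := by rintro h; rw [h] at hd; nlinarith
    exact HasRow.intro 12 ⟨nε, nρ, hr, n1, abs_pos.2 h2, hd, hdim, trivial, trivial⟩ hf
      (List.mem_singleton.2 rfl) (hasModel_five hε hd)
  · have h2 : c.Δ₂ ≠ 0 := by rintro h; rw [h] at hd; nlinarith
    exact HasRow.intro 11 ⟨nε, nρ, hr, n1, abs_pos.2 h2, hd, hdim, trivial, trivial⟩ hf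
      (List.mem_singleton.2 rfl)
      (hasModel_four hε h1 hd (hind_of_not_dependent (not_dependent_of_rho hρ)))
  · exact HasRow.intro 10 ⟨nε, nρ, hr, n1, trivial, hd, hdim, trivial, trivial⟩ hf
      (List.mem_singleton.2 rfl) (hasModel_two hε hd)

theorem hasRow_of_eps_one_of_rho_zero (hε : c.ε = 1) (hρ : c.ρ = 0) (hA : c.A = 0) (hD : c.D = 0)
    (hBC : c.B ≠ 0 ∨ c.C ≠ 0) : c.HasRow := by
  have nε : 0 < ‖c.ε‖ := by rw [hε, norm_one]; exact one_pos
  have nρ : ‖c.ρ‖ = 0 := by rw [hρ, norm_zero]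
  have h1 : c.Δ₁ = -(c.B * c.C) := by rw [Δ₁, hA]; ring
  have h2 : c.Δ₂ = (‖c.B‖ ^ 2 + ‖c.C‖ ^ 2) / 2 := by simp [Δ₂, hA, hρ]
  have hX : c.X ≠ 0 := by
    intro hX
    have hB : c.B = 0 := congrFun₂ hX 0 1
    have hC : c.C = 0 := congrFun₂ hX 1 0
    simp [hB, hC] at hBC
  have h2' : c.Δ₂ ≠ 0 := by
    rw [h2]
    obtain h | h := hBC <;> have := norm_pos_iff.2 h <;> positivity
  have h15 : ‖c.Δ₁‖ ^ 2 - c.Δ₂ ^ 2 < 0 → c.HasModel 15 := hasModel_of_neg hε (.inl hρ) hA hD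
  by_cases hC : c.C = 0
  · have hB : c.B ≠ 0 := by simpa [hC] using hBC
    have h1' : c.Δ₁ = 0 := by rw [h1, hC, mul_zero, neg_zero]
    have n1 : ‖c.Δ₁‖ = 0 := by rw [h1', norm_zero]
    have hd : ‖c.Δ₁‖ ^ 2 - c.Δ₂ ^ 2 < 0 := by rw [n1]; have := sq_pos_of_ne_zero h2'; linarith
    exact HasRow.intro 13 ⟨nε, nρ, rank_X_eq_one h1' hX, n1, abs_pos.2 h2', hd,
      dim_eq_two (not_dependent_of_diff hd.ne), norm_pos_iff.2 hB, by rw [hC]; exact norm_zero⟩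
      (hasComplexModel_three hε hρ hA hD hB hC) (List.mem_singleton.2 rfl) (h15 hd)
  by_cases hB : c.B = 0
  · have h1' : c.Δ₁ = 0 := by rw [h1, hB, zero_mul, neg_zero]
    have n1 : ‖c.Δ₁‖ = 0 := by rw [h1', norm_zero]
    have hd : ‖c.Δ₁‖ ^ 2 - c.Δ₂ ^ 2 < 0 := by rw [n1]; have := sq_pos_of_ne_zero h2'; linarith
    exact HasRow.intro 14 ⟨nε, nρ, rank_X_eq_one h1' hX, n1, abs_pos.2 h2', hd,
      dim_eq_two (not_dependent_of_diff hd.ne), by rw [hB]; exact norm_zero, norm_pos_iff.2 hC⟩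
      (hasComplexModel_seventeen hε hρ hA hD hB hC) (List.mem_singleton.2 rfl) (h15 hd)
  have h1' : c.Δ₁ ≠ 0 := by rw [h1]; exact neg_ne_zero.2 (mul_ne_zero hB hC)
  have n1 : 0 < ‖c.Δ₁‖ := norm_pos_iff.2 h1'
  -- For `ε = 1` and `ρ = 0` the discriminant is minus a square: it is never positive, and it
  -- vanishes exactly when `|B| = |C|`.
  have hd : ‖c.Δ₁‖ ^ 2 - c.Δ₂ ^ 2 = -((‖c.B‖ ^ 2 - ‖c.C‖ ^ 2) / 2) ^ 2 := by
    rw [h1, h2, norm_neg, norm_mul]; ring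
  have hr := rank_X_eq_two h1'
  have hf := hasComplexModel_nine hε hρ hA hD hB hC
  by_cases h : ‖c.B‖ = ‖c.C‖
  · exact HasRow.intro 15 ⟨nε, nρ, hr, n1, abs_pos.2 h2',
      by rw [hd, h]; show -((‖c.C‖ ^ 2 - ‖c.C‖ ^ 2) / 2) ^ 2 = (0 : ℝ); ring,
      dim_eq_one (dependent_of_norm_eq hρ hA hD hC h) hX, norm_pos_iff.2 hB, norm_pos_iff.2 hC⟩ hf
      (List.mem_singleton.2 rfl) (hasModel_nine hε hA hD hρ hB h)
  · have hd' : ‖c.Δ₁‖ ^ 2 - c.Δ₂ ^ 2 < 0 := by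
      rw [hd, neg_lt_zero]
      apply sq_pos_of_ne_zero
      intro h'
      apply h
      rw [← sq_eq_sq₀ (norm_nonneg _) (norm_nonneg _)]
      linarith
    exact HasRow.intro 16 ⟨nε, nρ, hr, n1, abs_pos.2 h2', hd',
      dim_eq_two (not_dependent_of_diff hd'.ne), norm_pos_iff.2 hB, norm_pos_iff.2 hC⟩ hf
      (List.mem_singleton.2 rfl) (h15 hd')

theorem hasRow_of_eps_one_of_rho_one (hε : c.ε = 1) (hρ : c.ρ = 1) (hA : c.A = 0)
    (hD : c.D = 0) : c.HasRow := by
  have nε : 0 < ‖c.ε‖ := by rw [hε, norm_one]; exact one_pos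
  have nρ1 : ‖c.ρ‖ = 1 := by rw [hρ, norm_one]
  have nρ : 0 < ‖c.ρ‖ := by rw [nρ1]; exact one_pos
  have hdim := dim_eq_two (not_dependent_of_rho hρ)
  have h1 : c.Δ₁ = -(c.B * c.C) := by rw [Δ₁, hA]; ring
  have h2 : c.Δ₂ = (‖c.B‖ ^ 2 + ‖c.C‖ ^ 2 - 1) / 2 := by simp [Δ₂, hA, hρ]
  have h15 : ‖c.Δ₁‖ ^ 2 - c.Δ₂ ^ 2 < 0 → c.HasModel 15 := hasModel_of_neg hε (.inr hρ) hA hD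
  by_cases h1' : c.Δ₁ = 0
  · have n1 : ‖c.Δ₁‖ = 0 := by rw [h1', norm_zero]
    have hd (h2 : c.Δ₂ ≠ 0) : ‖c.Δ₁‖ ^ 2 - c.Δ₂ ^ 2 < 0 := by
      rw [n1]; have := sq_pos_of_ne_zero h2; linarith
    have hd0 (h2 : c.Δ₂ = 0) : ‖c.Δ₁‖ ^ 2 - c.Δ₂ ^ 2 = 0 := by rw [n1, h2]; norm_num
    by_cases hC : c.C = 0
    · have nC : ‖c.C‖ = 0 := by rw [hC, norm_zero]
      by_cases hB : c.B = 0
      · have nB : ‖c.B‖ = 0 := by rw [hB, norm_zero]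
        have hX : c.X = 0 := by
          ext i j
          fin_cases i <;> fin_cases j <;> simp [X, hA, hB, hC, hD]
        have h2' : c.Δ₂ ≠ 0 := by rw [h2, nB, nC]; norm_num
        exact HasRow.intro 17 ⟨nε, nρ, by rw [hX]; exact Matrix.rank_zero, n1, abs_pos.2 h2',
          hd h2', hdim, nB, nC⟩ (hasComplexModel_six hε hρ hA hD hB hC)
          (List.mem_singleton.2 rfl) (h15 (hd h2'))
      have hX : c.X ≠ 0 := fun hX => hB (congrFun₂ hX 0 1)
      have hr := rank_X_eq_one h1' hX
      have hf := hasComplexModel_four hε hρ hA hD hB hC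
      by_cases h2' : c.Δ₂ = 0
      · have nB : ‖c.B‖ = 1 := by
          rw [h2, nC] at h2'
          rw [← sq_eq_sq₀ (norm_nonneg _) zero_le_one]
          linarith
        have hrow : (table.get (18 : Fin 25)).HoldsFor c := ⟨nε, nρ, hr, n1,
          by rw [h2']; exact abs_zero, hd0 h2', hdim, nB.trans nρ1.symm, nC⟩
        by_cases hB1 : c.B = 1
        · exact HasRow.intro 18 hrow hf List.mem_cons_self (hasModel_seven hε hA hD hρ hB1 hC)
        · exact HasRow.intro 18 hrow hf (List.mem_cons_of_mem _ List.mem_cons_self)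
            (hasModel_sixteen hε hA hD hρ hB1 nB hC)
      · exact HasRow.intro 19 ⟨nε, nρ, hr, n1, abs_pos.2 h2', hd h2', hdim, norm_pos_iff.2 hB, nC⟩
          hf (List.mem_singleton.2 rfl) (h15 (hd h2'))
    have hB : c.B = 0 := by
      rw [h1, neg_eq_zero] at h1'
      exact (mul_eq_zero.1 h1').resolve_right hC
    have nB : ‖c.B‖ = 0 := by rw [hB, norm_zero]
    have hX : c.X ≠ 0 := fun hX => hC (congrFun₂ hX 1 0)
    have hr := rank_X_eq_one h1' hX
    have hf := hasComplexModel_ten hε hρ hA hD hB hC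
    by_cases h2' : c.Δ₂ = 0
    · have nC : ‖c.C‖ = 1 := by
        rw [h2, nB] at h2'
        rw [← sq_eq_sq₀ (norm_nonneg _) zero_le_one]
        linarith
      exact HasRow.intro 20 ⟨nε, nρ, hr, n1, by rw [h2']; exact abs_zero, hd0 h2', hdim, nB,
        nC.trans nρ1.symm⟩ hf (List.mem_singleton.2 rfl) (hasModel_ten hε hA hD hρ hB nC)
    · exact HasRow.intro 21 ⟨nε, nρ, hr, n1, abs_pos.2 h2', hd h2', hdim, nB, norm_pos_iff.2 hC⟩
        hf (List.mem_singleton.2 rfl) (h15 (hd h2'))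
  have n1 : 0 < ‖c.Δ₁‖ := norm_pos_iff.2 h1'
  have hB : c.B ≠ 0 := by rintro hB; apply h1'; rw [h1, hB]; simp
  have hC : c.C ≠ 0 := by rintro hC; apply h1'; rw [h1, hC]; simp
  have nB := norm_pos_iff.2 hB
  have nC := norm_pos_iff.2 hC
  have hr := rank_X_eq_two h1'
  have hf := hasComplexModel_eleven hε hρ hA hD hB hC
  obtain hd | hd | hd := lt_trichotomy (‖c.Δ₁‖ ^ 2 - c.Δ₂ ^ 2) 0
  · have h2 : c.Δ₂ ≠ 0 := by rintro h; rw [h] at hd; nlinarith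
    exact HasRow.intro 24 ⟨nε, nρ, hr, n1, abs_pos.2 h2, hd, hdim, nB, nC⟩ hf
      (List.mem_singleton.2 rfl) (h15 hd)
  · have h2 : c.Δ₂ ≠ 0 := by rintro h; rw [h] at hd; nlinarith
    have hm := hasModel_of_zero hε hA hD hρ hB hC hd
    have hrow : (table.get (23 : Fin 25)).HoldsFor c :=
      ⟨nε, nρ, hr, n1, abs_pos.2 h2, hd, hdim, nB, nC⟩
    -- The table does not see `det N`, which is why both algebras stand in this row.
    by_cases hN : c.matN.det = 0
    · exact HasRow.intro 23 hrow hf List.mem_cons_self (hm.1 hN)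
    · exact HasRow.intro 23 hrow hf (List.mem_cons_of_mem _ List.mem_cons_self) (hm.2 hN)
  · have hm := hasModel_of_pos hε (.inr hρ) hA hD hd
    have hrow : (table.get (22 : Fin 25)).HoldsFor c :=
      ⟨nε, nρ, hr, n1, trivial, hd, hdim, nB, nC⟩
    by_cases hN : c.matN.det = 0
    · exact HasRow.intro 22 hrow hf List.mem_cons_self (hm.1 hN)
    · exact HasRow.intro 22 hrow hf (List.mem_cons_of_mem _ List.mem_cons_self) (hm.2 hN)

theorem Reduced.hasRow (h : c.Reduced) : c.HasRow := by
  obtain hε | hε := h.eps <;> obtain hρ | hρ := h.rho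
  · exact hasRow_of_eps_zero_of_rho_zero hε hρ
  · exact hasRow_of_eps_zero_of_rho_one hε hρ
  · obtain ⟨hA, hD⟩ := h.coeff hε
    refine hasRow_of_eps_one_of_rho_zero hε hρ hA hD ((h.nonzero hε).resolve_left ?_)
    rw [hρ]
    exact zero_ne_one
  · obtain ⟨hA, hD⟩ := h.coeff hε
    exact hasRow_of_eps_one_of_rho_one hε hρ hA hD

end Constants

theorem IsReduced.existsUnique_row {g : Type*} [LieRing g] [LieAlgebra ℝ g] {J : g →ₗ[ℝ] g}
    {ω : Module.Basis (Fin 3) ℂ (forms10 J)} {c : Constants} (h : IsReduced ω c) :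
    ∃! r : Row, r ∈ table ∧ r.Holds ω c := by
  obtain ⟨r, hr, hrc, -⟩ := h.reduced.hasRow
  refine ⟨r, ⟨hr, (Row.holds_iff h).2 hrc⟩, ?_⟩
  rintro r' ⟨hr', h'⟩
  exact ((Row.holds_iff h).1 h').unique hr' hr hrc

/-- The model found for the constants provides one `h_k` in the row. Any other `h_k'` isomorphic to
`g` has the same `lieClass`, hence is listed too. -/
theorem IsReduced.isomorphisms {g : Type*} [LieRing g] [LieAlgebra ℝ g] {J : g →ₗ[ℝ] g}
    (hJ : IsComplexStructure J) {ω : Module.Basis (Fin 3) ℂ (forms10 J)} {c : Constants}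
    (h : IsReduced ω c) {r : Row} (hr : r ∈ table) (hrc : r.Holds ω c) :
    Nonempty (f1 J hJ ≃ₗ⁅ℂ⁆ ℂ ⊗[ℝ] NilAlg r.f) ∧ (∃ k ∈ r.g, Nonempty (g ≃ₗ⁅ℝ⁆ NilAlg k)) ∧
      ∀ k ∈ Finset.Icc 1 16, Nonempty (g ≃ₗ⁅ℝ⁆ NilAlg k) → k ∈ r.g := by
  obtain ⟨r', hr', hrc', hf, k, hk, hg⟩ := h.reduced.hasRow
  obtain rfl := ((Row.holds_iff h).1 hrc).unique hr hr' hrc'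
  obtain ⟨φ⟩ := h.nonempty_lieEquiv hJ.sq hg
  refine ⟨h.nonempty_f1_lieEquiv hf, ⟨k, hk, ⟨φ⟩⟩, ?_⟩
  rintro k' hk' ⟨φ'⟩
  obtain ⟨hk1, hk2⟩ := table_lieClass r hr k hk
  apply hk2 k' hk'
  rw [← lieClass_nilAlg hk1, ← lieClass_nilAlg hk']
  exact lieClass_congr (φ.symm.trans φ')

/-! ### Realization of the reduced structure equations -/

section Transport

variable {g : Type*} [LieRing g] [LieAlgebra ℝ g]

/-- Multiplication by `i` on `ℂ³`, transported to `g`. -/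
def transportJ (ψ : (Fin 3 → ℂ) ≃ₗ[ℝ] g) : g →ₗ[ℝ] g where
  toFun x := ψ (Complex.I • ψ.symm x)
  map_add' x y := by simp only [map_add, smul_add]
  map_smul' r x := by
    rw [ψ.symm.map_smul, smul_comm Complex.I r, ψ.map_smul]
    rfl

theorem transportJ_apply (ψ : (Fin 3 → ℂ) ≃ₗ[ℝ] g) (x : g) :
    transportJ ψ x = ψ (Complex.I • ψ.symm x) := rfl

theorem transportJ_map (ψ : (Fin 3 → ℂ) ≃ₗ[ℝ] g) (v : Fin 3 → ℂ) :
    transportJ ψ (ψ v) = ψ (Complex.I • v) := by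
  rw [transportJ_apply, LinearEquiv.symm_apply_apply]

/-- The forms of type `(1,0)` on `g`, as linear forms on `ℂ³`. -/
def transportForms (ψ : (Fin 3 → ℂ) ≃ₗ[ℝ] g) : forms10 (transportJ ψ) ≃ₗ[ℂ] (Fin 3 → ℂ) where
  toFun α i := (α : g →ₗ[ℝ] ℂ) (ψ (Pi.single i 1))
  map_add' α β := rfl
  map_smul' s α := rfl
  invFun v := ⟨∑ i, v i • (LinearMap.proj i ∘ₗ ψ.symm.toLinearMap : g →ₗ[ℝ] ℂ), fun x => by
    simp only [LinearMap.sum_apply, LinearMap.smul_apply, LinearMap.comp_apply,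
      LinearEquiv.coe_coe, transportJ_apply, LinearEquiv.symm_apply_apply, LinearMap.proj_apply,
      Pi.smul_apply, smul_eq_mul, Finset.mul_sum]
    exact Finset.sum_congr rfl fun i _ => by ring⟩
  left_inv α := by
    have hsmul (s : ℂ) (v : Fin 3 → ℂ) :
        (α : g →ₗ[ℝ] ℂ) (ψ (s • v)) = s * (α : g →ₗ[ℝ] ℂ) (ψ v) := by
      have h : s • v = s.re • v + s.im • Complex.I • v := by
        funext i
        simp only [Pi.add_apply, Pi.smul_apply, Complex.real_smul, smul_eq_mul]
        nth_rewrite 1 [← Complex.re_add_im s]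
        ring
      rw [h, map_add, map_smul, map_smul, map_add, map_smul, map_smul, ← transportJ_map, α.2,
        Complex.real_smul, Complex.real_smul]
      nth_rewrite 3 [← Complex.re_add_im s]
      ring
    apply Subtype.ext
    ext x
    obtain ⟨v, rfl⟩ := ψ.surjective x
    have hv : v = ∑ i, v i • Pi.single i 1 := by
      funext j
      simp [Finset.sum_apply, Pi.single_apply]
    simp only [LinearMap.sum_apply, LinearMap.smul_apply, LinearMap.comp_apply,
      LinearEquiv.coe_coe, LinearEquiv.symm_apply_apply, LinearMap.proj_apply, smul_eq_mul]
    nth_rewrite 2 [hv]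
    simp only [map_sum, hsmul]
    exact Finset.sum_congr rfl fun i _ => mul_comm _ _
  right_inv v := by
    funext j
    simp [Pi.single_apply]

/-- The coordinates of `ℂ³`, as a basis of the forms of type `(1,0)` on `g`. -/
def transportBasis (ψ : (Fin 3 → ℂ) ≃ₗ[ℝ] g) : Module.Basis (Fin 3) ℂ (forms10 (transportJ ψ)) :=
  Module.Basis.ofEquivFun (transportForms ψ)

theorem transportBasis_apply (ψ : (Fin 3 → ℂ) ≃ₗ[ℝ] g) (j : Fin 3) (x : g) :
    (transportBasis ψ j : g →ₗ[ℝ] ℂ) x = ψ.symm x j := by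
  rw [transportBasis, Module.Basis.coe_ofEquivFun]
  change (∑ i, (Pi.single j 1 : Fin 3 → ℂ) i •
    (LinearMap.proj i ∘ₗ ψ.symm.toLinearMap : g →ₗ[ℝ] ℂ)) x = _
  simp [Pi.single_apply]

variable {c : Constants} {ψ : (Fin 3 → ℂ) ≃ₗ[ℝ] g}

theorem transport_dForm (hψ : ∀ x y, ψ (c.bracket x y) = ⁅ψ x, ψ y⁆) (j : Fin 3) (x y : g) :
    dForm (transportBasis ψ j : g →ₗ[ℝ] ℂ) x y = -c.bracket (ψ.symm x) (ψ.symm y) j := by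
  rw [dForm_apply, transportBasis_apply]
  have := hψ (ψ.symm x) (ψ.symm y)
  rw [LinearEquiv.apply_symm_apply, LinearEquiv.apply_symm_apply] at this
  rw [← this, LinearEquiv.symm_apply_apply]

theorem transport_isReduced (hc : c.Reduced) (hψ : ∀ x y, ψ (c.bracket x y) = ⁅ψ x, ψ y⁆) :
    IsReduced (transportBasis ψ) c where
  eps := hc.eps
  rho := hc.rho
  coeff := hc.coeff
  nonzero hε h := by
    have hf : ∀ x y, c.form x y = 0 := by
      intro x y
      have := LinearMap.congr_fun₂ h (ψ x) (ψ y)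
      rw [transport_dForm hψ, LinearEquiv.symm_apply_apply, LinearEquiv.symm_apply_apply,
        Constants.bracket_two, neg_neg] at this
      exact this
    obtain ⟨hρ, hX⟩ := Constants.form_eq_zero_iff.1 hf
    obtain h | h | h := hc.nonzero hε
    · exact one_ne_zero (h.symm.trans hρ)
    · exact h (congrFun₂ hX 0 1)
    · exact h (congrFun₂ hX 1 0)
  d_one := LinearMap.ext₂ fun x y => by
    rw [transport_dForm hψ, Constants.bracket_zero, neg_zero]
    rfl
  d_two := LinearMap.ext₂ fun x y => by
    simp only [transport_dForm hψ, Constants.bracket_one, LinearMap.smul_apply, wedge_apply,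
      conjForm_apply, transportBasis_apply, neg_neg, smul_eq_mul]
  d_three := LinearMap.ext₂ fun x y => by
    simp only [transport_dForm hψ, Constants.bracket_two, LinearMap.add_apply,
      LinearMap.smul_apply, wedge_apply, conjForm_apply, transportBasis_apply, neg_neg,
      smul_eq_mul, Constants.form]

/-- The torsion vanishes because no `dω^j` contains a term of type `(0,2)`. The basis is nilpotent
because `dω^j` involves only earlier forms and their conjugates. -/
theorem transport_isNilpotent (hc : c.Reduced) (hψ : ∀ x y, ψ (c.bracket x y) = ⁅ψ x, ψ y⁆) :
    IsNilpotentComplexStructure (transportJ ψ) where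
  sq x := by
    obtain ⟨v, rfl⟩ := ψ.surjective x
    rw [transportJ_map, transportJ_map, smul_smul, Complex.I_mul_I, neg_one_smul, map_neg]
  integrable x y := by
    obtain ⟨v, rfl⟩ := ψ.surjective x
    obtain ⟨w, rfl⟩ := ψ.surjective y
    simp only [transportJ_map, ← hψ, ← map_add, ← map_sub]
    rw [map_eq_zero_iff _ ψ.injective]
    funext k
    have hI := Complex.I_mul_I
    fin_cases k
    · simp
    · simp [-mul_eq_zero]
      linear_combination -c.ε * (v 0 * conj (w 0) - w 0 * conj (v 0)) * hI
    · simp [Constants.form, -mul_eq_zero]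
      linear_combination -(c.ρ * (v 0 * w 1 - w 0 * v 1) +
        c.A * (v 0 * conj (w 0) - w 0 * conj (v 0)) + c.B * (v 0 * conj (w 1) - w 0 * conj (v 1)) +
        c.C * (v 1 * conj (w 0) - w 1 * conj (v 0)) +
        c.D * (v 1 * conj (w 1) - w 1 * conj (v 1))) * hI
  exists_basis := by
    have h := transport_isReduced hc hψ
    refine ⟨3, transportBasis ψ, fun p => ?_⟩
    set ω := transportBasis ψ
    have hmem {S : Set (g →ₗ[ℝ] g →ₗ[ℝ] ℂ)} {β : g →ₗ[ℝ] g →ₗ[ℝ] ℂ} (s : ℂ) (hβ : β ∈ S) :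
        s • β ∈ Submodule.span ℂ S := Submodule.smul_mem _ _ (Submodule.subset_span hβ)
    fin_cases p
    · change dForm (ω 0 : g →ₗ[ℝ] ℂ) ∈ _
      rw [h.d_one]
      exact Submodule.zero_mem _
    · change dForm (ω 1 : g →ₗ[ℝ] ℂ) ∈ _
      rw [h.d_two]
      exact hmem _ ⟨_, _, ⟨0, by decide, .inl rfl⟩, ⟨0, by decide, .inr rfl⟩, rfl⟩
    · change dForm (ω 2 : g →ₗ[ℝ] ℂ) ∈ _
      rw [h.d_three]
      refine add_mem (add_mem (add_mem (add_mem (hmem _ ?_) (hmem _ ?_)) (hmem _ ?_))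
        (hmem _ ?_)) (hmem _ ?_)
      · exact ⟨_, _, ⟨0, by decide, .inl rfl⟩, ⟨1, by decide, .inl rfl⟩, rfl⟩
      · exact ⟨_, _, ⟨0, by decide, .inl rfl⟩, ⟨0, by decide, .inr rfl⟩, rfl⟩
      · exact ⟨_, _, ⟨0, by decide, .inl rfl⟩, ⟨1, by decide, .inr rfl⟩, rfl⟩
      · exact ⟨_, _, ⟨1, by decide, .inl rfl⟩, ⟨0, by decide, .inr rfl⟩, rfl⟩
      · exact ⟨_, _, ⟨1, by decide, .inl rfl⟩, ⟨1, by decide, .inr rfl⟩, rfl⟩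

end Transport

/-- The entries of the row of `c` that distinguish it from the other rows. -/
def Constants.signature (c : Constants) : ℕ × ℕ × ℕ × ℕ × ℕ × ℕ :=
  (signCode ‖c.ε‖, signCode ‖c.ρ‖, c.X.rank, signCode (‖c.Δ₁‖ ^ 2 - c.Δ₂ ^ 2),
    c.dim, if signCode ‖c.ε‖ = 1 then signCode ‖c.C‖ else 0)

/-- The signature alone suffices: the classification puts `c` into some row, which must be `r`, so
all remaining entries and a model on an algebra of the row come for free. The hypothesis `hk`
selects the algebra when the row lists two. -/
theorem Constants.Reduced.realized {c : Constants} (hc : c.Reduced) {r : Row} (hr : r ∈ table)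
    (hs : r.signature = c.signature) {k : ℕ} (hk : ∀ k' ∈ r.g, c.HasModel k' → c.HasModel k)
    {P : Constants → Prop} (hP : P c) : Realized r k P := by
  obtain ⟨r', hr', hrc, -, k', hk', hm⟩ := hc.hasRow
  obtain rfl : r' = r :=
    List.inj_on_of_nodup_map table_signature hr' hr ((hrc.signature_eq hr').trans hs.symm)
  obtain ⟨ψ, hψ⟩ := (hk k' hk' hm).exists_equiv
  have h := transport_isReduced hc hψ
  exact ⟨_, _, c, transport_isNilpotent hc hψ, h, (Row.holds_iff h).2 hrc, hP⟩

theorem Realized.mono {r : Row} {k : ℕ} {P Q : Constants → Prop} (h : Realized r k P)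
    (hPQ : ∀ c, P c → Q c) : Realized r k Q := by
  obtain ⟨J, ω, c, h1, h2, h3, h4⟩ := h
  exact ⟨J, ω, c, h1, h2, h3, hPQ c h4⟩

/-! ### Examples for the rows of the table -/

theorem signCode_of_neg {v : ℝ} (h : v < 0) : signCode v = 2 := by
  rw [signCode, if_neg h.ne, if_neg h.not_gt]

theorem signCode_of_eq {v : ℝ} (h : v = 0) : signCode v = 0 := if_pos h

namespace Constants

/-- Real constants. -/
def ofReal (e p a b c d : ℝ) : Constants := ⟨e, p, a, b, c, d⟩

variable (e p a b c d : ℝ)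

theorem Δ₁_ofReal : (ofReal e p a b c d).Δ₁ = ((a * d - b * c : ℝ) : ℂ) := by
  simp [ofReal, Δ₁]

theorem Δ₂_ofReal : (ofReal e p a b c d).Δ₂ = (b ^ 2 + c ^ 2 - 2 * a * d - p ^ 2) / 2 := by
  simp [ofReal, Δ₂]
  ring

theorem diff_ofReal : ‖(ofReal e p a b c d).Δ₁‖ ^ 2 - (ofReal e p a b c d).Δ₂ ^ 2 =
    (a * d - b * c) ^ 2 - ((b ^ 2 + c ^ 2 - 2 * a * d - p ^ 2) / 2) ^ 2 := by
  rw [Δ₁_ofReal, Δ₂_ofReal, Complex.norm_real, Real.norm_eq_abs, sq_abs]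

variable {e p a b c d}

theorem Δ₁_ofReal_ne (h : a * d - b * c ≠ 0) : (ofReal e p a b c d).Δ₁ ≠ 0 := by
  rw [Δ₁_ofReal]
  exact_mod_cast h

theorem rank_ofReal_eq_one (h : a * d - b * c = 0) (h' : a ≠ 0 ∨ b ≠ 0 ∨ c ≠ 0) :
    (ofReal e p a b c d).X.rank = 1 := by
  refine rank_X_eq_one (by rw [Δ₁_ofReal, h, Complex.ofReal_zero]) fun hX => ?_
  obtain h | h | h := h'
  · exact h (Complex.ofReal_eq_zero.1 (congrFun₂ hX 0 0))
  · exact h (Complex.ofReal_eq_zero.1 (congrFun₂ hX 0 1))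
  · exact h (Complex.ofReal_eq_zero.1 (congrFun₂ hX 1 0))

theorem rank_ofReal_eq_zero : (ofReal e p 0 0 0 0).X.rank = 0 := by
  have : (ofReal e p 0 0 0 0).X = 0 := by
    ext i j
    fin_cases i <;> fin_cases j <;> simp [X, ofReal]
  rw [this, Matrix.rank_zero]

/-- The invariants of `c` are the distinguishing entries of the `i`-th row. -/
def Fits (i : Fin 25) (c : Constants) : Prop := (table.get i).signature = c.signature

theorem fits_of_eps_zero (i : Fin 25) {c : Constants} (hε : c.ε = 0) {n₁ n₂ n₃ n₄ : ℕ}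
    (h1 : signCode ‖c.ρ‖ = n₁) (h2 : c.X.rank = n₂)
    (h3 : signCode (‖c.Δ₁‖ ^ 2 - c.Δ₂ ^ 2) = n₃) (h4 : c.dim = n₄)
    (hs : (table.get i).signature = (0, n₁, n₂, n₃, n₄, 0)) : c.Fits i := by
  rw [Fits, hs, signature, h1, h2, h3, h4, hε, norm_zero, signCode_of_eq rfl, if_neg (by norm_num)]

theorem fits_of_eps_one (i : Fin 25) {c : Constants} (hε : c.ε = 1) {n₁ n₂ n₃ n₄ n₅ : ℕ}
    (h1 : signCode ‖c.ρ‖ = n₁) (h2 : c.X.rank = n₂)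
    (h3 : signCode (‖c.Δ₁‖ ^ 2 - c.Δ₂ ^ 2) = n₃) (h4 : c.dim = n₄) (h5 : signCode ‖c.C‖ = n₅)
    (hs : (table.get i).signature = (1, n₁, n₂, n₃, n₄, n₅)) : c.Fits i := by
  rw [Fits, hs, signature, h1, h2, h3, h4, h5, hε, norm_one, signCode_of_pos one_pos, if_pos rfl]

theorem signCode_rho_zero {c : Constants} (h : c.ρ = 0) : signCode ‖c.ρ‖ = 0 :=
  signCode_of_eq (by rw [h, norm_zero])

theorem signCode_rho_one {c : Constants} (h : c.ρ = 1) : signCode ‖c.ρ‖ = 1 :=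
  signCode_of_pos (by rw [h, norm_one]; exact one_pos)

theorem reduced_of_eps_zero {c : Constants} (hε : c.ε = 0) (hρ : c.ρ = 0 ∨ c.ρ = 1) :
    c.Reduced :=
  ⟨.inl hε, hρ, fun h => absurd (hε.symm.trans h) zero_ne_one,
    fun h => absurd (hε.symm.trans h) zero_ne_one⟩

theorem reduced_of_eps_one {c : Constants} (hε : c.ε = 1) (hρ : c.ρ = 0 ∨ c.ρ = 1) (hA : c.A = 0)
    (hD : c.D = 0) (h : c.ρ = 1 ∨ c.B ≠ 0 ∨ c.C ≠ 0) : c.Reduced :=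
  ⟨.inr hε, hρ, fun _ => ⟨hA, hD⟩, fun _ => h⟩

theorem Reduced.realized_singleton {c : Constants} (hc : c.Reduced) (i : Fin 25) (hs : c.Fits i)
    {k : ℕ} (hk : (table.get i).g = [k]) {P : Constants → Prop} (hP : P c) :
    Realized (table.get i) k P :=
  hc.realized (List.get_mem table i) hs
    (fun k' hk' h => by rw [hk, List.mem_singleton] at hk'; rwa [← hk']) hP

theorem Reduced.realized_of_hasModel {c : Constants} (hc : c.Reduced) (i : Fin 25) (hs : c.Fits i)
    {k : ℕ} (hk : c.HasModel k) {P : Constants → Prop} (hP : P c) : Realized (table.get i) k P :=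
  hc.realized (List.get_mem table i) hs (fun _ _ _ => hk) hP

/-! #### Rows with `ε = 0` and `ρ = 0` -/

/-- If `s X` is Hermitian, its off-diagonal entries are conjugate. Unequal moduli of `B` and `C`
therefore show that `d = 2`. -/
theorem Dependent.norm_eq {c : Constants} (h : c.Dependent) : ‖c.B‖ = ‖c.C‖ := by
  have hρ := h.rho
  obtain ⟨s, hs, h⟩ := h
  have h3 := h ![1, 0, 0] ![0, 1, 0]
  have h4 := h ![1, 0, 0] ![0, Complex.I, 0]
  simp [form, hρ] at h3 h4
  have hB : s * c.C = conj (s * c.B) := Complex.ext (by simp; linarith) (by simp; linarith)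
  have hn := congrArg norm hB
  rw [Complex.norm_conj, norm_mul, norm_mul] at hn
  exact (mul_left_cancel₀ (norm_ne_zero_iff.2 hs) hn).symm

theorem realized_row_one : Realized (table.get (0 : Fin 25)) 1 fun _ => True := by
  have hε : (ofReal 0 0 0 0 0 0).ε = 0 := Complex.ofReal_zero
  have hρ : (ofReal 0 0 0 0 0 0).ρ = 0 := Complex.ofReal_zero
  refine (reduced_of_eps_zero hε (.inl hρ)).realized_singleton _
    (fits_of_eps_zero _ hε (signCode_rho_zero hρ) rank_ofReal_eq_zero
      (signCode_of_eq (by rw [diff_ofReal]; norm_num)) (n₄ := 0) ?_ rfl) rfl trivial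
  rw [dim, if_pos]
  intro x y
  simp [form, ofReal]

theorem realized_row_two (t : ℝ) : Realized (table.get (1 : Fin 25)) 8 fun c =>
    ‖c.B‖ = |t| ∧ ‖c.C‖ = |t| := by
  have hε : (ofReal 0 0 1 t t (t ^ 2)).ε = 0 := Complex.ofReal_zero
  have hρ : (ofReal 0 0 1 t t (t ^ 2)).ρ = 0 := Complex.ofReal_zero
  have h1 : (1 : ℝ) * t ^ 2 - t * t = 0 := by ring
  have hX : (ofReal 0 0 1 t t (t ^ 2)).X ≠ 0 := fun h =>
    one_ne_zero (Complex.ofReal_eq_zero.1 (congrFun₂ h 0 0))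
  refine (reduced_of_eps_zero hε (.inl hρ)).realized_singleton _
    (fits_of_eps_zero _ hε (signCode_rho_zero hρ) (rank_ofReal_eq_one h1 (.inl one_ne_zero))
      (signCode_of_eq (by rw [diff_ofReal]; ring)) (dim_eq_one (dependent_of_rank_one hρ
        (by rw [Δ₁_ofReal, h1, Complex.ofReal_zero]) (by rw [Δ₂_ofReal]; ring) hX) hX) rfl) rfl
      ⟨Complex.norm_real t, Complex.norm_real t⟩

/-- `D = bc` makes `X` of rank one, and `2Δ₂ = (b - c)² = 1`. -/
theorem realized_row_three {b c : ℝ} (h : (b - c) ^ 2 = 1) :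
    Realized (table.get (2 : Fin 25)) 5 fun k => ‖k.B‖ = |b| ∧ ‖k.C‖ = |c| := by
  have hε : (ofReal 0 0 1 b c (b * c)).ε = 0 := Complex.ofReal_zero
  have hρ : (ofReal 0 0 1 b c (b * c)).ρ = 0 := Complex.ofReal_zero
  have hd : ‖(ofReal 0 0 1 b c (b * c)).Δ₁‖ ^ 2 - (ofReal 0 0 1 b c (b * c)).Δ₂ ^ 2 < 0 := by
    rw [diff_ofReal]
    have : b ^ 2 + c ^ 2 - 2 * 1 * (b * c) - 0 ^ 2 = 1 := by linear_combination h
    rw [this]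
    ring_nf
    norm_num
  exact (reduced_of_eps_zero hε (.inl hρ)).realized_singleton _
    (fits_of_eps_zero _ hε (signCode_rho_zero hρ)
      (rank_ofReal_eq_one (by ring) (.inl one_ne_zero)) (signCode_of_neg hd)
      (dim_eq_two (not_dependent_of_diff hd.ne)) rfl) rfl ⟨Complex.norm_real b, Complex.norm_real c⟩

/-- With `A = 1`, `D = i`, `B = C = t` the term `A conj D + conj A D` vanishes, so `Δ₂` is free to
move with `t` while `|Δ₁|² = 1 + t⁴` stays above `Δ₂²` for `p = 0` and `p = 1`. -/
theorem diff_I (p t : ℝ) : ‖(⟨0, p, 1, t, t, Complex.I⟩ : Constants).Δ₁‖ ^ 2 -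
    (⟨0, p, 1, t, t, Complex.I⟩ : Constants).Δ₂ ^ 2 =
      1 + t ^ 4 - ((2 * t ^ 2 - p ^ 2) / 2) ^ 2 := by
  rw [norm_sq_eq]
  simp [Δ₁, Δ₂]
  ring

theorem Δ₁_I_ne (p t : ℝ) : (⟨0, p, 1, t, t, Complex.I⟩ : Constants).Δ₁ ≠ 0 := by
  intro h
  simpa [Δ₁] using congrArg Complex.im h

theorem Δ₂_I (p t : ℝ) :
    (⟨0, p, 1, t, t, Complex.I⟩ : Constants).Δ₂ = t ^ 2 - p ^ 2 / 2 := by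
  simp [Δ₂]
  ring

theorem realized_row_four (t : ℝ) : Realized (table.get (3 : Fin 25)) 2 fun c =>
    ‖c.B‖ = |t| ∧ ‖c.C‖ = |t| ∧ c.Δ₂ = t ^ 2 := by
  have hρ : (⟨0, (0 : ℝ), 1, t, t, Complex.I⟩ : Constants).ρ = 0 := Complex.ofReal_zero
  have hd : 0 < ‖(⟨0, (0 : ℝ), 1, t, t, Complex.I⟩ : Constants).Δ₁‖ ^ 2 -
      (⟨0, (0 : ℝ), 1, t, t, Complex.I⟩ : Constants).Δ₂ ^ 2 := by
    rw [diff_I]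
    ring_nf
    norm_num
  exact (reduced_of_eps_zero rfl (.inl hρ)).realized_singleton _
    (fits_of_eps_zero _ rfl (signCode_rho_zero hρ) (rank_X_eq_two (Δ₁_I_ne 0 t))
      (signCode_of_pos hd) (dim_eq_two (not_dependent_of_diff hd.ne')) rfl) rfl
    ⟨Complex.norm_real t, Complex.norm_real t, by rw [Δ₂_I]; ring⟩

theorem realized_row_five (t : ℝ) : Realized (table.get (4 : Fin 25)) 3 fun c =>
    ‖c.B‖ = |t| ∧ ‖c.C‖ = |t| := by
  have hε : (ofReal 0 0 1 t t (-1)).ε = 0 := Complex.ofReal_zero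
  have hρ : (ofReal 0 0 1 t t (-1)).ρ = 0 := Complex.ofReal_zero
  have hX : (ofReal 0 0 1 t t (-1)).X ≠ 0 := fun h =>
    one_ne_zero (Complex.ofReal_eq_zero.1 (congrFun₂ h 0 0))
  exact (reduced_of_eps_zero hε (.inl hρ)).realized_singleton _
    (fits_of_eps_zero _ hε (signCode_rho_zero hρ)
      (rank_X_eq_two (Δ₁_ofReal_ne (by nlinarith [sq_nonneg t])))
      (signCode_of_eq (by rw [diff_ofReal]; ring)) (dim_eq_one (dependent_of one_ne_zero hρ
        (by simp [ofReal]) (by simp [ofReal]) (by simp [ofReal])) hX) rfl) rfl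
      ⟨Complex.norm_real t, Complex.norm_real t⟩

/-- `D` is chosen so that `Δ₁ = Δ₂ = (b - c)²/4`; since `b` and `c` are nonnegative and different,
`|B| ≠ |C|`. -/
theorem realized_row_six {b c : ℝ} (h : (b - c) ^ 2 = 1) (hb : 0 ≤ b) (hc : 0 ≤ c) :
    Realized (table.get (5 : Fin 25)) 4 fun k => ‖k.B‖ = |b| ∧ ‖k.C‖ = |c| := by
  have hε : (ofReal 0 0 1 b c ((b + c) ^ 2 / 4)).ε = 0 := Complex.ofReal_zero
  have hρ : (ofReal 0 0 1 b c ((b + c) ^ 2 / 4)).ρ = 0 := Complex.ofReal_zero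
  refine (reduced_of_eps_zero hε (.inl hρ)).realized_singleton _
    (fits_of_eps_zero _ hε (signCode_rho_zero hρ)
      (rank_X_eq_two (Δ₁_ofReal_ne (by nlinarith)))
      (signCode_of_eq (by rw [diff_ofReal]; ring)) (dim_eq_two fun hdep => ?_) rfl) rfl
      ⟨Complex.norm_real b, Complex.norm_real c⟩
  have hn := hdep.norm_eq
  change ‖(b : ℂ)‖ = ‖(c : ℂ)‖ at hn
  rw [Complex.norm_of_nonneg hb, Complex.norm_of_nonneg hc] at hn
  rw [hn] at h
  norm_num at h

theorem realized_row_seven {b c : ℝ} (h : (b - c) ^ 2 = 1) (hb : 0 ≤ b) (hc : 0 ≤ c) :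
    Realized (table.get (6 : Fin 25)) 5 fun k => ‖k.B‖ = |b| ∧ ‖k.C‖ = |c| := by
  have hε : (ofReal 0 0 1 b c (-1)).ε = 0 := Complex.ofReal_zero
  have hρ : (ofReal 0 0 1 b c (-1)).ρ = 0 := Complex.ofReal_zero
  have hbc := mul_nonneg hb hc
  have hd : ‖(ofReal 0 0 1 b c (-1)).Δ₁‖ ^ 2 - (ofReal 0 0 1 b c (-1)).Δ₂ ^ 2 < 0 := by
    rw [diff_ofReal]
    have : b ^ 2 + c ^ 2 - 2 * 1 * -1 - 0 ^ 2 = 2 * (b * c) + 3 := by linear_combination h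
    rw [this]
    nlinarith
  exact (reduced_of_eps_zero hε (.inl hρ)).realized_singleton _
    (fits_of_eps_zero _ hε (signCode_rho_zero hρ)
      (rank_X_eq_two (Δ₁_ofReal_ne (by linarith))) (signCode_of_neg hd)
      (dim_eq_two (not_dependent_of_diff hd.ne)) rfl) rfl ⟨Complex.norm_real b, Complex.norm_real c⟩

/-! #### Rows with `ε = 0` and `ρ = 1` -/

theorem realized_row_eight : Realized (table.get (7 : Fin 25)) 5 fun _ => True := by
  have hε : (ofReal 0 1 0 0 0 0).ε = 0 := Complex.ofReal_zero
  have hρ : (ofReal 0 1 0 0 0 0).ρ = 1 := Complex.ofReal_one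
  exact (reduced_of_eps_zero hε (.inr hρ)).realized_singleton _
    (fits_of_eps_zero _ hε (signCode_rho_one hρ) rank_ofReal_eq_zero
      (signCode_of_neg (by rw [diff_ofReal]; norm_num))
      (dim_eq_two (not_dependent_of_rho hρ)) rfl) rfl trivial

/-- Here `Δ₁ = 0`, and `(b - c)² = 1` cancels `|ρ|²` in `Δ₂`. -/
theorem realized_row_nine {b c : ℝ} (h : (b - c) ^ 2 = 1) :
    Realized (table.get (8 : Fin 25)) 6 fun k => ‖k.B‖ = |b| ∧ ‖k.C‖ = |c| := by
  have hε : (ofReal 0 1 1 b c (b * c)).ε = 0 := Complex.ofReal_zero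
  have hρ : (ofReal 0 1 1 b c (b * c)).ρ = 1 := Complex.ofReal_one
  refine (reduced_of_eps_zero hε (.inr hρ)).realized_singleton _
    (fits_of_eps_zero _ hε (signCode_rho_one hρ)
      (rank_ofReal_eq_one (by ring) (.inl one_ne_zero)) (signCode_of_eq ?_)
      (dim_eq_two (not_dependent_of_rho hρ)) rfl) rfl ⟨Complex.norm_real b, Complex.norm_real c⟩
  rw [diff_ofReal]
  have : b ^ 2 + c ^ 2 - 2 * 1 * (b * c) - 1 ^ 2 = 0 := by linear_combination h
  rw [this]
  ring

theorem realized_row_ten (t : ℝ) : Realized (table.get (9 : Fin 25)) 5 fun c =>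
    ‖c.B‖ = |t| ∧ ‖c.C‖ = |t| := by
  have hε : (ofReal 0 1 1 t t (t ^ 2)).ε = 0 := Complex.ofReal_zero
  have hρ : (ofReal 0 1 1 t t (t ^ 2)).ρ = 1 := Complex.ofReal_one
  exact (reduced_of_eps_zero hε (.inr hρ)).realized_singleton _
    (fits_of_eps_zero _ hε (signCode_rho_one hρ)
      (rank_ofReal_eq_one (by ring) (.inl one_ne_zero))
      (signCode_of_neg (by rw [diff_ofReal]; ring_nf; norm_num))
      (dim_eq_two (not_dependent_of_rho hρ)) rfl) rfl ⟨Complex.norm_real t, Complex.norm_real t⟩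

theorem realized_row_eleven (t : ℝ) : Realized (table.get (10 : Fin 25)) 2 fun c =>
    ‖c.B‖ = |t| ∧ ‖c.C‖ = |t| ∧ c.Δ₂ = t ^ 2 - 1 / 2 := by
  have hρ : (⟨0, (1 : ℝ), 1, t, t, Complex.I⟩ : Constants).ρ = 1 := Complex.ofReal_one
  exact (reduced_of_eps_zero rfl (.inr hρ)).realized_singleton _
    (fits_of_eps_zero _ rfl (signCode_rho_one hρ) (rank_X_eq_two (Δ₁_I_ne 1 t))
      (signCode_of_pos (by rw [diff_I]; nlinarith [sq_nonneg t]))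
      (dim_eq_two (not_dependent_of_rho hρ)) rfl) rfl
    ⟨Complex.norm_real t, Complex.norm_real t, by rw [Δ₂_I]; ring⟩

/-- This `D` gives `Δ₁ = Δ₂ = -1/4` for every `t`. -/
theorem realized_row_twelve (t : ℝ) : Realized (table.get (11 : Fin 25)) 4 fun c =>
    ‖c.B‖ = |t| ∧ ‖c.C‖ = |t| := by
  have hε : (ofReal 0 1 1 t t (t ^ 2 - 1 / 4)).ε = 0 := Complex.ofReal_zero
  have hρ : (ofReal 0 1 1 t t (t ^ 2 - 1 / 4)).ρ = 1 := Complex.ofReal_one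
  exact (reduced_of_eps_zero hε (.inr hρ)).realized_singleton _
    (fits_of_eps_zero _ hε (signCode_rho_one hρ)
      (rank_X_eq_two (Δ₁_ofReal_ne (by ring_nf; norm_num)))
      (signCode_of_eq (by rw [diff_ofReal]; ring))
      (dim_eq_two (not_dependent_of_rho hρ)) rfl) rfl ⟨Complex.norm_real t, Complex.norm_real t⟩

theorem realized_row_thirteen (t : ℝ) : Realized (table.get (12 : Fin 25)) 5 fun c =>
    ‖c.B‖ = |t| ∧ ‖c.C‖ = |t| := by
  have hε : (ofReal 0 1 1 t t (1 + t ^ 2)).ε = 0 := Complex.ofReal_zero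
  have hρ : (ofReal 0 1 1 t t (1 + t ^ 2)).ρ = 1 := Complex.ofReal_one
  exact (reduced_of_eps_zero hε (.inr hρ)).realized_singleton _
    (fits_of_eps_zero _ hε (signCode_rho_one hρ)
      (rank_X_eq_two (Δ₁_ofReal_ne (by ring_nf; norm_num)))
      (signCode_of_neg (by rw [diff_ofReal]; ring_nf; norm_num))
      (dim_eq_two (not_dependent_of_rho hρ)) rfl) rfl ⟨Complex.norm_real t, Complex.norm_real t⟩

end Constants

namespace Constants

/-! #### Rows with `ε = 1` -/

theorem reduced_ofReal_one {p b c : ℝ} (hp : p = 0 ∨ p = 1) (h : p = 1 ∨ b ≠ 0 ∨ c ≠ 0) :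
    (ofReal 1 p 0 b c 0).Reduced := by
  refine reduced_of_eps_one Complex.ofReal_one ?_ Complex.ofReal_zero Complex.ofReal_zero ?_ <;>
  · simp only [ofReal]
    exact_mod_cast by assumption

theorem fits_ofReal_one (i : Fin 25) {p b c : ℝ} {n₁ n₂ n₃ n₄ n₅ : ℕ} (h1 : signCode |p| = n₁)
    (h2 : (ofReal 1 p 0 b c 0).X.rank = n₂)
    (h3 : signCode ((b * c) ^ 2 - ((b ^ 2 + c ^ 2 - p ^ 2) / 2) ^ 2) = n₃)
    (h4 : (ofReal 1 p 0 b c 0).dim = n₄) (h5 : signCode |c| = n₅)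
    (hs : (table.get i).signature = (1, n₁, n₂, n₃, n₄, n₅)) : (ofReal 1 p 0 b c 0).Fits i := by
  refine fits_of_eps_one i Complex.ofReal_one ?_ h2 ?_ h4 ?_ hs
  · rw [← h1]
    exact congrArg signCode (Complex.norm_real p)
  · rw [diff_ofReal, ← h3]
    congr 1
    ring
  · rw [← h5]
    exact congrArg signCode (Complex.norm_real c)

theorem dim_ofReal_of_diff {p b c : ℝ} (h : (b * c) ^ 2 - ((b ^ 2 + c ^ 2 - p ^ 2) / 2) ^ 2 ≠ 0) :
    (ofReal 1 p 0 b c 0).dim = 2 := by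
  refine dim_eq_two (not_dependent_of_diff ?_)
  rw [diff_ofReal]
  convert h using 1
  ring

theorem dim_ofReal_of_rho {b c : ℝ} : (ofReal 1 1 0 b c 0).dim = 2 :=
  dim_eq_two (not_dependent_of_rho Complex.ofReal_one)

theorem realized_row_fourteen : Realized (table.get (13 : Fin 25)) 15 fun _ => True :=
  (reduced_ofReal_one (p := 0) (b := 1) (c := 0) (by norm_num) (by norm_num)).realized_singleton _
    (fits_ofReal_one _ (signCode_of_eq (by norm_num)) (rank_ofReal_eq_one (by norm_num)
      (by norm_num)) (signCode_of_neg (by norm_num)) (dim_ofReal_of_diff (by norm_num))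
      (signCode_of_eq (by norm_num)) rfl) rfl trivial

theorem realized_row_fifteen : Realized (table.get (14 : Fin 25)) 15 fun _ => True :=
  (reduced_ofReal_one (p := 0) (b := 0) (c := 1) (by norm_num) (by norm_num)).realized_singleton _
    (fits_ofReal_one _ (signCode_of_eq (by norm_num)) (rank_ofReal_eq_one (by norm_num)
      (by norm_num)) (signCode_of_neg (by norm_num)) (dim_ofReal_of_diff (by norm_num))
      (signCode_of_pos (by norm_num)) rfl) rfl trivial

theorem realized_row_sixteen : Realized (table.get (15 : Fin 25)) 9 fun _ => True := by
  have h1 : (ofReal 1 0 0 1 1 0).Δ₁ ≠ 0 := Δ₁_ofReal_ne (by norm_num)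
  refine (reduced_ofReal_one (p := 0) (b := 1) (c := 1) (by norm_num)
    (by norm_num)).realized_singleton _
    (fits_ofReal_one _ (signCode_of_eq (by norm_num)) (rank_X_eq_two h1)
      (signCode_of_eq (by norm_num))
      (dim_eq_one (dependent_of_norm_eq ?_ ?_ ?_ ?_ rfl) (X_ne_zero h1))
      (signCode_of_pos (by norm_num)) rfl) rfl trivial <;> simp [ofReal]

theorem realized_row_seventeen : Realized (table.get (16 : Fin 25)) 15 fun _ => True :=
  (reduced_ofReal_one (p := 0) (b := 2) (c := 1) (by norm_num) (by norm_num)).realized_singleton _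
    (fits_ofReal_one _ (signCode_of_eq (by norm_num))
      (rank_X_eq_two (Δ₁_ofReal_ne (by norm_num))) (signCode_of_neg (by norm_num))
      (dim_ofReal_of_diff (by norm_num)) (signCode_of_pos (by norm_num)) rfl) rfl trivial

theorem realized_row_eighteen : Realized (table.get (17 : Fin 25)) 15 fun _ => True :=
  (reduced_ofReal_one (p := 1) (b := 0) (c := 0) (by norm_num) (by norm_num)).realized_singleton _
    (fits_ofReal_one _ (signCode_of_pos (by norm_num)) rank_ofReal_eq_zero
      (signCode_of_neg (by norm_num)) dim_ofReal_of_rho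
      (signCode_of_eq (by norm_num)) rfl) rfl trivial

theorem fits_row_nineteen {b : ℝ} (hb : b ^ 2 = 1) :
    (ofReal 1 1 0 b 0 0).Fits (18 : Fin 25) := by
  have hb0 : b ≠ 0 := by rintro rfl; norm_num at hb
  exact fits_ofReal_one _ (signCode_of_pos (by norm_num)) (rank_ofReal_eq_one (by norm_num)
    (.inr (.inl hb0))) (signCode_of_eq (by rw [hb]; norm_num)) dim_ofReal_of_rho
    (signCode_of_eq (by norm_num)) rfl

theorem realized_row_nineteen_seven : Realized (table.get (18 : Fin 25)) 7 fun _ => True :=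
  (reduced_ofReal_one (p := 1) (b := 1) (c := 0) (by norm_num)
    (by norm_num)).realized_of_hasModel _ (fits_row_nineteen (by norm_num))
    (hasModel_seven Complex.ofReal_one Complex.ofReal_zero Complex.ofReal_zero Complex.ofReal_one
      Complex.ofReal_one Complex.ofReal_zero) trivial

theorem realized_row_nineteen_sixteen : Realized (table.get (18 : Fin 25)) 16 fun _ => True := by
  refine (reduced_ofReal_one (p := 1) (b := -1) (c := 0) (by norm_num)
    (by norm_num)).realized_of_hasModel _ (fits_row_nineteen (by norm_num))
    (hasModel_sixteen Complex.ofReal_one Complex.ofReal_zero Complex.ofReal_zero Complex.ofReal_one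
      ?_ ?_ Complex.ofReal_zero) trivial
  · simp only [ofReal]
    norm_num
  · simp [ofReal]

theorem realized_row_twenty : Realized (table.get (19 : Fin 25)) 15 fun _ => True :=
  (reduced_ofReal_one (p := 1) (b := 2) (c := 0) (by norm_num) (by norm_num)).realized_singleton _
    (fits_ofReal_one _ (signCode_of_pos (by norm_num)) (rank_ofReal_eq_one (by norm_num)
      (by norm_num)) (signCode_of_neg (by norm_num)) dim_ofReal_of_rho
      (signCode_of_eq (by norm_num)) rfl) rfl trivial

theorem realized_row_twentyone : Realized (table.get (20 : Fin 25)) 10 fun _ => True :=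
  (reduced_ofReal_one (p := 1) (b := 0) (c := 1) (by norm_num) (by norm_num)).realized_singleton _
    (fits_ofReal_one _ (signCode_of_pos (by norm_num)) (rank_ofReal_eq_one (by norm_num)
      (by norm_num)) (signCode_of_eq (by norm_num)) dim_ofReal_of_rho
      (signCode_of_pos (by norm_num)) rfl) rfl trivial

theorem realized_row_twentytwo : Realized (table.get (21 : Fin 25)) 15 fun _ => True :=
  (reduced_ofReal_one (p := 1) (b := 0) (c := 2) (by norm_num) (by norm_num)).realized_singleton _
    (fits_ofReal_one _ (signCode_of_pos (by norm_num)) (rank_ofReal_eq_one (by norm_num)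
      (by norm_num)) (signCode_of_neg (by norm_num)) dim_ofReal_of_rho
      (signCode_of_pos (by norm_num)) rfl) rfl trivial

/-- In the row with `g = h_12, h_13`, `Δ₂` takes every value `t ≥ 0`. -/
theorem realized_row_twentythree {c : Constants} (hε : c.ε = 1) (hρ : c.ρ = 1) (hA : c.A = 0)
    (hD : c.D = 0) {t : ℝ} (ht : 0 ≤ t) (hB : ‖c.B‖ ^ 2 = t + 1 / 2) (hC : ‖c.C‖ ^ 2 = t + 1 / 2)
    {k : ℕ} (hk : c.HasModel k) : Realized (table.get (22 : Fin 25)) k fun c => |c.Δ₂| = t := by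
  have h2 : c.Δ₂ = t := by
    simp only [Δ₂, hA, hρ, hB, hC]
    simp
    ring
  have h1 : ‖c.Δ₁‖ ^ 2 = (t + 1 / 2) ^ 2 := by
    rw [Δ₁, hA, zero_mul, zero_sub, norm_neg, norm_mul, mul_pow, hB, hC]
    ring
  have hC0 : 0 < ‖c.C‖ := by
    by_contra! h
    have := le_antisymm h (norm_nonneg _)
    rw [this] at hC
    linarith
  have h1' : c.Δ₁ ≠ 0 := by
    intro h
    rw [h, norm_zero] at h1
    nlinarith
  refine (reduced_of_eps_one hε (.inr hρ) hA hD (.inl hρ)).realized_of_hasModel _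
    (fits_of_eps_one _ hε (signCode_rho_one hρ) (rank_X_eq_two h1')
      (signCode_of_pos (by rw [h1, h2]; nlinarith)) (dim_eq_two (not_dependent_of_rho hρ))
      (signCode_of_pos hC0) rfl) hk ?_
  rw [h2, abs_of_nonneg ht]

theorem realized_row_twentythree_twelve {t : ℝ} (ht : 0 ≤ t) :
    Realized (table.get (22 : Fin 25)) 12 fun c => |c.Δ₂| = t := by
  have h1 : Real.sqrt (t + 1 / 4) ^ 2 = t + 1 / 4 := Real.sq_sqrt (by linarith)
  have h2 : Real.sqrt (t + 1 / 2) ^ 2 = t + 1 / 2 := Real.sq_sqrt (by linarith)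
  -- The real part `1/2` makes `|1 - B| = |B| = |C|`, hence `det N = 0`.
  let c : Constants := ⟨1, 1, 0, ⟨1 / 2, Real.sqrt (t + 1 / 4)⟩, Real.sqrt (t + 1 / 2), 0⟩
  have hB : ‖c.B‖ ^ 2 = t + 1 / 2 := by
    rw [norm_sq_eq]
    linear_combination h1
  have hC : ‖c.C‖ ^ 2 = t + 1 / 2 := by
    rw [norm_sq_eq]
    simpa [c] using h2
  refine realized_row_twentythree (c := c) rfl rfl rfl rfl ht hB hC ((hasModel_of_pos rfl (.inr rfl)
    rfl rfl ?_).1 ?_)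
  · have h3 : c.Δ₂ = t := by
      simp only [Δ₂, hB, hC]
      simp [c]
      ring
    rw [h3, Δ₁, norm_sub_rev, show c.A = 0 from rfl, zero_mul, sub_zero, norm_mul, mul_pow, hB, hC]
    nlinarith
  · rw [det_matN]
    simp only [c, Complex.one_re, Complex.ofReal_re, Complex.ofReal_im]
    linear_combination h1 - h2

theorem realized_row_twentythree_thirteen {t : ℝ} (ht : 0 ≤ t) :
    Realized (table.get (22 : Fin 25)) 13 fun c => |c.Δ₂| = t := by
  have h2 : Real.sqrt (t + 1 / 2) ^ 2 = t + 1 / 2 := Real.sq_sqrt (by linarith)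
  -- For real `B` with `|B| = |C|` one has `det N = 1 - 2B`, which is nonzero since `B² ≥ 1/2`.
  let c : Constants := ⟨1, 1, 0, Real.sqrt (t + 1 / 2), Real.sqrt (t + 1 / 2), 0⟩
  have hB : ‖c.B‖ ^ 2 = t + 1 / 2 := by
    rw [norm_sq_eq]
    simpa [c] using h2
  have hC : ‖c.C‖ ^ 2 = t + 1 / 2 := hB
  refine realized_row_twentythree (c := c) rfl rfl rfl rfl ht hB hC ((hasModel_of_pos rfl (.inr rfl)
    rfl rfl ?_).2 ?_)
  · have h3 : c.Δ₂ = t := by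
      simp only [Δ₂, hB, hC]
      simp [c]
      ring
    rw [h3, Δ₁, norm_sub_rev, show c.A = 0 from rfl, zero_mul, sub_zero, norm_mul, mul_pow, hB]
    nlinarith
  · rw [det_matN]
    simp only [c, Complex.one_re, Complex.ofReal_re, Complex.ofReal_im]
    intro h
    have h3 : Real.sqrt (t + 1 / 2) = 1 / 2 := by linear_combination -h / 2
    rw [h3] at h2
    linarith

theorem realized_row_twentyfour_eleven : Realized (table.get (23 : Fin 25)) 11 fun _ => True := by
  refine (reduced_ofReal_one (p := 1) (b := 2) (c := 1) (by norm_num)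
    (by norm_num)).realized_of_hasModel _
    (fits_ofReal_one _ (signCode_of_pos (by norm_num))
      (rank_X_eq_two (Δ₁_ofReal_ne (by norm_num))) (signCode_of_eq (by norm_num))
      dim_ofReal_of_rho (signCode_of_pos (by norm_num)) rfl)
    ((hasModel_of_zero Complex.ofReal_one Complex.ofReal_zero Complex.ofReal_zero
      Complex.ofReal_one ?_ ?_ ?_).1 ?_) trivial
  · simp [ofReal]
  · simp [ofReal]
  · rw [diff_ofReal]; norm_num
  · rw [det_matN]
    norm_num [ofReal]

theorem realized_row_twentyfour_fourteen : Realized (table.get (23 : Fin 25)) 14 fun _ => True := by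
  refine (reduced_ofReal_one (p := 1) (b := 1) (c := 2) (by norm_num)
    (by norm_num)).realized_of_hasModel _
    (fits_ofReal_one _ (signCode_of_pos (by norm_num))
      (rank_X_eq_two (Δ₁_ofReal_ne (by norm_num))) (signCode_of_eq (by norm_num))
      dim_ofReal_of_rho (signCode_of_pos (by norm_num)) rfl)
    ((hasModel_of_zero Complex.ofReal_one Complex.ofReal_zero Complex.ofReal_zero
      Complex.ofReal_one ?_ ?_ ?_).2 ?_) trivial
  · simp [ofReal]
  · simp [ofReal]
  · rw [diff_ofReal]; norm_num
  · rw [det_matN]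
    norm_num [ofReal]

theorem realized_row_twentyfive : Realized (table.get (24 : Fin 25)) 15 fun _ => True :=
  (reduced_ofReal_one (p := 1) (b := 1) (c := 3) (by norm_num) (by norm_num)).realized_singleton _
    (fits_ofReal_one _ (signCode_of_pos (by norm_num))
      (rank_X_eq_two (Δ₁_ofReal_ne (by norm_num))) (signCode_of_neg (by norm_num))
      dim_ofReal_of_rho (signCode_of_pos (by norm_num)) rfl) rfl trivial

end Constants

/-- The algebra `h_k` occurs in the row `r`, and each unconstrained entry is unconstrained. -/
def Realizable (r : Row) (k : ℕ) : Prop :=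
  Realized r k (fun _ => True) ∧
    (r.Δ₂ = Entry.free → ∀ t : ℝ, 0 ≤ t → Realized r k fun c => |c.Δ₂| = t) ∧
    (r.B = Entry.free → ∀ t : ℝ, 0 ≤ t → Realized r k fun c => ‖c.B‖ = t) ∧
    (r.C = Entry.free → ∀ t : ℝ, 0 ≤ t → Realized r k fun c => ‖c.C‖ = t)

theorem Realizable.of_diagonal {r : Row} {k : ℕ} (hr : r.Δ₂.code ≠ 3)
    (h : ∀ t : ℝ, Realized r k fun c => ‖c.B‖ = |t| ∧ ‖c.C‖ = |t|) : Realizable r k := by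
  refine ⟨(h 0).mono fun _ _ => trivial, fun h2 => absurd (congrArg Entry.code h2) hr,
    fun _ t ht => (h t).mono ?_, fun _ t ht => (h t).mono ?_⟩
  · rintro c ⟨hB, -⟩
    rw [hB, abs_of_nonneg ht]
  · rintro c ⟨-, hC⟩
    rw [hC, abs_of_nonneg ht]

/-- Taking `(b, c)` to be `(t, t + 1)` or `(t + 1, t)` lets either modulus be any `t ≥ 0`. Code `3`
is the unconstrained entry. -/
theorem Realizable.of_shifted {r : Row} {k : ℕ} (hr : r.Δ₂.code ≠ 3)
    (h : ∀ b c : ℝ, (b - c) ^ 2 = 1 → 0 ≤ b → 0 ≤ c →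
      Realized r k fun k => ‖k.B‖ = |b| ∧ ‖k.C‖ = |c|) : Realizable r k := by
  refine ⟨(h 1 0 (by norm_num) (by norm_num) le_rfl).mono fun _ _ => trivial,
    fun h2 => absurd (congrArg Entry.code h2) hr,
    fun _ t ht => (h t (t + 1) (by ring) ht (by linarith)).mono ?_,
    fun _ t ht => (h (t + 1) t (by ring) (by linarith) ht).mono ?_⟩
  · rintro c ⟨hB, -⟩
    rw [hB, abs_of_nonneg ht]
  · rintro c ⟨-, hC⟩
    rw [hC, abs_of_nonneg ht]

theorem Realizable.of_fixed {r : Row} {k : ℕ}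
    (hr : r.Δ₂.code ≠ 3 ∧ r.B.code ≠ 3 ∧ r.C.code ≠ 3)
    (h : Realized r k fun _ => True) : Realizable r k :=
  ⟨h, fun h2 => absurd (congrArg Entry.code h2) hr.1,
    fun h2 => absurd (congrArg Entry.code h2) hr.2.1,
    fun h2 => absurd (congrArg Entry.code h2) hr.2.2⟩

theorem Realizable.of_Δ₂ {r : Row} {k : ℕ} (hr : r.B.code ≠ 3 ∧ r.C.code ≠ 3)
    (h : ∀ t : ℝ, 0 ≤ t → Realized r k fun c => |c.Δ₂| = t) : Realizable r k :=
  ⟨(h 0 le_rfl).mono fun _ _ => trivial, fun _ => h,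
    fun h2 => absurd (congrArg Entry.code h2) hr.1,
    fun h2 => absurd (congrArg Entry.code h2) hr.2⟩

theorem Realizable.of_diagonal_Δ₂ {r : Row} {k : ℕ} {s : ℝ} (hs : 0 ≤ s)
    (h : ∀ t : ℝ, Realized r k fun c => ‖c.B‖ = |t| ∧ ‖c.C‖ = |t| ∧ c.Δ₂ = t ^ 2 - s) :
    Realizable r k := by
  refine ⟨(h 0).mono fun _ _ => trivial, fun _ t ht => (h (Real.sqrt (t + s))).mono ?_,
    fun _ t ht => (h t).mono ?_, fun _ t ht => (h t).mono ?_⟩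
  · rintro c ⟨-, -, h2⟩
    rw [h2, Real.sq_sqrt (by linarith), add_sub_cancel_right, abs_of_nonneg ht]
  · rintro c ⟨hB, -, -⟩
    rw [hB, abs_of_nonneg ht]
  · rintro c ⟨-, hC, -⟩
    rw [hC, abs_of_nonneg ht]

open Constants in
theorem realizable_of_mem_table : ∀ r ∈ table, ∀ k ∈ r.g, Realizable r k := by
  rw [table]
  simp only [List.forall_mem_cons, List.not_mem_nil, IsEmpty.forall_iff, implies_true, and_true]
  refine ⟨.of_fixed (by decide) realized_row_one,
    .of_diagonal (by decide) realized_row_two,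
    .of_shifted (by decide) fun b c h _ _ => realized_row_three h,
    .of_diagonal_Δ₂ le_rfl fun t => ?_,
    .of_diagonal (by decide) realized_row_five,
    .of_shifted (by decide) fun b c h hb hc => realized_row_six h hb hc,
    .of_shifted (by decide) fun b c h hb hc => realized_row_seven h hb hc,
    .of_fixed (by decide) realized_row_eight,
    .of_shifted (by decide) fun b c h _ _ => realized_row_nine h,
    .of_diagonal (by decide) realized_row_ten,
    .of_diagonal_Δ₂ one_half_pos.le realized_row_eleven,
    .of_diagonal (by decide) realized_row_twelve,
    .of_diagonal (by decide) realized_row_thirteen,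
    .of_fixed (by decide) realized_row_fourteen,
    .of_fixed (by decide) realized_row_fifteen,
    .of_fixed (by decide) realized_row_sixteen,
    .of_fixed (by decide) realized_row_seventeen,
    .of_fixed (by decide) realized_row_eighteen,
    ⟨.of_fixed (by decide) realized_row_nineteen_seven,
      .of_fixed (by decide) realized_row_nineteen_sixteen⟩,
    .of_fixed (by decide) realized_row_twenty,
    .of_fixed (by decide) realized_row_twentyone,
    .of_fixed (by decide) realized_row_twentytwo,
    ⟨.of_Δ₂ (by decide) fun t ht => realized_row_twentythree_twelve ht,
      .of_Δ₂ (by decide) fun t ht => realized_row_twentythree_thirteen ht⟩,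
    ⟨.of_fixed (by decide) realized_row_twentyfour_eleven,
      .of_fixed (by decide) realized_row_twentyfour_fourteen⟩,
    .of_fixed (by decide) realized_row_twentyfive⟩
  refine (realized_row_four t).mono ?_
  rintro c ⟨hB, hC, h⟩
  exact ⟨hB, hC, by rw [h, sub_zero]⟩

/-! ### Existence of a reduced basis -/

section Existence

variable {g : Type*} [LieRing g] [LieAlgebra ℝ g] {J : g →ₗ[ℝ] g}

theorem IsReduced.of_form {ω : Module.Basis (Fin 3) ℂ (forms10 J)} {c : Constants}
    (hc : c.Reduced) (h0 : ∀ x y, dForm (ω 0 : g →ₗ[ℝ] ℂ) x y = 0)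
    (h1 : ∀ x y, dForm (ω 1 : g →ₗ[ℝ] ℂ) x y =
      c.ε * (coord ω x 0 * conj (coord ω y 0) - coord ω y 0 * conj (coord ω x 0)))
    (h2 : ∀ x y, dForm (ω 2 : g →ₗ[ℝ] ℂ) x y = c.form (coord ω x) (coord ω y)) :
    IsReduced ω c where
  eps := hc.eps
  rho := hc.rho
  coeff := hc.coeff
  nonzero hε h := by
    have hf : ∀ x y, c.form x y = 0 := by
      intro x y
      obtain ⟨x, rfl⟩ := coord_surjective ω x
      obtain ⟨y, rfl⟩ := coord_surjective ω y
      rw [← h2, h]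
      rfl
    obtain ⟨hρ, hX⟩ := Constants.form_eq_zero_iff.1 hf
    obtain h | h | h := hc.nonzero hε
    · exact one_ne_zero (h.symm.trans hρ)
    · exact h (congrFun₂ hX 0 1)
    · exact h (congrFun₂ hX 1 0)
  d_one := LinearMap.ext₂ h0
  d_two := LinearMap.ext₂ h1
  d_three := LinearMap.ext₂ fun x y => by
    rw [h2]
    simp only [LinearMap.add_apply, LinearMap.smul_apply, wedge_apply, conjForm_apply, smul_eq_mul]
    rfl

/-- The 2-forms spanned by products of the forms `ω 0`, `ω 1` and their conjugates. -/
theorem exists_coeff_of_mem_span {ω : Module.Basis (Fin 3) ℂ (forms10 J)}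
    {β : g →ₗ[ℝ] g →ₗ[ℝ] ℂ} (hβ : β ∈ Submodule.span ℂ {β : g →ₗ[ℝ] g →ₗ[ℝ] ℂ |
      ∃ a b : g →ₗ[ℝ] ℂ, (∃ i < (2 : Fin 3), a = ω i ∨ a = conjForm (ω i)) ∧
        (∃ j < (2 : Fin 3), b = ω j ∨ b = conjForm (ω j)) ∧ β = wedge a b}) :
    ∃ (c : Constants) (E : ℂ), ∀ x y, β x y = c.form (coord ω x) (coord ω y) +
      E * (conj (coord ω x 0) * conj (coord ω y 1) - conj (coord ω y 0) * conj (coord ω x 1)) := by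
  have hlin (a : g →ₗ[ℝ] ℂ) (ha : ∃ i < (2 : Fin 3), a = ω i ∨ a = conjForm (ω i)) :
      ∃ p q r s : ℂ, ∀ x, a x = p * coord ω x 0 + q * coord ω x 1 + r * conj (coord ω x 0) +
        s * conj (coord ω x 1) := by
    obtain ⟨i, hi, h⟩ := ha
    obtain rfl | rfl : i = 0 ∨ i = 1 := by omega
    all_goals obtain rfl | rfl := h
    · exact ⟨1, 0, 0, 0, fun x => by simp [coord_apply]⟩
    · exact ⟨0, 0, 1, 0, fun x => by simp [coord_apply, conjForm_apply]⟩
    · exact ⟨0, 1, 0, 0, fun x => by simp [coord_apply]⟩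
    · exact ⟨0, 0, 0, 1, fun x => by simp [coord_apply, conjForm_apply]⟩
  induction hβ using Submodule.span_induction with
  | mem β h =>
    obtain ⟨a, b, ha, hb, rfl⟩ := h
    obtain ⟨p, q, r, s, ha⟩ := hlin a ha
    obtain ⟨p', q', r', s', hb⟩ := hlin b hb
    refine ⟨⟨0, p * q' - q * p', p * r' - r * p', p * s' - s * p', q * r' - r * q',
      q * s' - s * q'⟩, r * s' - s * r', fun x y => ?_⟩
    rw [wedge_apply, ha, ha, hb, hb, Constants.form]
    ring
  | zero => exact ⟨⟨0, 0, 0, 0, 0, 0⟩, 0, fun x y => by simp [Constants.form]⟩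
  | add β γ _ _ hβ hγ =>
    obtain ⟨c, E, h⟩ := hβ
    obtain ⟨c', E', h'⟩ := hγ
    refine ⟨⟨0, c.ρ + c'.ρ, c.A + c'.A, c.B + c'.B, c.C + c'.C, c.D + c'.D⟩, E + E',
      fun x y => ?_⟩
    rw [LinearMap.add_apply, LinearMap.add_apply, h, h', Constants.form, Constants.form,
      Constants.form]
    ring
  | smul t β _ hβ =>
    obtain ⟨c, E, h⟩ := hβ
    refine ⟨⟨0, t * c.ρ, t * c.A, t * c.B, t * c.C, t * c.D⟩, t * E, fun x y => ?_⟩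
    rw [LinearMap.smul_apply, LinearMap.smul_apply, h, Constants.form, Constants.form, smul_eq_mul]
    ring

/-- The 2-forms spanned by products of `ω 0` and its conjugate. -/
theorem exists_coeff_of_mem_span_one {ω : Module.Basis (Fin 3) ℂ (forms10 J)}
    {β : g →ₗ[ℝ] g →ₗ[ℝ] ℂ} (hβ : β ∈ Submodule.span ℂ {β : g →ₗ[ℝ] g →ₗ[ℝ] ℂ |
      ∃ a b : g →ₗ[ℝ] ℂ, (∃ i < (1 : Fin 3), a = ω i ∨ a = conjForm (ω i)) ∧
        (∃ j < (1 : Fin 3), b = ω j ∨ b = conjForm (ω j)) ∧ β = wedge a b}) :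
    ∃ e : ℂ, ∀ x y, β x y =
      e * (coord ω x 0 * conj (coord ω y 0) - coord ω y 0 * conj (coord ω x 0)) := by
  have hlin (a : g →ₗ[ℝ] ℂ) (ha : ∃ i < (1 : Fin 3), a = ω i ∨ a = conjForm (ω i)) :
      ∃ p r : ℂ, ∀ x, a x = p * coord ω x 0 + r * conj (coord ω x 0) := by
    obtain ⟨i, hi, h⟩ := ha
    obtain rfl : i = 0 := by omega
    obtain rfl | rfl := h
    · exact ⟨1, 0, fun x => by simp [coord_apply]⟩
    · exact ⟨0, 1, fun x => by simp [coord_apply, conjForm_apply]⟩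
  induction hβ using Submodule.span_induction with
  | mem β h =>
    obtain ⟨a, b, ha, hb, rfl⟩ := h
    obtain ⟨p, r, ha⟩ := hlin a ha
    obtain ⟨p', r', hb⟩ := hlin b hb
    refine ⟨p * r' - r * p', fun x y => ?_⟩
    rw [wedge_apply, ha, ha, hb, hb]
    ring
  | zero => exact ⟨0, fun x y => by simp⟩
  | add β γ _ _ hβ hγ =>
    obtain ⟨e, h⟩ := hβ
    obtain ⟨e', h'⟩ := hγ
    refine ⟨e + e', fun x y => ?_⟩
    rw [LinearMap.add_apply, LinearMap.add_apply, h, h']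
    ring
  | smul t β _ hβ =>
    obtain ⟨e, h⟩ := hβ
    refine ⟨t * e, fun x y => ?_⟩
    rw [LinearMap.smul_apply, LinearMap.smul_apply, h, smul_eq_mul]
    ring

theorem eq_zero_of_span_zero {ω : Module.Basis (Fin 3) ℂ (forms10 J)}
    {β : g →ₗ[ℝ] g →ₗ[ℝ] ℂ} (hβ : β ∈ Submodule.span ℂ {β : g →ₗ[ℝ] g →ₗ[ℝ] ℂ |
      ∃ a b : g →ₗ[ℝ] ℂ, (∃ i < (0 : Fin 3), a = ω i ∨ a = conjForm (ω i)) ∧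
        (∃ j < (0 : Fin 3), b = ω j ∨ b = conjForm (ω j)) ∧ β = wedge a b}) : β = 0 := by
  rw [← Submodule.mem_bot ℂ, ← Submodule.span_empty]
  convert hβ
  symm
  rw [Set.eq_empty_iff_forall_notMem]
  rintro _ ⟨a, b, ⟨i, hi, -⟩, -⟩
  exact absurd hi (Fin.not_lt_zero i)

/-- A basis `ω` with structure equations that are reduced up to normalization. -/
structure IsPreReduced (ω : Module.Basis (Fin 3) ℂ (forms10 J)) (c : Constants) : Prop where
  d_one : ∀ x y, dForm (ω 0 : g →ₗ[ℝ] ℂ) x y = 0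
  d_two : ∀ x y, dForm (ω 1 : g →ₗ[ℝ] ℂ) x y =
    c.ε * (coord ω x 0 * conj (coord ω y 0) - coord ω y 0 * conj (coord ω x 0))
  d_three : ∀ x y, dForm (ω 2 : g →ₗ[ℝ] ℂ) x y = c.form (coord ω x) (coord ω y)

theorem IsPreReduced.coord_lie {ω : Module.Basis (Fin 3) ℂ (forms10 J)} {c : Constants}
    (h : IsPreReduced ω c) (x y : g) :
    coord ω ⁅x, y⁆ = c.bracket (coord ω x) (coord ω y) := by
  funext i
  have h0 := h.d_one x y
  have h1 := h.d_two x y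
  have h2 := h.d_three x y
  rw [dForm_apply] at h0 h1 h2
  fin_cases i
  · exact neg_eq_zero.1 h0
  · exact neg_eq_iff_eq_neg.1 h1
  · exact neg_eq_iff_eq_neg.1 h2

/-- Since `d² ω³ = 0`, and the `D` term contributes `Dε ω¹ ∧ conj ω¹ ∧ conj ω²`, which no other term
can cancel. -/
theorem IsPreReduced.D_eq_zero {ω : Module.Basis (Fin 3) ℂ (forms10 J)} {c : Constants}
    (h : IsPreReduced ω c) (hε : c.ε ≠ 0) : c.D = 0 := by
  have jac (x y z : Fin 3 → ℂ) : c.bracket x (c.bracket y z) =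
      c.bracket (c.bracket x y) z + c.bracket y (c.bracket x z) := by
    obtain ⟨x, rfl⟩ := coord_surjective ω x
    obtain ⟨y, rfl⟩ := coord_surjective ω y
    obtain ⟨z, rfl⟩ := coord_surjective ω z
    simp only [← h.coord_lie, ← map_add]
    rw [leibniz_lie]
  have h1 := congrFun (jac ![1, 0, 0] ![Complex.I, 0, 0] ![0, 1, 0]) 2
  have h2 := congrFun (jac ![1, 0, 0] ![Complex.I, 0, 0] ![0, Complex.I, 0]) 2
  simp [Constants.form, -mul_eq_zero] at h1 h2
  refine (mul_eq_zero.1 (?_ : c.D * c.ε = 0)).resolve_right hε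
  linear_combination (h2 - Complex.I * h1) / 4 + c.D * c.ε * Complex.I_mul_I

theorem exists_isPreReduced (hJ : IsNilpotentComplexStructure J)
    (hg : Module.finrank ℝ g = 6) :
    ∃ (ω : Module.Basis (Fin 3) ℂ (forms10 J)) (c : Constants), IsPreReduced ω c := by
  obtain ⟨m, ω, hω⟩ := hJ.exists_basis
  obtain rfl := card_eq_three hJ.sq ω hg
  obtain ⟨e, he⟩ := exists_coeff_of_mem_span_one (hω 1)
  obtain ⟨c, E, hc⟩ := exists_coeff_of_mem_span (hω 2)
  -- Applying `ω³` to the integrability condition extracts four times the `(0,2)` part of `dω³`; on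
  -- the chosen vectors that part is `E`.
  have hE : E = 0 := by
    obtain ⟨x, hx⟩ := coord_surjective ω ![1, 0, 0]
    obtain ⟨y, hy⟩ := coord_surjective ω ![0, 1, 0]
    have h := congrArg (ω 2 : g →ₗ[ℝ] ℂ) (hJ.integrable x y)
    simp only [map_add, map_sub, map_zero, (ω 2).2 _] at h
    have h1 := hc x y
    have h2 := hc (J x) y
    have h3 := hc x (J y)
    have h4 := hc (J x) (J y)
    simp only [dForm_apply, coord_J, hx, hy] at h1 h2 h3 h4
    simp [Constants.form, -mul_eq_zero] at h1 h2 h3 h4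
    linear_combination -(h1 + Complex.I * h2 + Complex.I * h3 - h4) / 4 - h / 4 -
      (c.ρ - E) / 2 * Complex.I_mul_I
  refine ⟨ω, ⟨e, c.ρ, c.A, c.B, c.C, c.D⟩, fun x y => ?_, he, fun x y => ?_⟩
  · rw [eq_zero_of_span_zero (hω 0)]
    rfl
  · rw [hc, hE, zero_mul, add_zero]
    rfl

theorem exists_basis_of_triangular (ω : Module.Basis (Fin 3) ℂ (forms10 J)) {s r : ℂ} (t : ℂ)
    (hs : s ≠ 0) (hr : r ≠ 0) : ∃ ω' : Module.Basis (Fin 3) ℂ (forms10 J),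
      ω' 0 = ω 0 ∧ ω' 1 = s • ω 1 ∧ ω' 2 = r • ω 2 + t • ω 1 := by
  have hind : LinearIndependent ℂ ![ω 0, s • ω 1, r • ω 2 + t • ω 1] := by
    rw [Fintype.linearIndependent_iff]
    intro k hk
    have h := Fintype.linearIndependent_iff.1 ω.linearIndependent
      ![k 0, k 1 * s + k 2 * t, k 2 * r] (by
        rw [← hk]
        simp only [Fin.sum_univ_three, Matrix.cons_val]
        module)
    have h0 := h 0
    have h1 := h 1
    have h2 := h 2
    simp only [Matrix.cons_val] at h0 h1 h2
    have h2' := (mul_eq_zero.1 h2).resolve_right hr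
    rw [h2', zero_mul, add_zero] at h1
    intro i
    fin_cases i
    exacts [h0, (mul_eq_zero.1 h1).resolve_right hs, h2']
  have hcard : Fintype.card (Fin 3) = Module.finrank ℂ (forms10 J) := by
    rw [Module.finrank_eq_card_basis ω]
  refine ⟨basisOfLinearIndependentOfCardEqFinrank hind hcard, ?_, ?_, ?_⟩ <;>
    rw [coe_basisOfLinearIndependentOfCardEqFinrank] <;> rfl

theorem exists_isReduced (hJ : IsNilpotentComplexStructure J) (hg : Module.finrank ℝ g = 6) :
    ∃ (ω : Module.Basis (Fin 3) ℂ (forms10 J)) (c : Constants), IsReduced ω c := by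
  obtain ⟨ω, c, h⟩ := exists_isPreReduced hJ hg
  have hform (x y : g) := h.d_three x y
  by_cases hε : c.ε = 0
  · obtain ⟨r, hr, hrρ⟩ : ∃ r : ℂ, r ≠ 0 ∧ (r * c.ρ = 0 ∨ r * c.ρ = 1) := by
      by_cases hρ : c.ρ = 0
      · exact ⟨1, one_ne_zero, .inl (by rw [hρ, mul_zero])⟩
      · exact ⟨c.ρ⁻¹, inv_ne_zero hρ, .inr (inv_mul_cancel₀ hρ)⟩
    obtain ⟨ω', h0, h1, h2⟩ := exists_basis_of_triangular ω 0 one_ne_zero hr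
    refine ⟨ω', ⟨0, r * c.ρ, r * c.A, r * c.B, r * c.C, r * c.D⟩,
      IsReduced.of_form (Constants.reduced_of_eps_zero rfl hrρ) ?_ ?_ ?_⟩ <;> intro x y
    · rw [h0, h.d_one]
    · have := h.d_two x y
      rw [hε, zero_mul] at this
      rw [h1, one_smul, this, zero_mul]
    · have := hform x y
      rw [dForm_apply] at this ⊢
      simp only [Constants.form, coord_apply] at this ⊢
      rw [h0, h1, h2]
      simp only [Submodule.coe_add, Submodule.coe_smul, LinearMap.add_apply, LinearMap.smul_apply,
        smul_eq_mul, one_smul]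
      linear_combination r * this
  have hD := h.D_eq_zero hε
  have hε' : conj c.ε ≠ 0 := by simpa using hε
  obtain ⟨r, hr, hrρ⟩ : ∃ r : ℂ, r ≠ 0 ∧ (r * c.ρ * c.ε = 0 ∨ r * c.ρ * c.ε = 1) := by
    by_cases hρ : c.ρ = 0
    · exact ⟨1, one_ne_zero, .inl (by rw [hρ]; ring)⟩
    · exact ⟨(c.ρ * c.ε)⁻¹, inv_ne_zero (mul_ne_zero hρ hε), .inr (by field_simp)⟩
  -- Dividing `ω²` by `ε` normalizes `dω²`, and the multiple of `ω²` added to `r ω³` cancels the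
  -- coefficient `A`.
  obtain ⟨ω', h0, h1, h2⟩ :=
    exists_basis_of_triangular ω (-(r * c.A / c.ε)) (inv_ne_zero hε) hr
  have hd0 (x y : g) : dForm (ω' 0 : g →ₗ[ℝ] ℂ) x y = 0 := by rw [h0, h.d_one]
  have hd1 (x y : g) : dForm (ω' 1 : g →ₗ[ℝ] ℂ) x y =
      (ω' 0 : g →ₗ[ℝ] ℂ) x * conj ((ω' 0 : g →ₗ[ℝ] ℂ) y) -
        (ω' 0 : g →ₗ[ℝ] ℂ) y * conj ((ω' 0 : g →ₗ[ℝ] ℂ) x) := by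
    have := h.d_two x y
    rw [dForm_apply] at this ⊢
    simp only [coord_apply] at this
    rw [h0, h1]
    simp only [Submodule.coe_smul, LinearMap.smul_apply, smul_eq_mul]
    field_simp
    linear_combination this
  have hd2 (x y : g) : dForm (ω' 2 : g →ₗ[ℝ] ℂ) x y =
      (⟨1, r * c.ρ * c.ε, 0, r * c.B * conj c.ε, r * c.C * c.ε, 0⟩ : Constants).form
        (coord ω' x) (coord ω' y) := by
    have hy1 := h.d_two x y
    have hy2 := hform x y
    rw [dForm_apply] at hy1 hy2 ⊢
    simp only [Constants.form, coord_apply, hD] at hy1 hy2 ⊢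
    rw [h0, h1, h2]
    simp only [Submodule.coe_add, Submodule.coe_smul, LinearMap.add_apply, LinearMap.smul_apply,
      smul_eq_mul, map_mul, map_inv₀]
    field_simp
    linear_combination conj c.ε * (r * c.ε * hy2 - r * c.A * hy1)
  by_cases hne : r * c.ρ * c.ε = 1 ∨ r * c.B * conj c.ε ≠ 0 ∨ r * c.C * c.ε ≠ 0
  · refine ⟨ω', _, IsReduced.of_form (Constants.reduced_of_eps_one rfl hrρ rfl rfl hne) hd0 ?_ hd2⟩
    intro x y
    rw [hd1, one_mul]
    rfl
  -- Here the new `ω³` is closed, so it changes places with `ω²`. The basis is then reduced with `ε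
  -- = 0` and `A = 1`.
  · push Not at hne
    refine ⟨ω'.reindex (Equiv.swap 1 2), ⟨0, 0, 1, 0, 0, 0⟩,
      IsReduced.of_form (Constants.reduced_of_eps_zero rfl (.inl rfl)) ?_ ?_ ?_⟩ <;> intro x y
    · rw [Module.Basis.reindex_apply, show (Equiv.swap (1 : Fin 3) 2).symm 0 = 0 by decide, hd0]
    · rw [Module.Basis.reindex_apply, show (Equiv.swap (1 : Fin 3) 2).symm 1 = 2 by decide, hd2,
        hne.2.1, hne.2.2, hrρ.resolve_right hne.1]
      simp [Constants.form]
    · rw [Module.Basis.reindex_apply, show (Equiv.swap (1 : Fin 3) 2).symm 2 = 1 by decide, hd1]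
      simp only [Constants.form, coord_apply, Module.Basis.reindex_apply,
        show (Equiv.swap (1 : Fin 3) 2).symm 0 = 0 by decide]
      ring

end Existence

end NilCx

end

/-! ### The classification theorem. -/

theorem mainTheorem2 :
    (∀ (g : Type*) [LieRing g] [LieAlgebra ℝ g] [LieRing.IsNilpotent g],
      Module.finrank ℝ g = 6 →
      ∀ (J : g →ₗ[ℝ] g) (hJ : NilCx.IsNilpotentComplexStructure J),
        (∃ (ω : Module.Basis (Fin 3) ℂ (NilCx.forms10 J)) (c : NilCx.Constants),
          NilCx.IsReduced ω c) ∧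
        ∀ (ω : Module.Basis (Fin 3) ℂ (NilCx.forms10 J)) (c : NilCx.Constants),
          NilCx.IsReduced ω c →
          (∃! r : NilCx.Row, r ∈ NilCx.table ∧ r.Holds ω c) ∧
          ∀ r ∈ NilCx.table, r.Holds ω c →
            Nonempty (NilCx.f1 J hJ.toIsComplexStructure ≃ₗ⁅ℂ⁆
              TensorProduct ℝ ℂ (NilCx.NilAlg r.f)) ∧
            (∃ k ∈ r.g, Nonempty (g ≃ₗ⁅ℝ⁆ NilCx.NilAlg k)) ∧
            (∀ k ∈ Finset.Icc 1 16, Nonempty (g ≃ₗ⁅ℝ⁆ NilCx.NilAlg k) → k ∈ r.g)) ∧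
    (∀ r ∈ NilCx.table, ∀ k ∈ r.g,
      NilCx.Realized r k (fun _ => True) ∧
      (r.Δ₂ = NilCx.Entry.free → ∀ t : ℝ, 0 ≤ t → NilCx.Realized r k (fun c => |c.Δ₂| = t)) ∧
      (r.B = NilCx.Entry.free → ∀ t : ℝ, 0 ≤ t → NilCx.Realized r k (fun c => ‖c.B‖ = t)) ∧
      (r.C = NilCx.Entry.free → ∀ t : ℝ, 0 ≤ t → NilCx.Realized r k (fun c => ‖c.C‖ = t))) := by
  refine ⟨fun g _ _ _ hg J hJ => ⟨NilCx.exists_isReduced hJ hg, fun ω c h =>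
    ⟨h.existsUnique_row, fun r hr hrc => h.isomorphisms hJ.toIsComplexStructure hr hrc⟩⟩,
    NilCx.realizable_of_mem_table⟩
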